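/- **Online submodular cover.** Let $N$ be a finite universe with $n$ elements, with a cost $c(j)\ge 0$ for every $j\in N$, and write $c(S)=\sum_{j\in S}c(j)$. Let $f^{(1)},f^{(2)},\dots$ be functions $2^N\to\mathbb R_{\ge 0}$ that are monotone ($f(A)\le f(B)$ for $A\subseteq B$) and submodular ($f(A\cap B)+f(A\cup B)\le f(A)+f(B)$). A set $S\subseteq N$ is a *cover* for $f$ if $f(S)=f(N)$. The sequence is *time-monotone* if, for every $t\ge 1$, each cover for $f^{(t+1)}$ is a cover for $f^{(t)}$. An online algorithm is given $N$ and $c$ in advance; at time $t=1,2,\dots$ it receives a value oracle for $f^{(t)}$ and has to output a cover $S_t$ for $f^{(t)}$ with $S_{t-1}\subseteq S_t$ (where $S_0=\emptyset$), without knowledge of later functions. For $T\ge 1$ let $$f_{\min}=\min\{f^{(t)}(S\cup\{j\})-f^{(t)}(S) : 1\le t\le T,\ j\in N,\ S\subseteq N,\ f^{(t)}(S\cup\{j\})\ne f^{(t)}(S)\},\qquad f(N)=\max_{1\le t\le T}f^{(t)}(N),$$ and let $\mathrm{OPT}_T$ be the minimum cost of a cover for $f^{(T)}$. **Theorem.**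 There are a randomized online algorithm, a polynomial $p$ and a constant $C>0$ such that the following holds for every $n$, every $c$ and every (fixed in advance) time-monotone sequence of nonnegative monotone submodular functions. At each time $t\ge1$ and for every outcome of its coin tosses, the algorithm stops after at most $p(n+t)$ steps and has extended $S_{t-1}$ to a cover $S_t$ for $f^{(t)}$. Moreover, for every $T\ge 1$, $$\mathbb E[c(S_T)]\ \le\ C\,(1+\ln n)\left(1+\ln\frac{T\cdot f(N)}{f_{\min}}\right)\mathrm{OPT}_T .$$ (If there is no nonzero marginal, or if $n=0$, then $\mathrm{OPT}_T=0$ and the right-hand side is read as $0$.) Here the algorithm is a single program, the same for all inputs, for a randomized real random-access machine. In one step it can: perform an assignment or a test with expressions of bounded size, where natural numbers can be added, subtracted and compared, and real numbers can be added, subtracted, multiplied, divided and compared; toss a coin whose bias is a computed real number; or query the value oracle of the current function on a set that is stored in its memory. -/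

import Mathlib

/-! ## Submodular cover -/

namespace OnlineCover

/-- A nonnegative monotone submodular set function on subsets of `Fin n`. -/
structure IsMonotoneSubmodular {n : ℕ} (f : Finset (Fin n) → ℝ) : Prop where
  nonneg : ∀ A, 0 ≤ f A
  mono : ∀ A B, A ⊆ B → f A ≤ f B
  submod : ∀ A B, f (A ∩ B) + f (A ∪ B) ≤ f A + f B

/-- `S` is a submodular cover for `f`. -/
def IsCover {n : ℕ} (f : Finset (Fin n) → ℝ) (S : Finset (Fin n)) : Prop :=
  f S = f Finset.univ

/-- The sequence `f 1, f 2, …` is time-monotone. The entry `f 0` plays no role. -/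
def TimeMonotone {n : ℕ} (f : ℕ → Finset (Fin n) → ℝ) : Prop :=
  ∀ t, 1 ≤ t → ∀ S, IsCover (f (t + 1)) S → IsCover (f t) S

/-- The linear cost of a set. -/
def cost {n : ℕ} (c : Fin n → ℝ) (S : Finset (Fin n)) : ℝ := ∑ j ∈ S, c j

/-- The minimum cost of a cover; the minimum is over a finite nonempty set, since the whole
universe is a cover. -/
noncomputable def optCost {n : ℕ} (c : Fin n → ℝ) (f : Finset (Fin n) → ℝ) : ℝ :=
  sInf (cost c '' {S | IsCover f S})

/-- The nonzero marginals `f t (j ∣ S)`, `1 ≤ t ≤ T`. -/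
def nonzeroMarginals {n : ℕ} (f : ℕ → Finset (Fin n) → ℝ) (T : ℕ) : Set ℝ :=
  {v | v ≠ 0 ∧ ∃ t ∈ Set.Icc 1 T, ∃ (j : Fin n) (S : Finset (Fin n)),
    v = f t (insert j S) - f t S}

/-- The smallest nonzero marginal among `f 1, …, f T`. (If there is none, then all these functions
are constant, the empty set is an optimal cover, and the value `0` given here is irrelevant.) -/
noncomputable def fMin {n : ℕ} (f : ℕ → Finset (Fin n) → ℝ) (T : ℕ) : ℝ :=
  sInf (nonzeroMarginals f T)

/-- The largest value `f t (N)` for `1 ≤ t ≤ T`. -/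
noncomputable def fTotal {n : ℕ} (f : ℕ → Finset (Fin n) → ℝ) (T : ℕ) : ℝ :=
  sSup ((fun t => f t Finset.univ) '' Set.Icc 1 T)

/-! ## A randomized real random-access machine with a value oracle

The memory consists of arrays of natural numbers and arrays of real numbers. Natural numbers are
used for counters, indices and set membership; they can be added, subtracted (truncated) and
compared, but not multiplied. Real numbers can be added, subtracted, multiplied, divided and
compared; there is no rounding of reals and no real constant other than natural numerals. -/

/-- The memory: `nat a i` and `real a i` are the `i`-th cells of the arrays with name `a`. -/
structure Mem where
  nat : ℕ → ℕ → ℕ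
  real : ℕ → ℕ → ℝ

/-- Expressions with natural value. Array names are fixed in the program, indices are computed. -/
inductive NExp : Type
  | const (k : ℕ)
  | get (a : ℕ) (i : NExp)
  | add (x y : NExp)
  | sub (x y : NExp)

/-- Value of an expression with natural value. -/
def NExp.eval (m : Mem) : NExp → ℕ
  | const k => k
  | get a i => m.nat a (i.eval m)
  | add x y => x.eval m + y.eval m
  | sub x y => x.eval m - y.eval m

/-- Expressions with real value. -/
inductive RExp : Type
  | ofNat (x : NExp)
  | get (a : ℕ) (i : NExp)
  | add (x y : RExp)
  | sub (x y : RExp)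
  | mul (x y : RExp)
  | div (x y : RExp)

/-- Value of an expression with real value (division by zero gives zero). -/
noncomputable def RExp.eval (m : Mem) : RExp → ℝ
  | ofNat x => (x.eval m : ℝ)
  | get a i => m.real a (i.eval m)
  | add x y => x.eval m + y.eval m
  | sub x y => x.eval m - y.eval m
  | mul x y => x.eval m * y.eval m
  | div x y => x.eval m / y.eval m

/-- Tests, used in conditionals and loops. -/
inductive Test : Type
  | ltN (x y : NExp)
  | ltR (x y : RExp)
  | not (b : Test)

/-- Truth of a test. -/
def Test.Holds (m : Mem) : Test → Prop
  | ltN x y => x.eval m < y.eval m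
  | ltR x y => x.eval m < y.eval m
  | not b => ¬ b.Holds m

/-- Programs. A program is a finite syntactic object, so every expression in it has a size that is
bounded by a constant of the program. -/
inductive Cmd : Type
  | skip
  /-- natural assignment `a[i] := x` -/
  | setN (a : ℕ) (i : NExp) (x : NExp)
  /-- real assignment `a[i] := x` -/
  | setR (a : ℕ) (i : NExp) (x : RExp)
  /-- toss a coin with bias `p` and store the outcome, `1` or `0`, in the natural cell `a[i]` -/
  | flip (a : ℕ) (i : NExp) (p : RExp)
  /-- call the value oracle on the set whose indicator is the natural array `s`, and store the
  answer in the real cell `a[i]` -/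
  | query (a : ℕ) (i : NExp) (s : ℕ)
  | seq (p q : Cmd)
  | ite (b : Test) (p q : Cmd)
  | loop (b : Test) (p : Cmd)

/-- Overwrite one natural cell. -/
def Mem.setNat (m : Mem) (a i v : ℕ) : Mem :=
  { m with nat := Function.update m.nat a (Function.update (m.nat a) i v) }

/-- Overwrite one real cell. -/
noncomputable def Mem.setReal (m : Mem) (a i : ℕ) (v : ℝ) : Mem :=
  { m with real := Function.update m.real a (Function.update (m.real a) i v) }

/-- The subset of `Fin n` whose indicator is the natural array `a`. -/
def Mem.readSet (n : ℕ) (m : Mem) (a : ℕ) : Finset (Fin n) :=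
  Finset.univ.filter fun j => m.nat a j ≠ 0

/-- A configuration: the stack of commands still to be executed, and the memory. -/
structure Config where
  todo : List Cmd
  mem : Mem

/-- The machine has halted if nothing remains to be executed. -/
def Config.Halted (x : Config) : Prop := x.todo = []

/-- A coin with bias `p` (cut off to `[0, 1]`). -/
noncomputable def coin (p : ℝ) : PMF Bool :=
  PMF.ofFintype
    (fun b => if b then min 1 (ENNReal.ofReal p) else 1 - min 1 (ENNReal.ofReal p)) (by simp)

open scoped Classical in
/-- One step of the machine, with value oracle `f`. A halted machine stays as it is. -/
noncomputable def step {n : ℕ} (f : Finset (Fin n) → ℝ) : Config → PMF Config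
  | ⟨[], m⟩ => PMF.pure ⟨[], m⟩
  | ⟨.skip :: K, m⟩ => PMF.pure ⟨K, m⟩
  | ⟨.setN a i x :: K, m⟩ => PMF.pure ⟨K, m.setNat a (i.eval m) (x.eval m)⟩
  | ⟨.setR a i x :: K, m⟩ => PMF.pure ⟨K, m.setReal a (i.eval m) (x.eval m)⟩
  | ⟨.flip a i p :: K, m⟩ =>
      (coin (p.eval m)).map fun b => ⟨K, m.setNat a (i.eval m) (if b then 1 else 0)⟩
  | ⟨.query a i s :: K, m⟩ => PMF.pure ⟨K, m.setReal a (i.eval m) (f (m.readSet n s))⟩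
  | ⟨.seq p q :: K, m⟩ => PMF.pure ⟨p :: q :: K, m⟩
  | ⟨.ite b p q :: K, m⟩ => PMF.pure ⟨(if b.Holds m then p else q) :: K, m⟩
  | ⟨.loop b p :: K, m⟩ =>
      PMF.pure (if b.Holds m then ⟨p :: .loop b p :: K, m⟩ else ⟨K, m⟩)

/-- The distribution of the configuration after `k` steps. -/
noncomputable def run {n : ℕ} (f : Finset (Fin n) → ℝ) : ℕ → Config → PMF Config
  | 0, x => PMF.pure x
  | k + 1, x => (step f x).bind (run f k)

/-! ## Online execution -/

/-- The initial memory: the natural array `0` holds `n` in its cell `0`, the real array `0` holds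
the costs, and all other cells are zero. -/
noncomputable def initMem {n : ℕ} (c : Fin n → ℝ) : Mem where
  nat := fun a i => if a = 0 ∧ i = 0 then n else 0
  real := fun a i => if h : a = 0 ∧ i < n then c ⟨i, h.2⟩ else 0

/-- The current solution is kept in the natural array `1`. -/
def solution (n : ℕ) (m : Mem) : Finset (Fin n) := m.readSet n 1

/-- The execution of the program `P` at one time step, for `k` machine steps, started in the memory
`m` that the previous time step has left and with the value oracle of the current function only. -/
noncomputable def stage {n : ℕ} (P : Cmd) (f : Finset (Fin n) → ℝ) (k : ℕ) (m : Mem) :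
    PMF Config :=
  run f k ⟨[P], m⟩

/-- The distribution of the memory after time step `t`, if time step `s` is run for `k s` machine
steps. -/
noncomputable def memAfter {n : ℕ} (P : Cmd) (k : ℕ → ℕ) (c : Fin n → ℝ)
    (f : ℕ → Finset (Fin n) → ℝ) : ℕ → PMF Mem
  | 0 => PMF.pure (initMem c)
  | t + 1 => (memAfter P k c f t).bind fun m =>
      (stage P (f (t + 1)) (k (t + 1)) m).map Config.mem

/-- The expected cost of the solution under a distribution of the memory. -/
noncomputable def expectedCost {n : ℕ} (c : Fin n → ℝ) (μ : PMF Mem) : ENNReal :=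
  ∑' m, μ m * ENNReal.ofReal (cost c (solution n m))

end OnlineCover

/-!
The algorithm keeps `n` layers. Each layer has its own fractional vector `x` and its own random set,
and regards as covered the set `A` of the elements of cost zero and of the random sets of the lower
layers. While the covering constraint `∑ j, f(j | S) * x j ≥ f(N) - f(S)` is violated for `S`, the union
of `A` and its own random set, it increases every `x j` by `(x j + 1 / n) * ρ j`, where `ρ j` is
proportional to the gain per cost and has maximum one. Each increment `d` comes with a coin of bias
`d / (1 - x j)` for putting `j` into the random set. Some `n * x j + 1` doubles in every such round, so
that quadratically many rounds suffice (`not_violated_of_layerStep`). If all layers together fail to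
cover, the fallback buys the set `bulk` of all elements `j` such that the elements cheaper than `j`
form no cover. Each of them costs at most as much as an optimal cover.

Every layer halves the expected gap (`two_mul_ex_gap_succ_le`). The quantity
`promise = ∑ j, f(j | S) * x j + f(N) - f(S)` does not increase in expectation when a layer is updated,
for whatever function and set the update is made (`ex_round_promise_le`). Lower layers never see
higher ones, so that it may be taken with respect to the final function and the final state of the
lower layers, even during earlier updates (`ex_layersAfter_le`). It starts as the gap that the lower
layers leave, and the covering constraint makes it at least twice the gap at the end. As a set that is
no cover has a gap of at least `fMin`, the probability that the first `i` layers fail at some time up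
to `T` is at most `K / 2 ^ i`, where `K = T * fTotal / fMin` (`failure_le`).

A layer has expected cost `O(1 + log n) * OPT`: an optimal cover `X` for the last function covers all
earlier ones, and a multiple of the logarithmic divergence of `x` from `X`, which is initially
`log (4 * n) * OPT`, pays for the random set (`ex_round_potential_le`). Moreover, a layer is not
touched before the lower ones fail, and they are independent of it. So its expected cost is at most
`O(1 + log n) * OPT * min 1 (K / 2 ^ i)` (`ex_layer_cost_le`), and the sum over `i` gives the factor
`O(1 + log K)`. The fallback costs at most `n * OPT` and is used with probability at most
`min 1 (K / 2 ^ n)`, so that the same sum bounds its expected cost (`ex_flagged_cost_le`).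

The program executes this algorithm literally. `Sim` says that a piece of code halts in time and that
its memory can be coupled with an abstract random state. It composes along the syntax of programs, and
yields the running time and the coupling of the whole online execution with the abstract algorithm
(`main_sim`, `exists_coupling`).
-/

open scoped ENNReal

namespace OnlineCover

/-! ### Expectations -/

/-- The expectation of a nonnegative function under a discrete distribution. -/
noncomputable def ex {α : Type*} (μ : PMF α) (φ : α → ℝ≥0∞) : ℝ≥0∞ := ∑' a, μ a * φ a

section Expectation
variable {α β : Type*}

@[simp] theorem ex_pure (a : α) (φ : α → ℝ≥0∞) : ex (PMF.pure a) φ = φ a := by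
  rw [ex, tsum_eq_single a]
  · simp
  · intro b hb
    simp [PMF.pure_apply, hb]

theorem ex_bind (μ : PMF α) (κ : α → PMF β) (φ : β → ℝ≥0∞) :
    ex (μ.bind κ) φ = ex μ fun a => ex (κ a) φ := by
  simp only [ex, PMF.bind_apply]
  simp_rw [← ENNReal.tsum_mul_right, ← ENNReal.tsum_mul_left]
  rw [ENNReal.tsum_comm]
  simp_rw [mul_assoc]

theorem ex_map (μ : PMF α) (g : α → β) (φ : β → ℝ≥0∞) :
    ex (μ.map g) φ = ex μ fun a => φ (g a) := by
  rw [← PMF.bind_pure_comp, ex_bind]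
  simp

theorem ex_mono {μ : PMF α} {φ ψ : α → ℝ≥0∞} (h : ∀ a ∈ μ.support, φ a ≤ ψ a) :
    ex μ φ ≤ ex μ ψ := by
  refine ENNReal.tsum_le_tsum fun a => ?_
  by_cases ha : μ a = 0
  · simp [ha]
  · gcongr
    exact h a ((PMF.mem_support_iff _ _).2 ha)

theorem ex_congr {μ : PMF α} {φ ψ : α → ℝ≥0∞} (h : ∀ a ∈ μ.support, φ a = ψ a) :
    ex μ φ = ex μ ψ :=
  le_antisymm (ex_mono fun a ha => (h a ha).le) (ex_mono fun a ha => (h a ha).ge)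

theorem ex_add (μ : PMF α) (φ ψ : α → ℝ≥0∞) :
    ex μ (fun a => φ a + ψ a) = ex μ φ + ex μ ψ := by
  simp only [ex, mul_add, ENNReal.tsum_add]

theorem ex_mul_left (μ : PMF α) (r : ℝ≥0∞) (φ : α → ℝ≥0∞) :
    ex μ (fun a => r * φ a) = r * ex μ φ := by
  simp only [ex, ← ENNReal.tsum_mul_left]
  exact tsum_congr fun a => by ring

theorem ex_const (μ : PMF α) (r : ℝ≥0∞) : ex μ (fun _ => r) = r := by
  simp only [ex, ENNReal.tsum_mul_right, PMF.tsum_coe, one_mul]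

theorem ex_le_const {μ : PMF α} {φ : α → ℝ≥0∞} {r : ℝ≥0∞} (h : ∀ a ∈ μ.support, φ a ≤ r) :
    ex μ φ ≤ r :=
  (ex_mono h).trans (ex_const μ r).le

theorem ex_comm (μ : PMF α) (ν : PMF β) (φ : α → β → ℝ≥0∞) :
    ex μ (fun a => ex ν (φ a)) = ex ν fun b => ex μ fun a => φ a b := by
  simp only [ex, ← ENNReal.tsum_mul_left]
  rw [ENNReal.tsum_comm]
  exact tsum_congr fun b => tsum_congr fun a => by ring

theorem ex_sum {ι : Type*} (s : Finset ι) (μ : PMF α) (φ : ι → α → ℝ≥0∞) :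
    ex μ (fun a => ∑ i ∈ s, φ i a) = ∑ i ∈ s, ex μ (φ i) := by
  classical
  induction s using Finset.induction_on with
  | empty => simp [ex]
  | insert i s hi ih => simp only [Finset.sum_insert hi, ex_add, ih]

theorem ex_coin (p : ℝ) (φ : Bool → ℝ≥0∞) :
    ex (coin p) φ =
      min 1 (ENNReal.ofReal p) * φ true + (1 - min 1 (ENNReal.ofReal p)) * φ false := by
  simp [ex, coin]

/-- The outcome `false` of a coin is possible only if its bias is less than one. -/
theorem lt_one_of_false_mem_support {p : ℝ} (h : false ∈ (coin p).support) : p < 1 := by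
  by_contra hp
  rw [PMF.mem_support_iff] at h
  apply h
  have : (1 : ℝ≥0∞) ≤ ENNReal.ofReal p := by simpa using hp
  simp [coin, this]

theorem bind_congr_of_support (μ : PMF α) {g h : α → PMF β} (H : ∀ a ∈ μ.support, g a = h a) :
    μ.bind g = μ.bind h := by
  ext b
  simp only [PMF.bind_apply]
  refine tsum_congr fun a => ?_
  by_cases ha : μ a = 0
  · simp [ha]
  · rw [H a ((PMF.mem_support_iff _ _).2 ha)]

/-- Composition of the kernels `κ 0, …, κ (N - 1)`, in this order. -/
noncomputable def iter (κ : ℕ → α → PMF α) : ℕ → α → PMF α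
  | 0, a => PMF.pure a
  | N + 1, a => (iter κ N a).bind (κ N)

@[simp] theorem iter_pure (N : ℕ) (a : α) : iter (fun _ => PMF.pure) N a = PMF.pure a := by
  induction N with
  | zero => rfl
  | succ N ih => simp [iter, ih]

/-- An invariant that each kernel preserves for all outcomes. -/
theorem iter_support {κ : ℕ → α → PMF α} {I : ℕ → α → Prop} {N : ℕ}
    (h : ∀ k < N, ∀ a, I k a → ∀ b ∈ (κ k a).support, I (k + 1) b) {a : α} (ha : I 0 a) :
    ∀ b ∈ (iter κ N a).support, I N b := by
  induction N with
  | zero =>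
    intro b hb
    simp only [iter, PMF.mem_support_pure_iff] at hb
    exact hb ▸ ha
  | succ N ih =>
    intro b hb
    simp only [iter, PMF.mem_support_bind_iff] at hb
    obtain ⟨a', ha', hb⟩ := hb
    exact h N (Nat.lt_succ_self N) a' (ih (fun k hk => h k (hk.trans (Nat.lt_succ_self N))) a' ha') b hb

/-- The drift of an expectation along a composition of kernels. -/
theorem ex_iter_le {κ : ℕ → α → PMF α} {I : ℕ → α → Prop} {N : ℕ} {φ : α → ℝ≥0∞} {r : ℕ → ℝ≥0∞}
    (h : ∀ k < N, ∀ a, I k a → ∀ b ∈ (κ k a).support, I (k + 1) b)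
    (hφ : ∀ k < N, ∀ a, I k a → ex (κ k a) φ ≤ φ a + r k) {a : α} (ha : I 0 a) :
    ex (iter κ N a) φ ≤ φ a + ∑ k ∈ Finset.range N, r k := by
  induction N with
  | zero => simp [iter]
  | succ N ih =>
    have h' : ∀ k < N, ∀ a, I k a → ∀ b ∈ (κ k a).support, I (k + 1) b :=
      fun k hk => h k (hk.trans (Nat.lt_succ_self N))
    rw [iter, ex_bind, Finset.sum_range_succ, ← add_assoc]
    calc ex (iter κ N a) (fun a' => ex (κ N a') φ)
        ≤ ex (iter κ N a) (fun a' => φ a' + r N) :=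
          ex_mono fun a' ha' => hφ N (Nat.lt_succ_self N) a' (iter_support h' ha a' ha')
      _ = ex (iter κ N a) φ + r N := by rw [ex_add, ex_const]
      _ ≤ _ := by
          gcongr
          exact ih h' (fun k hk => hφ k (hk.trans (Nat.lt_succ_self N)))

end Expectation

/-! ### Semantics of programs -/

section Semantics
variable {n : ℕ} {f : Finset (Fin n) → ℝ}

/-- Started in `x`, the machine has halted after `k` steps in a memory distributed as `μ`. -/
def HaltsTo (f : Finset (Fin n) → ℝ) (x : Config) (k : ℕ) (μ : PMF Mem) : Prop :=
  ∀ k' ≥ k, run f k' x = μ.map (Config.mk [])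

/-- Started in the memory `m`, the command `c` terminates within `b` steps in a memory distributed
as `μ`. This is expressed through the continuations of `c`, because the number of steps that `c`
takes depends on the coins. -/
def Runs (f : Finset (Fin n) → ℝ) (c : Cmd) (m : Mem) (b : ℕ) (μ : PMF Mem) : Prop :=
  ∀ K k g, (∀ m' ∈ μ.support, HaltsTo f ⟨K, m'⟩ k (g m')) → HaltsTo f ⟨c :: K, m⟩ (b + k) (μ.bind g)

theorem haltsTo_nil (m : Mem) : HaltsTo f ⟨[], m⟩ 0 (PMF.pure m) := by
  intro k _
  induction k with
  | zero => simp [run, PMF.pure_map]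
  | succ k ih => simp [run, step, ih (Nat.zero_le k)]

theorem HaltsTo.mono {x : Config} {k k' : ℕ} {μ : PMF Mem} (h : HaltsTo f x k μ) (hk : k ≤ k') :
    HaltsTo f x k' μ := fun l hl => h l (hk.trans hl)

theorem HaltsTo.of_step {x y : Config} {k : ℕ} {μ : PMF Mem} (hs : step f x = PMF.pure y)
    (h : HaltsTo f y k μ) : HaltsTo f x (k + 1) μ := by
  intro k' hk'
  obtain ⟨l, rfl⟩ : ∃ l, k' = l + 1 := ⟨k' - 1, by omega⟩
  rw [run, hs, PMF.pure_bind]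
  exact h l (by omega)

theorem Runs.mono {c : Cmd} {m : Mem} {b b' : ℕ} {μ : PMF Mem} (h : Runs f c m b μ) (hb : b ≤ b') :
    Runs f c m b' μ := fun K k g hg => (h K k g hg).mono (by omega)

theorem Runs.stage {c : Cmd} {m : Mem} {b : ℕ} {μ : PMF Mem} (h : Runs f c m b μ) {k : ℕ}
    (hk : b ≤ k) : stage c f k m = μ.map (Config.mk []) := by
  have := h [] 0 PMF.pure fun m' _ => haltsTo_nil m'
  rw [PMF.bind_pure] at this
  exact this k (by omega)

theorem Runs.of_step {c : Cmd} {m m' : Mem}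
    (hs : ∀ K, step f ⟨c :: K, m⟩ = PMF.pure ⟨K, m'⟩) : Runs f c m 1 (PMF.pure m') := by
  intro K k g hg
  rw [PMF.pure_bind, add_comm]
  exact HaltsTo.of_step (hs K) (hg m' (by simp))

theorem runs_flip (a : ℕ) (i : NExp) (p : RExp) (m : Mem) :
    Runs f (.flip a i p) m 1
      ((coin (p.eval m)).map fun b => m.setNat a (i.eval m) (if b then 1 else 0)) := by
  intro K k g hg k' hk'
  obtain ⟨l, rfl⟩ : ∃ l, k' = l + 1 := ⟨k' - 1, by omega⟩
  rw [run, step, PMF.bind_map, PMF.bind_map, PMF.map_bind]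
  refine bind_congr_of_support _ fun b hb => ?_
  exact hg _ ((PMF.mem_support_map_iff _ _ _).2 ⟨b, hb, rfl⟩) l (by omega)

theorem Runs.seq {p q : Cmd} {m : Mem} {b₁ b₂ : ℕ} {μ : PMF Mem} {ν : Mem → PMF Mem}
    (hp : Runs f p m b₁ μ) (hq : ∀ m' ∈ μ.support, Runs f q m' b₂ (ν m')) :
    Runs f (.seq p q) m (b₁ + b₂ + 1) (μ.bind ν) := by
  intro K k g hg
  rw [PMF.bind_bind]
  have : HaltsTo f ⟨p :: q :: K, m⟩ (b₁ + (b₂ + k)) (μ.bind fun m' => (ν m').bind g) :=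
    hp _ _ _ fun m' hm' => hq m' hm' _ _ _ fun m'' hm'' =>
      hg m'' ((PMF.mem_support_bind_iff _ _ _).2 ⟨m', hm', hm''⟩)
  exact (HaltsTo.of_step (by rw [step]) this).mono (by omega)

open scoped Classical in
theorem Runs.ite {t : Test} {p q : Cmd} {m : Mem} {b : ℕ} {μ : PMF Mem}
    (h : Runs f (if t.Holds m then p else q) m b μ) : Runs f (.ite t p q) m (b + 1) μ := by
  intro K k g hg
  exact (HaltsTo.of_step (by rw [step]) (h K k g hg)).mono (by omega)

theorem Runs.loop_exit {t : Test} {p : Cmd} {m : Mem} (h : ¬ t.Holds m) :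
    Runs f (.loop t p) m 1 (PMF.pure m) :=
  Runs.of_step fun K => by rw [step, if_neg h]

/-! ### Arrays that a program does not touch -/

/-- The natural arrays that a program may write. -/
def Cmd.natWrites : Cmd → List ℕ
  | skip => []
  | setN a _ _ => [a]
  | setR _ _ _ => []
  | flip a _ _ => [a]
  | query _ _ _ => []
  | seq p q => p.natWrites ++ q.natWrites
  | ite _ p q => p.natWrites ++ q.natWrites
  | loop _ p => p.natWrites

/-- The real arrays that a program may write. -/
def Cmd.realWrites : Cmd → List ℕ
  | skip => []
  | setN _ _ _ => []
  | setR a _ _ => [a]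
  | flip _ _ _ => []
  | query a _ _ => [a]
  | seq p q => p.realWrites ++ q.realWrites
  | ite _ p q => p.realWrites ++ q.realWrites
  | loop _ p => p.realWrites

/-- The memory `m'` differs from `m` only in arrays that `c` may write. -/
def Frame (c : Cmd) (m m' : Mem) : Prop :=
  (∀ a, a ∉ c.natWrites → m'.nat a = m.nat a) ∧ (∀ a, a ∉ c.realWrites → m'.real a = m.real a)

theorem Frame.refl (c : Cmd) (m : Mem) : Frame c m m := ⟨fun _ _ => rfl, fun _ _ => rfl⟩

theorem Frame.trans {c : Cmd} {m m' m'' : Mem} (h : Frame c m m') (h' : Frame c m' m'') :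
    Frame c m m'' :=
  ⟨fun a ha => (h'.1 a ha).trans (h.1 a ha), fun a ha => (h'.2 a ha).trans (h.2 a ha)⟩

theorem step_frame_nat {a : ℕ} {x y : Config} (hx : ∀ c ∈ x.todo, a ∉ c.natWrites)
    (hy : y ∈ (step f x).support) :
    (∀ c ∈ y.todo, a ∉ c.natWrites) ∧ y.mem.nat a = x.mem.nat a := by
  classical
  obtain ⟨K, m⟩ := x
  rcases K with _ | ⟨c, K⟩
  · simp only [step, PMF.mem_support_pure_iff] at hy
    subst hy
    simp
  · simp only [List.mem_cons, forall_eq_or_imp] at hx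
    obtain ⟨hc, hK⟩ := hx
    cases c <;> simp only [step, PMF.mem_support_pure_iff, PMF.mem_support_map_iff] at hy
    case flip =>
      obtain ⟨b, _, rfl⟩ := hy
      simp only [Cmd.natWrites, List.mem_singleton] at hc
      exact ⟨hK, by simp [Mem.setNat, hc]⟩
    all_goals subst hy
    all_goals simp only [Cmd.natWrites, List.mem_singleton, List.mem_append, not_or] at hc
    case ite =>
      refine ⟨?_, rfl⟩
      simp only [List.mem_cons, forall_eq_or_imp]
      exact ⟨by split_ifs <;> tauto, hK⟩
    case loop =>
      split_ifs
      · refine ⟨?_, rfl⟩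
        simp only [List.mem_cons, forall_eq_or_imp]
        exact ⟨hc, by simpa [Cmd.natWrites] using hc, hK⟩
      · exact ⟨hK, rfl⟩
    case seq =>
      refine ⟨?_, rfl⟩
      simp only [List.mem_cons, forall_eq_or_imp]
      exact ⟨hc.1, hc.2, hK⟩
    all_goals exact ⟨hK, by simp_all [Mem.setNat, Mem.setReal]⟩

theorem step_frame_real {a : ℕ} {x y : Config} (hx : ∀ c ∈ x.todo, a ∉ c.realWrites)
    (hy : y ∈ (step f x).support) :
    (∀ c ∈ y.todo, a ∉ c.realWrites) ∧ y.mem.real a = x.mem.real a := by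
  classical
  obtain ⟨K, m⟩ := x
  rcases K with _ | ⟨c, K⟩
  · simp only [step, PMF.mem_support_pure_iff] at hy
    subst hy
    simp
  · simp only [List.mem_cons, forall_eq_or_imp] at hx
    obtain ⟨hc, hK⟩ := hx
    cases c <;> simp only [step, PMF.mem_support_pure_iff, PMF.mem_support_map_iff] at hy
    case flip =>
      obtain ⟨b, _, rfl⟩ := hy
      exact ⟨hK, by simp [Mem.setNat]⟩
    all_goals subst hy
    all_goals simp only [Cmd.realWrites, List.mem_singleton, List.mem_append, not_or] at hc
    case ite =>
      refine ⟨?_, rfl⟩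
      simp only [List.mem_cons, forall_eq_or_imp]
      exact ⟨by split_ifs <;> tauto, hK⟩
    case loop =>
      split_ifs
      · refine ⟨?_, rfl⟩
        simp only [List.mem_cons, forall_eq_or_imp]
        exact ⟨hc, by simpa [Cmd.realWrites] using hc, hK⟩
      · exact ⟨hK, rfl⟩
    case seq =>
      refine ⟨?_, rfl⟩
      simp only [List.mem_cons, forall_eq_or_imp]
      exact ⟨hc.1, hc.2, hK⟩
    all_goals exact ⟨hK, by simp_all [Mem.setNat, Mem.setReal]⟩

theorem run_frame {k : ℕ} {x y : Config} (hy : y ∈ (run f k x).support) :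
    (∀ a, (∀ c ∈ x.todo, a ∉ c.natWrites) → y.mem.nat a = x.mem.nat a) ∧
      (∀ a, (∀ c ∈ x.todo, a ∉ c.realWrites) → y.mem.real a = x.mem.real a) := by
  induction k generalizing x with
  | zero =>
    simp only [run, PMF.mem_support_pure_iff] at hy
    subst hy
    simp
  | succ k ih =>
    simp only [run, PMF.mem_support_bind_iff] at hy
    obtain ⟨z, hz, hy⟩ := hy
    refine ⟨fun a ha => ?_, fun a ha => ?_⟩
    · have := step_frame_nat ha hz
      exact ((ih hy).1 a this.1).trans this.2
    · have := step_frame_real ha hz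
      exact ((ih hy).2 a this.1).trans this.2

theorem Runs.frame {c : Cmd} {m m' : Mem} {b : ℕ} {μ : PMF Mem} (h : Runs f c m b μ)
    (hm : m' ∈ μ.support) : Frame c m m' := by
  have h1 : (⟨[], m'⟩ : Config) ∈ (run f b ⟨[c], m⟩).support := by
    have := h.stage le_rfl
    rw [OnlineCover.stage] at this
    rw [this]
    exact (PMF.mem_support_map_iff _ _ _).2 ⟨m', hm, rfl⟩
  have := run_frame h1
  exact ⟨fun a ha => this.1 a (by simpa using ha), fun a ha => this.2 a (by simpa using ha)⟩

/-! ### Simulation of an abstract kernel by a program -/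

/-- The program `c`, started in `m`, terminates within `b` steps, and its final memory can be
coupled with an abstract state of distribution `κ` such that they are related by `Q`. -/
def Sim {α : Type*} (f : Finset (Fin n) → ℝ) (c : Cmd) (m : Mem) (b : ℕ) (κ : PMF α)
    (Q : α → Mem → Prop) : Prop :=
  ∃ J : PMF (α × Mem), J.map Prod.fst = κ ∧ Runs f c m b (J.map Prod.snd) ∧
    ∀ z ∈ J.support, Q z.1 z.2

variable {α β : Type*}

theorem Sim.frame {c : Cmd} {m : Mem} {b : ℕ} {κ : PMF α} {Q : α → Mem → Prop}
    (h : Sim f c m b κ Q) : Sim f c m b κ fun a m' => Q a m' ∧ Frame c m m' := by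
  obtain ⟨J, h1, h2, h3⟩ := h
  exact ⟨J, h1, h2, fun z hz =>
    ⟨h3 z hz, h2.frame ((PMF.mem_support_map_iff _ _ _).2 ⟨z, hz, rfl⟩)⟩⟩

theorem Sim.weaken {c : Cmd} {m : Mem} {b b' : ℕ} {κ : PMF α} {Q Q' : α → Mem → Prop}
    (h : Sim f c m b κ Q) (hb : b ≤ b') (hQ : ∀ a m', Q a m' → Q' a m') : Sim f c m b' κ Q' := by
  obtain ⟨J, h1, h2, h3⟩ := h
  exact ⟨J, h1, h2.mono hb, fun z hz => hQ _ _ (h3 z hz)⟩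

/-- Outcomes of probability zero are excluded. -/
theorem Sim.support {c : Cmd} {m : Mem} {b : ℕ} {κ : PMF α} {Q : α → Mem → Prop}
    (h : Sim f c m b κ Q) : Sim f c m b κ fun a m' => Q a m' ∧ a ∈ κ.support := by
  obtain ⟨J, h1, h2, h3⟩ := h
  exact ⟨J, h1, h2, fun z hz => ⟨h3 z hz, h1 ▸ (PMF.mem_support_map_iff _ _ _).2 ⟨z, hz, rfl⟩⟩⟩

theorem Sim.of_runs {c : Cmd} {m : Mem} {b : ℕ} {κ : PMF α} {Q : α → Mem → Prop} (g : α → Mem)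
    (h : Runs f c m b (κ.map g)) (hQ : ∀ a ∈ κ.support, Q a (g a)) : Sim f c m b κ Q := by
  refine ⟨κ.map fun a => (a, g a), ?_, ?_, ?_⟩
  · rw [PMF.map_comp]
    exact PMF.map_id κ
  · rw [PMF.map_comp]
    exact h
  · intro z hz
    obtain ⟨a, ha, rfl⟩ := (PMF.mem_support_map_iff _ _ _).1 hz
    exact hQ a ha

theorem Sim.of_runs_pure {c : Cmd} {m m' : Mem} {b : ℕ} {a : α} {Q : α → Mem → Prop}
    (h : Runs f c m b (PMF.pure m')) (hQ : Q a m') : Sim f c m b (PMF.pure a) Q :=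
  Sim.of_runs (fun _ => m') (by rwa [PMF.pure_map]) fun b hb => by
    rw [(PMF.mem_support_pure_iff _ _).1 hb]
    exact hQ

theorem coupling_bind {κ : PMF α} {J : PMF (α × Mem)} (h1 : J.map Prod.fst = κ)
    {κ' : α → PMF β} {J' : α × Mem → PMF (β × Mem)}
    (h' : ∀ z ∈ J.support, (J' z).map Prod.fst = κ' z.1) :
    (J.bind J').map Prod.fst = κ.bind κ' := by
  rw [PMF.map_bind, ← h1, PMF.bind_map]
  exact bind_congr_of_support _ h'

/-- Sequential composition for a program whose outcome is coupled with an abstract state: the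
continuation may be analysed separately for each pair of an abstract state and a memory. -/
theorem Runs.bind_coupling {c : Cmd} {K : List Cmd} {k b : ℕ} {m : Mem} {J : PMF (α × Mem)}
    (h : Runs f c m b (J.map Prod.snd)) {g : α × Mem → PMF Mem}
    (hg : ∀ z ∈ J.support, HaltsTo f ⟨K, z.2⟩ k (g z)) :
    HaltsTo f ⟨c :: K, m⟩ (b + k) (J.bind g) := by
  classical
  -- all the `g z` with the same memory `z.2` agree, being the outcome of the same configuration
  have key : ∀ m' ∈ (J.map Prod.snd).support, ∃ μ : PMF Mem, HaltsTo f ⟨K, m'⟩ k μ := by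
    intro m' hm'
    obtain ⟨z, hz, rfl⟩ := (PMF.mem_support_map_iff _ _ _).1 hm'
    exact ⟨g z, hg z hz⟩
  let G : Mem → PMF Mem := fun m' => if h : ∃ μ, HaltsTo f ⟨K, m'⟩ k μ then h.choose else PMF.pure m'
  have hG : ∀ m' ∈ (J.map Prod.snd).support, HaltsTo f ⟨K, m'⟩ k (G m') := by
    intro m' hm'
    have := key m' hm'
    simp only [G, dif_pos this]
    exact this.choose_spec
  have := h K k G hG
  rw [PMF.bind_map] at this
  have inj : Function.Injective (PMF.map (Config.mk [])) := by
    intro μ ν e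
    have := congrArg (PMF.map Config.mem) e
    simp only [PMF.map_comp] at this
    exact (PMF.map_id μ).symm.trans (this.trans (PMF.map_id ν))
  have e : J.bind (G ∘ Prod.snd) = J.bind g := by
    refine bind_congr_of_support _ fun z hz => inj ?_
    rw [Function.comp_apply, ← hG z.2 ((PMF.mem_support_map_iff _ _ _).2 ⟨z, hz, rfl⟩) k le_rfl, ← hg z hz k le_rfl]
  rwa [e] at this

/-- The couplings of the two parts are composed. The second one may be chosen depending on the outcome
of the first. -/
theorem Sim.of_step {c p q : Cmd} {m : Mem} {b₁ b₂ : ℕ} {κ : PMF α} {κ' : α → PMF β}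
    {Q : α → Mem → Prop} {Q' : β → Mem → Prop}
    (hs : ∀ K, step f ⟨c :: K, m⟩ = PMF.pure ⟨p :: q :: K, m⟩) (hp : Sim f p m b₁ κ Q)
    (hq : ∀ a m', Q a m' → Sim f q m' b₂ (κ' a) Q') :
    Sim f c m (b₁ + b₂ + 1) (κ.bind κ') Q' := by
  classical
  obtain ⟨J, h1, h2, h3⟩ := hp
  obtain ⟨y, _⟩ := (κ.bind κ').support_nonempty
  have : Nonempty (PMF (β × Mem)) := ⟨PMF.pure (y, m)⟩
  choose! J' h1' h2' h3' using hq
  refine ⟨J.bind fun z => J' z.1 z.2, coupling_bind h1 fun z hz => h1' _ _ (h3 z hz), ?_, ?_⟩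
  · intro K k g hg
    have : HaltsTo f ⟨p :: q :: K, m⟩ (b₁ + (b₂ + k))
        (J.bind fun z => ((J' z.1 z.2).map Prod.snd).bind g) := by
      refine h2.bind_coupling fun z hz => h2' _ _ (h3 z hz) _ _ _ fun m'' hm'' => hg m'' ?_
      obtain ⟨w, hw, rfl⟩ := (PMF.mem_support_map_iff _ _ _).1 hm''
      exact (PMF.mem_support_map_iff _ _ _).2
        ⟨w, (PMF.mem_support_bind_iff _ _ _).2 ⟨z, hz, hw⟩, rfl⟩
    rw [PMF.map_bind, PMF.bind_bind]
    exact (HaltsTo.of_step (hs K) this).mono (by omega)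
  · intro w hw
    obtain ⟨z, hz, hw⟩ := (PMF.mem_support_bind_iff _ _ _).1 hw
    exact h3' _ _ (h3 z hz) w hw

theorem Sim.seq {p q : Cmd} {m : Mem} {b₁ b₂ : ℕ} {κ : PMF α} {κ' : α → PMF β}
    {Q : α → Mem → Prop} {Q' : β → Mem → Prop} (hp : Sim f p m b₁ κ Q)
    (hq : ∀ a m', Q a m' → Sim f q m' b₂ (κ' a) Q') :
    Sim f (.seq p q) m (b₁ + b₂ + 1) (κ.bind κ') Q' :=
  Sim.of_step (fun K => by rw [step]) hp hq

open scoped Classical in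
theorem Sim.ite {t : Test} {p q : Cmd} {m : Mem} {b : ℕ} {κ : PMF α} {Q : α → Mem → Prop}
    (h : Sim f (if t.Holds m then p else q) m b κ Q) : Sim f (.ite t p q) m (b + 1) κ Q := by
  obtain ⟨J, h1, h2, h3⟩ := h
  exact ⟨J, h1, h2.ite, h3⟩

/-! ### Straight-line code and counting loops -/

/-- Programs without coins and loops. -/
def Cmd.Straight : Cmd → Prop
  | skip => True
  | setN _ _ _ => True
  | setR _ _ _ => True
  | flip _ _ _ => False
  | query _ _ _ => True
  | seq p q => p.Straight ∧ q.Straight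
  | ite _ p q => p.Straight ∧ q.Straight
  | loop _ _ => False

/-- The number of nodes, which bounds the running time of straight-line code. -/
def Cmd.size : Cmd → ℕ
  | skip => 1
  | setN _ _ _ => 1
  | setR _ _ _ => 1
  | flip _ _ _ => 1
  | query _ _ _ => 1
  | seq p q => p.size + q.size + 1
  | ite _ p q => p.size + q.size + 1
  | loop _ p => p.size + 1

open scoped Classical in
/-- The effect of straight-line code on the memory; coins and loops are skipped. -/
noncomputable def Cmd.effect (f : Finset (Fin n) → ℝ) : Cmd → Mem → Mem
  | skip, m => m
  | setN a i x, m => m.setNat a (i.eval m) (x.eval m)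
  | setR a i x, m => m.setReal a (i.eval m) (x.eval m)
  | flip _ _ _, m => m
  | query a i s, m => m.setReal a (i.eval m) (f (m.readSet n s))
  | seq p q, m => q.effect f (p.effect f m)
  | ite t p q, m => if t.Holds m then p.effect f m else q.effect f m
  | loop _ _, m => m

theorem Cmd.Straight.runs {c : Cmd} (hc : c.Straight) (m : Mem) :
    Runs f c m c.size (PMF.pure (c.effect f m)) := by
  classical
  induction c generalizing m with
  | skip => exact Runs.of_step fun K => by rw [step]; rfl
  | setN a i x => exact Runs.of_step fun K => by rw [step]; rfl
  | setR a i x => exact Runs.of_step fun K => by rw [step]; rfl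
  | flip a i x => exact hc.elim
  | query a i s => exact Runs.of_step fun K => by rw [step]; rfl
  | seq p q ihp ihq =>
    have := (ihp hc.1 m).seq (b₂ := q.size) (ν := fun m' => PMF.pure (q.effect f m'))
      fun m' _ => ihq hc.2 m'
    rwa [PMF.pure_bind] at this
  | ite t p q ihp ihq =>
    refine Runs.mono (Runs.ite (b := p.size + q.size) ?_) le_rfl
    rw [Cmd.effect]
    split_ifs
    · exact (ihp hc.1 m).mono (by omega)
    · exact (ihq hc.2 m).mono (by omega)
  | loop t p _ => exact hc.elim

theorem Sim.of_straight {c : Cmd} (hc : c.Straight) {m : Mem} {a : α} {Q : α → Mem → Prop}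
    (hQ : Q a (c.effect f m)) : Sim f c m c.size (PMF.pure a) Q :=
  Sim.of_runs_pure (hc.runs m) hQ

/-- The scalar kept in cell `0` of a natural array. -/
abbrev NExp.var (v : ℕ) : NExp := .get v (.const 0)

/-- The scalar kept in cell `0` of a real array. -/
abbrev RExp.var (v : ℕ) : RExp := .get v (.const 0)

/-- The program `for v := 0 to N - 1 do p`. -/
def Cmd.forLoop (v : ℕ) (N : NExp) (p : Cmd) : Cmd :=
  .seq (.setN v (.const 0) (.const 0))
    (.loop (.ltN (.var v) N) (.seq p (.setN v (.const 0) (.add (.var v) (.const 1)))))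

theorem iter_succ' (κ : ℕ → α → PMF α) (N : ℕ) (a : α) :
    iter κ (N + 1) a = (κ 0 a).bind (iter (fun k => κ (k + 1)) N) := by
  induction N with
  | zero =>
    rw [iter, iter, PMF.pure_bind]
    exact (PMF.bind_pure (κ 0 a)).symm
  | succ N ih =>
    rw [iter, ih, PMF.bind_bind]
    rfl

theorem Mem.setNat_nat_self (m : Mem) (a i v : ℕ) : (m.setNat a i v).nat a i = v := by
  simp [Mem.setNat]

theorem Sim.forLoop {v : ℕ} {N : NExp} {p : Cmd} {m : Mem} {b N₀ : ℕ} {κ : ℕ → α → PMF α}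
    {I : ℕ → α → Mem → Prop} {a : α} (hv : v ∉ p.natWrites)
    (hN : ∀ m', Frame (.forLoop v N p) m m' → N.eval m' = N₀)
    (hI : ∀ k a m' w, I k a m' → I k a (m'.setNat v 0 w)) (h0 : I 0 a m)
    (hp : ∀ k < N₀, ∀ a m', I k a m' → m'.nat v 0 = k → Frame (.forLoop v N p) m m' →
      Sim f p m' b (κ k a) (I (k + 1))) :
    Sim f (.forLoop v N p) m (N₀ * (b + 3) + 3) (iter κ N₀ a) (I N₀) := by
  have hframe : ∀ m' w, Frame (.forLoop v N p) m m' → Frame (.forLoop v N p) m (m'.setNat v 0 w) := by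
    intro m' w h
    refine h.trans ⟨fun a ha => ?_, fun a _ => rfl⟩
    simp only [Cmd.forLoop, Cmd.natWrites, List.mem_append, List.mem_singleton, not_or] at ha
    simp [Mem.setNat, ha.1]
  have hsub : ∀ m' m'', Frame p m' m'' → Frame (.forLoop v N p) m' m'' := by
    intro m' m'' h
    refine ⟨fun a ha => h.1 a ?_, fun a ha => h.2 a ?_⟩
    · simp only [Cmd.forLoop, Cmd.natWrites, List.mem_append, not_or] at ha
      exact ha.2.1
    · simp only [Cmd.forLoop, Cmd.realWrites, List.mem_append, not_or] at ha
      exact ha.2.1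
  have main : ∀ r k a m', k + r = N₀ → I k a m' → m'.nat v 0 = k → Frame (.forLoop v N p) m m' →
      Sim f (.loop (.ltN (.var v) N) (.seq p (.setN v (.const 0) (.add (.var v) (.const 1))))) m'
        (r * (b + 3) + 1) (iter (fun l => κ (l + k)) r a) (I N₀) := by
    intro r
    induction r with
    | zero =>
      intro k a m' hk hIk hm' hF
      refine Sim.weaken (Sim.of_runs_pure (Runs.loop_exit ?_) hIk) (by omega) ?_
      · simp only [Test.Holds, NExp.eval, hm', hN m' hF]
        omega
      · intro a m' h
        rwa [← show k = N₀ by omega]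
    | succ r ih =>
      intro k a m' hk hIk hm' hF
      rw [iter_succ']
      have body : Sim f (.seq p (.setN v (.const 0) (.add (.var v) (.const 1)))) m' (b + 1 + 1)
          (κ (0 + k) a) fun a m'' => I (k + 1) a m'' ∧ m''.nat v 0 = k + 1 ∧
            Frame (.forLoop v N p) m m'' := by
        have := Sim.seq (κ' := PMF.pure) (b₂ := 1)
          (Q' := fun a m'' => I (k + 1) a m'' ∧ m''.nat v 0 = k + 1 ∧ Frame (.forLoop v N p) m m'')
          (q := .setN v (.const 0) (.add (.var v) (.const 1)))
          (hp k (by omega) a m' hIk hm' hF).frame ?_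
        · rw [PMF.bind_pure] at this
          rwa [zero_add]
        · rintro a m'' ⟨hI', hF'⟩
          have e : m''.nat v 0 = k := by rw [hF'.1 v hv, hm']
          refine Sim.of_runs_pure (Cmd.Straight.runs (c := .setN _ _ _) trivial m'') ?_
          simp only [Cmd.effect, NExp.eval, e]
          exact ⟨hI _ _ _ _ hI', Mem.setNat_nat_self _ _ _ _,
            hframe _ _ (hF.trans (hsub _ _ hF'))⟩
      have := Sim.of_step (c := .loop (.ltN (.var v) N)
          (.seq p (.setN v (.const 0) (.add (.var v) (.const 1)))))
        (fun K => by
          rw [step, if_pos]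
          simp only [Test.Holds, NExp.eval, hm', hN m' hF]
          omega) body
        (fun a m'' h => ih (k + 1) a m'' (by omega) h.1 h.2.1 h.2.2)
      refine Sim.weaken (b := b + 1 + 1 + (r * (b + 3) + 1) + 1) ?_ (by ring_nf; omega)
        fun _ _ h => h
      convert this using 5
      omega
  have start := Sim.seq (κ' := iter (fun l => κ (l + 0)) N₀) (Q' := I N₀)
    (q := .loop (.ltN (.var v) N) (.seq p (.setN v (.const 0) (.add (.var v) (.const 1)))))
    (Sim.of_runs_pure (f := f) (a := a)
      (Q := fun a' m' => a' = a ∧ m' = m.setNat v 0 0)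
      (Cmd.Straight.runs (c := .setN v (.const 0) (.const 0)) trivial m) ⟨rfl, rfl⟩)
    (b₂ := N₀ * (b + 3) + 1)
    (by
      rintro a' m' ⟨rfl, rfl⟩
      exact main N₀ 0 a' _ (by omega) (hI _ _ _ _ h0) (Mem.setNat_nat_self _ _ _ _)
        (hframe _ _ (Frame.refl _ _)))
  rw [PMF.pure_bind] at start
  exact start.weaken (by simp only [Cmd.size]; omega) fun _ _ h => h

end Semantics

/-! ### Marginal gains -/

section Gain
variable {n : ℕ} {f : Finset (Fin n) → ℝ}

/-- The marginal gain of `j` over `S`. -/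
def gain (f : Finset (Fin n) → ℝ) (S : Finset (Fin n)) (j : Fin n) : ℝ := f (insert j S) - f S

/-- The value that is missing for `S` to be a cover. -/
def gap (f : Finset (Fin n) → ℝ) (S : Finset (Fin n)) : ℝ := f Finset.univ - f S

theorem isCover_iff_gap {S : Finset (Fin n)} : IsCover f S ↔ gap f S = 0 := by
  rw [IsCover, gap, sub_eq_zero, eq_comm]

theorem gain_of_mem {S : Finset (Fin n)} {j : Fin n} (h : j ∈ S) : gain f S j = 0 := by
  rw [gain, Finset.insert_eq_of_mem h, sub_self]

theorem gap_insert (S : Finset (Fin n)) (j : Fin n) :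
    gap f (insert j S) = gap f S - gain f S j := by
  simp only [gap, gain]
  ring

namespace IsMonotoneSubmodular

theorem gain_nonneg (hf : IsMonotoneSubmodular f) (S : Finset (Fin n)) (j : Fin n) :
    0 ≤ gain f S j := sub_nonneg.2 (hf.mono _ _ (Finset.subset_insert _ _))

theorem gap_nonneg (hf : IsMonotoneSubmodular f) (S : Finset (Fin n)) : 0 ≤ gap f S :=
  sub_nonneg.2 (hf.mono _ _ (Finset.subset_univ _))

theorem gap_le (hf : IsMonotoneSubmodular f) (S : Finset (Fin n)) : gap f S ≤ f Finset.univ :=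
  sub_le_self _ (hf.nonneg S)

theorem gain_le_gap (hf : IsMonotoneSubmodular f) (S : Finset (Fin n)) (j : Fin n) :
    gain f S j ≤ gap f S := sub_le_sub_right (hf.mono _ _ (Finset.subset_univ _)) _

theorem isCover_mono (hf : IsMonotoneSubmodular f) {S S' : Finset (Fin n)} (h : S ⊆ S')
    (hS : IsCover f S) : IsCover f S' :=
  le_antisymm (hf.mono _ _ (Finset.subset_univ _)) (hS ▸ hf.mono _ _ h)

theorem gain_anti (hf : IsMonotoneSubmodular f) {S S' : Finset (Fin n)} (h : S ⊆ S') (j : Fin n) :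
    gain f S' j ≤ gain f S j := by
  by_cases hj : j ∈ S'
  · rw [gain_of_mem hj]
    exact hf.gain_nonneg S j
  · have := hf.submod (insert j S) S'
    rw [Finset.insert_inter_of_notMem hj, Finset.inter_eq_left.2 h, Finset.insert_union,
      Finset.union_eq_right.2 h] at this
    simp only [gain]
    linarith

theorem le_sum_gain (hf : IsMonotoneSubmodular f) (S X : Finset (Fin n)) :
    f (S ∪ X) - f S ≤ ∑ j ∈ X, gain f S j := by
  induction X using Finset.induction_on with
  | empty => simp
  | insert j X hj ih =>
    rw [Finset.sum_insert hj, Finset.union_insert]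
    have := hf.gain_anti (S := S) (S' := S ∪ X) Finset.subset_union_left j
    simp only [gain] at this ⊢
    simp only [gain] at ih
    linarith

/-- The covering constraint for `S`, satisfied by every cover `X`. -/
theorem gap_le_sum_gain (hf : IsMonotoneSubmodular f) {X : Finset (Fin n)} (hX : IsCover f X)
    (S : Finset (Fin n)) : gap f S ≤ ∑ j ∈ X, gain f S j := by
  have h1 := hf.le_sum_gain S X
  have h2 : IsCover f (S ∪ X) := hf.isCover_mono Finset.subset_union_right hX
  rw [h2] at h1
  exact h1

end IsMonotoneSubmodular
end Gain

/-! ### The abstract algorithm -/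

section Algorithm
variable {n : ℕ}

/-- A layer: a fractional vector and the random set obtained from it so far. -/
abbrev Layer (n : ℕ) : Type := (Fin n → ℝ) × Finset (Fin n)

/-- The state of a layer that has never been updated. -/
abbrev Layer.idle (n : ℕ) : Layer n := (fun _ => 0, ∅)

/-- The largest gain per cost. -/
noncomputable def maxRatio (c : Fin n → ℝ) (f : Finset (Fin n) → ℝ) (S : Finset (Fin n)) : ℝ :=
  Finset.univ.fold max 0 fun j => gain f S j / c j

/-- The multiplicative step for `j`: the gain per cost, scaled to have maximum one. The divisions by
zero give the value zero; they concern elements of cost zero, which `S` will always contain, and sets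
`S` over which no gain is left. -/
noncomputable def rate (c : Fin n → ℝ) (f : Finset (Fin n) → ℝ) (S : Finset (Fin n)) (j : Fin n) :
    ℝ := gain f S j / c j / maxRatio c f S

/-- The increment of a fractional value `x` for the multiplicative step `r`. -/
noncomputable def incr (n : ℕ) (x r : ℝ) : ℝ := (x + 1 / n) * r

/-- Raise the `k`-th fractional value, and put `k` into the random set with a probability that
makes the unconditional probability of membership follow the fractional value. If that value
reaches one, the coin has bias at least one. -/
noncomputable def raise (ρ : Fin n → ℝ) (k : ℕ) (b : Layer n) : PMF (Layer n) :=
  if h : k < n then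
    (coin (incr n (b.1 ⟨k, h⟩) (ρ ⟨k, h⟩) / (1 - b.1 ⟨k, h⟩))).map fun hit =>
      (Function.update b.1 ⟨k, h⟩ (b.1 ⟨k, h⟩ + incr n (b.1 ⟨k, h⟩) (ρ ⟨k, h⟩)),
        if hit then insert ⟨k, h⟩ b.2 else b.2)
  else PMF.pure b

/-- The fractional vector violates the covering constraint for `A` and the random set. -/
def Violated (f : Finset (Fin n) → ℝ) (A : Finset (Fin n)) (b : Layer n) : Prop :=
  ∑ j, gain f (A ∪ b.2) j * b.1 j < gap f (A ∪ b.2)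

open scoped Classical in
/-- One multiplicative update, made if the covering constraint is violated. -/
noncomputable def round (c : Fin n → ℝ) (f : Finset (Fin n) → ℝ) (A : Finset (Fin n))
    (b : Layer n) : PMF (Layer n) :=
  if Violated f A b then iter (raise (rate c f (A ∪ b.2))) n b else PMF.pure b

/-- All updates of a layer at one time step. The `(n + 1) * (n + 1)` rounds are arranged in two nested
loops because the machine cannot multiply natural numbers. -/
noncomputable def layerStep (c : Fin n → ℝ) (f : Finset (Fin n) → ℝ) (A : Finset (Fin n)) :
    Layer n → PMF (Layer n) :=
  iter (fun _ => iter (fun _ => round c f A) (n + 1)) (n + 1)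

/-- The elements of cost zero and of the first `i` layers. -/
noncomputable def lower (c : Fin n → ℝ) (σ : ℕ → Layer n) (i : ℕ) : Finset (Fin n) :=
  (Finset.univ.filter fun j => ¬ 0 < c j) ∪ (Finset.range i).biUnion fun l => (σ l).2

/-- The update of the layer `i`, on top of the current lower layers. -/
noncomputable def layerKernel (c : Fin n → ℝ) (f : Finset (Fin n) → ℝ) (i : ℕ) (σ : ℕ → Layer n) :
    PMF (ℕ → Layer n) :=
  (layerStep c f (lower c σ i) (σ i)).map (Function.update σ i)

/-- The states of the layers after time step `t`. -/
noncomputable def layersAfter (c : Fin n → ℝ) (f : ℕ → Finset (Fin n) → ℝ) :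
    ℕ → PMF (ℕ → Layer n)
  | 0 => PMF.pure fun _ => Layer.idle n
  | t + 1 => (layersAfter c f t).bind (iter (layerKernel c (f (t + 1))) n)

theorem lower_succ (c : Fin n → ℝ) (σ : ℕ → Layer n) (i : ℕ) :
    lower c σ (i + 1) = lower c σ i ∪ (σ i).2 := by
  simp only [lower, Finset.range_add_one, Finset.biUnion_insert]
  ext j
  simp only [Finset.mem_union]
  tauto

theorem lower_congr (c : Fin n → ℝ) {σ σ' : ℕ → Layer n} {i : ℕ} (h : ∀ l < i, σ l = σ' l) :
    lower c σ i = lower c σ' i := by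
  unfold lower
  congr 1
  exact Finset.biUnion_congr rfl fun l hl => by rw [h l (Finset.mem_range.1 hl)]

theorem zero_cost_mem_lower {c : Fin n → ℝ} {σ : ℕ → Layer n} {i : ℕ} {j : Fin n}
    (h : ¬ 0 < c j) : j ∈ lower c σ i := by
  exact Finset.mem_union_left _ (Finset.mem_filter.2 ⟨Finset.mem_univ j, h⟩)

/-! ### The multiplicative steps -/

variable {c : Fin n → ℝ} {f : Finset (Fin n) → ℝ} {S : Finset (Fin n)}

theorem le_maxRatio (c : Fin n → ℝ) (f : Finset (Fin n) → ℝ) (S : Finset (Fin n)) (j : Fin n) :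
    gain f S j / c j ≤ maxRatio c f S :=
  Finset.le_fold_max _ |>.2 (Or.inr ⟨j, Finset.mem_univ j, le_rfl⟩)

theorem maxRatio_nonneg (c : Fin n → ℝ) (f : Finset (Fin n) → ℝ) (S : Finset (Fin n)) :
    0 ≤ maxRatio c f S := Finset.le_fold_max _ |>.2 (Or.inl le_rfl)

theorem exists_eq_maxRatio (h : 0 < maxRatio c f S) : ∃ j, gain f S j / c j = maxRatio c f S := by
  obtain h' | ⟨j, _, hj⟩ := (Finset.le_fold_max _).1 (le_refl (maxRatio c f S))
  · exact absurd h' (not_le.2 h)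
  · exact ⟨j, le_antisymm (le_maxRatio c f S j) hj⟩

theorem rate_nonneg (hc : ∀ j, 0 ≤ c j) (hf : IsMonotoneSubmodular f) (j : Fin n) :
    0 ≤ rate c f S j :=
  div_nonneg (div_nonneg (hf.gain_nonneg S j) (hc j)) (maxRatio_nonneg c f S)

theorem rate_le_one (j : Fin n) : rate c f S j ≤ 1 :=
  div_le_one_of_le₀ (le_maxRatio c f S j) (maxRatio_nonneg c f S)

theorem rate_of_mem {j : Fin n} (h : j ∈ S) : rate c f S j = 0 := by
  simp [rate, gain_of_mem h]

/-- If the elements of cost zero are in `S`, then some gain per cost is positive unless `S` is a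
cover. -/
theorem maxRatio_pos (hf : IsMonotoneSubmodular f) (hS : ∀ j, ¬ 0 < c j → j ∈ S)
    (h : 0 < gap f S) : 0 < maxRatio c f S := by
  have h1 := hf.gap_le_sum_gain (X := Finset.univ) rfl S
  obtain ⟨j, _, hj⟩ : ∃ j ∈ Finset.univ, 0 < gain f S j := by
    by_contra! h2
    exact absurd (h1.trans (Finset.sum_nonpos h2)) (not_le.2 h)
  have hcj : 0 < c j := by
    by_contra h3
    rw [gain_of_mem (hS j h3)] at hj
    exact lt_irrefl _ hj
  exact (div_pos hj hcj).trans_le (le_maxRatio c f S j)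

theorem cost_mul_rate (hS : ∀ j, ¬ 0 < c j → j ∈ S) (j : Fin n) :
    c j * rate c f S j = gain f S j / maxRatio c f S := by
  by_cases h : 0 < c j
  · rw [rate]
    field_simp
  · rw [rate, gain_of_mem (hS j h)]
    simp

/-! ### Invariants of a layer -/

/-- The fractional values are nonnegative and bounded, and are less than one outside of the
random set. -/
def Layer.Valid (b : Layer n) : Prop := ∀ j, 0 ≤ b.1 j ∧ b.1 j ≤ 3 ∧ (j ∉ b.2 → b.1 j < 1)

theorem Layer.valid_idle : (Layer.idle n).Valid := fun j => by simp

/-- Admissible multiplicative steps. -/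
def Admissible (ρ : Fin n → ℝ) (b : Layer n) : Prop :=
  ∀ j, 0 ≤ ρ j ∧ ρ j ≤ 1 ∧ (j ∈ b.2 → ρ j = 0)

theorem admissible_rate (hc : ∀ j, 0 ≤ c j) (hf : IsMonotoneSubmodular f) (A : Finset (Fin n))
    (b : Layer n) : Admissible (rate c f (A ∪ b.2)) b := fun j =>
  ⟨rate_nonneg hc hf j, rate_le_one j, fun h => rate_of_mem (Finset.mem_union_right A h)⟩

theorem incr_nonneg {x r : ℝ} (hx : 0 ≤ x) (hr : 0 ≤ r) : 0 ≤ incr n x r := by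
  unfold incr
  positivity

theorem incr_zero (x : ℝ) : incr n x 0 = 0 := mul_zero _

/-- The situation in the middle of an update that started in `b₀`. -/
structure Midway (ρ : Fin n → ℝ) (b₀ : Layer n) (k : ℕ) (b : Layer n) : Prop where
  valid : b.Valid
  done : ∀ j : Fin n, j.val < k → b.1 j = b₀.1 j + incr n (b₀.1 j) (ρ j)
  todo : ∀ j : Fin n, k ≤ j.val → b.1 j = b₀.1 j
  sub : b₀.2 ⊆ b.2
  fresh : ∀ j : Fin n, k ≤ j.val → j ∈ b.2 → j ∈ b₀.2

theorem Midway.start {ρ : Fin n → ℝ} {b : Layer n} (hb : b.Valid) : Midway ρ b 0 b :=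
  ⟨hb, fun _ h => absurd h (Nat.not_lt_zero _), fun _ _ => rfl, subset_rfl, fun _ _ h => h⟩

theorem Midway.raise {ρ : Fin n → ℝ} {b₀ b b' : Layer n} {k : ℕ} (hρ : Admissible ρ b₀)
    (hb : Midway ρ b₀ k b) (hb' : b' ∈ (raise ρ k b).support) : Midway ρ b₀ (k + 1) b' := by
  unfold OnlineCover.raise at hb'
  split_ifs at hb' with h
  · obtain ⟨hit, hhit, rfl⟩ := (PMF.mem_support_map_iff _ _ _).1 hb'
    set i : Fin n := ⟨k, h⟩ with hi
    have hx0 := (hb.valid i).1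
    have hd := incr_nonneg (n := n) hx0 (hρ i).1
    have hin : (1 : ℝ) / n ≤ 1 := by
      rw [div_le_one (by exact_mod_cast (by omega : 0 < n))]
      exact_mod_cast (by omega : 1 ≤ n)
    have hlt : i ∉ b₀.2 → b.1 i < 1 := fun h' =>
      (hb.valid i).2.2 fun h'' => h' (hb.fresh i le_rfl h'')
    have hd3 : b.1 i + incr n (b.1 i) (ρ i) ≤ 3 := by
      by_cases hm : i ∈ b₀.2
      · rw [(hρ i).2.2 hm, incr_zero, add_zero]
        exact (hb.valid i).2.1
      · have h1 := hlt hm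
        have : incr n (b.1 i) (ρ i) ≤ (b.1 i + 1 / n) * 1 :=
          mul_le_mul_of_nonneg_left (hρ i).2.1 (by positivity)
        linarith
    refine ⟨fun j => ?_, fun j hj => ?_, fun j hj => ?_, ?_, fun j hj hjm => ?_⟩
    · by_cases hji : j = i
      · subst hji
        simp only [Function.update_self]
        refine ⟨by linarith, hd3, fun hnot => ?_⟩
        cases hit with
        | true => simp at hnot
        | false =>
          have h1 := lt_one_of_false_mem_support hhit
          have hnot' : i ∉ b.2 := by simpa using hnot
          have h2 := (hb.valid i).2.2 hnot'
          rw [div_lt_one (by linarith)] at h1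
          linarith
      · simp only [Function.update_of_ne hji]
        refine ⟨(hb.valid j).1, (hb.valid j).2.1, fun hnot => (hb.valid j).2.2 fun hm => hnot ?_⟩
        split_ifs
        · exact Finset.mem_insert_of_mem hm
        · exact hm
    · by_cases hji : j = i
      · subst hji
        simp only [Function.update_self]
        rw [hb.todo i le_rfl]
      · simp only [Function.update_of_ne hji]
        refine hb.done j ?_
        have : j.val ≠ k := fun e => hji (Fin.ext e)
        omega
    · have hji : j ≠ i := fun e => by
        rw [e] at hj
        simp [hi] at hj
      simp only [Function.update_of_ne hji]
      exact hb.todo j (by omega)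
    · split_ifs
      · exact hb.sub.trans (Finset.subset_insert _ _)
      · exact hb.sub
    · have hji : j ≠ i := fun e => by
        rw [e] at hj
        simp [hi] at hj
      refine hb.fresh j (by omega) ?_
      dsimp only at hjm
      split_ifs at hjm
      · exact (Finset.mem_insert.1 hjm).resolve_left hji
      · exact hjm
  · rw [(PMF.mem_support_pure_iff _ _).1 hb']
    exact ⟨hb.valid, fun j _ => hb.done j (by omega), fun j hj => hb.todo j (by omega), hb.sub,
      fun j hj => hb.fresh j (by omega)⟩

theorem midway_end {ρ : Fin n → ℝ} {b b' : Layer n} (hρ : Admissible ρ b) (hb : b.Valid)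
    (hb' : b' ∈ (iter (raise ρ) n b).support) : Midway ρ b n b' :=
  iter_support (I := Midway ρ b) (fun _ _ _ h _ h' => h.raise hρ h') (Midway.start hb) b' hb'

theorem round_valid (hc : ∀ j, 0 ≤ c j) (hf : IsMonotoneSubmodular f) {A : Finset (Fin n)}
    {b b' : Layer n} (hb : b.Valid) (hb' : b' ∈ (round c f A b).support) : b'.Valid := by
  unfold round at hb'
  split_ifs at hb'
  · exact (midway_end (admissible_rate hc hf A b) hb hb').valid
  · exact (PMF.mem_support_pure_iff _ _).1 hb' ▸ hb

theorem layerStep_valid (hc : ∀ j, 0 ≤ c j) (hf : IsMonotoneSubmodular f) {A : Finset (Fin n)}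
    {b b' : Layer n} (hb : b.Valid) (hb' : b' ∈ (layerStep c f A b).support) : b'.Valid :=
  iter_support (I := fun _ => Layer.Valid) (fun _ _ _ h =>
    iter_support (I := fun _ => Layer.Valid) (fun _ _ _ h _ => round_valid hc hf h) h) hb b' hb'

/-- A potential that does not increase in a round does not increase in a time step. -/
theorem ex_layerStep_le (hc : ∀ j, 0 ≤ c j) (hf : IsMonotoneSubmodular f) {A : Finset (Fin n)}
    {φ : Layer n → ℝ≥0∞} (h : ∀ b : Layer n, b.Valid → ex (round c f A b) φ ≤ φ b) {b : Layer n}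
    (hb : b.Valid) : ex (layerStep c f A b) φ ≤ φ b := by
  have hv : ∀ k < n + 1, ∀ b : Layer n, b.Valid → ∀ b' ∈ (round c f A b).support, b'.Valid :=
    fun _ _ _ h _ => round_valid hc hf h
  have := ex_iter_le (κ := fun _ => iter (fun _ => round c f A) (n + 1)) (N := n + 1)
    (I := fun _ => Layer.Valid) (r := fun _ => 0) (φ := φ)
    (fun _ _ b hb => iter_support (I := fun _ => Layer.Valid) hv hb)
    (fun _ _ b hb => by
      simpa using ex_iter_le (I := fun _ => Layer.Valid) (r := fun _ => 0) (φ := φ) hv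
        (fun _ _ b hb => by simpa using h b hb) hb) hb
  rw [layerStep]
  simpa using this

/-- A layer on top of a cover does nothing. -/
theorem layerStep_of_isCover (hf : IsMonotoneSubmodular f) {A : Finset (Fin n)} (hA : IsCover f A)
    {b : Layer n} (hb : b.Valid) : layerStep c f A b = PMF.pure b := by
  have key : ∀ b : Layer n, b.Valid → round c f A b = PMF.pure b := by
    intro b hb
    rw [round, if_neg]
    rw [Violated, isCover_iff_gap.1 (hf.isCover_mono Finset.subset_union_left hA), not_lt]
    exact Finset.sum_nonneg fun j _ => mul_nonneg (hf.gain_nonneg _ j) (hb j).1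
  have inner : ∀ N, iter (fun _ => round c f A) N b = PMF.pure b := by
    intro N
    induction N with
    | zero => rfl
    | succ N ih => rw [iter, ih, PMF.pure_bind, key b hb]
  have outer : ∀ N, iter (fun _ => iter (fun _ => round c f A) (n + 1)) N b = PMF.pure b := by
    intro N
    induction N with
    | zero => rfl
    | succ N ih => rw [iter, ih, PMF.pure_bind, inner]
  exact outer _

/-! ### The number of rounds -/

/-- The number of doublings of `n * x j + 1` that are still possible, summed over the elements
outside of the random set. Only values up to `n + 1` have to be considered; the crude bound `n + 1`
in place of a logarithm keeps every summand positive, so that a hit decreases the sum too. -/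
noncomputable def doublings (b : Layer n) : ℕ :=
  ∑ j, if j ∈ b.2 then 0 else n + 1 - Nat.log 2 ⌊n * b.1 j + 1⌋₊

theorem doublings_le (b : Layer n) : doublings b ≤ n * (n + 1) := by
  calc doublings b ≤ ∑ _j : Fin n, (n + 1) :=
        Finset.sum_le_sum fun j _ => by split_ifs <;> omega
    _ = n * (n + 1) := by simp

/-- A violated round doubles `n * x j + 1` for an element `j` of maximal ratio, unless `j` enters the
random set. As long as `j` is outside, its value is below one, so that the logarithm is at most `n`. -/
theorem doublings_lt (hc : ∀ j, 0 ≤ c j) (hf : IsMonotoneSubmodular f) {A : Finset (Fin n)}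
    (hA : ∀ j, ¬ 0 < c j → j ∈ A) {b b' : Layer n} (hb : b.Valid) (hv : Violated f A b)
    (hb' : b' ∈ (round c f A b).support) : doublings b' < doublings b := by
  rw [round, if_pos hv] at hb'
  have hρ := admissible_rate hc hf A b
  have hM := midway_end hρ hb hb'
  have hgap : 0 < gap f (A ∪ b.2) := lt_of_le_of_lt
    (Finset.sum_nonneg fun j _ => mul_nonneg (hf.gain_nonneg _ j) (hb j).1) hv
  have hpos := maxRatio_pos hf (fun j hj => Finset.mem_union_left b.2 (hA j hj)) hgap
  obtain ⟨i, hi⟩ := exists_eq_maxRatio hpos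
  have hrate : rate c f (A ∪ b.2) i = 1 := by rw [rate, hi, div_self hpos.ne']
  have hib : i ∉ b.2 := fun h => by
    have := (hρ i).2.2 h
    rw [hrate] at this
    exact one_ne_zero this
  have hn : (0 : ℝ) < n := by exact_mod_cast i.pos
  have hlog : ∀ j, j ∉ b.2 → Nat.log 2 ⌊n * b.1 j + 1⌋₊ ≤ n := by
    intro j hj
    have h1 := (hb j).2.2 hj
    have h2 : ⌊n * b.1 j + 1⌋₊ < n + 1 := by
      rw [Nat.floor_lt (by have := (hb j).1; positivity)]
      push_cast
      nlinarith
    exact (Nat.log_le_self _ _).trans (by omega)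
  refine Finset.sum_lt_sum (fun j _ => ?_) ⟨i, Finset.mem_univ i, ?_⟩
  · by_cases hj' : j ∈ b'.2
    · simp [hj']
    · have hj : j ∉ b.2 := fun h => hj' (hM.sub h)
      rw [if_neg hj', if_neg hj, hM.done j j.2]
      have : 0 ≤ incr n (b.1 j) (rate c f (A ∪ b.2) j) := incr_nonneg (hb j).1 (hρ j).1
      refine Nat.sub_le_sub_left (Nat.log_mono_right (Nat.floor_mono ?_)) _
      gcongr
      linarith
  · rw [if_neg hib]
    have hl := hlog i hib
    by_cases hi' : i ∈ b'.2
    · rw [if_pos hi']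
      omega
    · rw [if_neg hi', hM.done i i.2, hrate]
      have e : (n : ℝ) * (b.1 i + incr n (b.1 i) 1) + 1 = 2 * (n * b.1 i + 1) := by
        unfold incr
        field_simp
        ring
      rw [e]
      have h0 : (1 : ℝ) ≤ n * b.1 i + 1 := by
        have := (hb i).1
        nlinarith
      have h1 : ⌊n * b.1 i + 1⌋₊ ≠ 0 := (Nat.floor_pos.2 h0).ne'
      have h2 : 2 * ⌊n * b.1 i + 1⌋₊ ≤ ⌊2 * (n * b.1 i + 1)⌋₊ := by
        rw [Nat.le_floor_iff (by linarith)]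
        push_cast
        have := Nat.floor_le (show 0 ≤ n * b.1 i + 1 by linarith)
        linarith
      have h3 : Nat.log 2 ⌊n * b.1 i + 1⌋₊ + 1 ≤ Nat.log 2 ⌊2 * (n * b.1 i + 1)⌋₊ := by
        rw [← Nat.log_mul_base one_lt_two h1, mul_comm]
        exact Nat.log_mono_right h2
      omega

/-- After the rounds of one time step the covering constraint is satisfied, because there are at most
`n * (n + 1)` violated rounds, fewer than the `(n + 1) * (n + 1)` rounds made. -/
theorem not_violated_of_layerStep (hc : ∀ j, 0 ≤ c j) (hf : IsMonotoneSubmodular f)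
    {A : Finset (Fin n)} (hA : ∀ j, ¬ 0 < c j → j ∈ A) {b b' : Layer n} (hb : b.Valid)
    (hb' : b' ∈ (layerStep c f A b).support) : ¬ Violated f A b' := by
  let I : ℕ → Layer n → Prop := fun k b =>
    b.Valid ∧ (¬ Violated f A b ∨ doublings b + k ≤ n * (n + 1))
  have hI : ∀ k b, I k b → ∀ b' ∈ (round c f A b).support, I (k + 1) b' := by
    rintro k b ⟨hb, h⟩ b' hb'
    refine ⟨round_valid hc hf hb hb', ?_⟩
    by_cases hv : Violated f A b
    · have := doublings_lt hc hf hA hb hv hb'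
      right
      have := h.resolve_left (not_not.2 hv)
      omega
    · rw [round, if_neg hv, PMF.mem_support_pure_iff] at hb'
      exact Or.inl (hb' ▸ hv)
  have h := iter_support (κ := fun _ => iter (fun _ => round c f A) (n + 1)) (N := n + 1)
    (I := fun k => I (k * (n + 1)))
    (fun k _ b hb b' hb' => by
      have := iter_support (κ := fun _ => round c f A) (N := n + 1)
        (I := fun l => I (k * (n + 1) + l)) (fun l _ b hb b' hb' => hI _ b hb b' hb')
        hb b' hb'
      rwa [← Nat.succ_mul] at this)
    (by
      rw [zero_mul]
      exact ⟨hb, Or.inr (doublings_le b)⟩) b' hb'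
  refine h.2.resolve_right fun h' => ?_
  have : (n + 1) * (n + 1) = n * (n + 1) + (n + 1) := Nat.succ_mul n (n + 1)
  omega

end Algorithm

section Potentials
variable {n : ℕ} {c : Fin n → ℝ} {f : Finset (Fin n) → ℝ}

/-! ### Potentials of a layer -/

theorem ex_coin_le {p a b r : ℝ} {φ : Bool → ℝ≥0∞} (hp : 0 ≤ p) (ha : φ true ≤ ENNReal.ofReal a)
    (hb : φ false ≤ ENNReal.ofReal b) (ha0 : 0 ≤ a) (hb0 : 0 ≤ b)
    (h : min 1 p * a + (1 - min 1 p) * b ≤ r) : ex (coin p) φ ≤ ENNReal.ofReal r := by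
  have h1 : min 1 (ENNReal.ofReal p) = ENNReal.ofReal (min 1 p) := by
    rw [ENNReal.ofReal_min, ENNReal.ofReal_one]
  have h0 : 0 ≤ min 1 p := le_min zero_le_one hp
  have h2 : 0 ≤ 1 - min 1 p := sub_nonneg.2 (min_le_left _ _)
  rw [ex_coin, h1, ← ENNReal.ofReal_one, ← ENNReal.ofReal_sub _ h0]
  calc _ ≤ ENNReal.ofReal (min 1 p) * ENNReal.ofReal a
        + ENNReal.ofReal (1 - min 1 p) * ENNReal.ofReal b := by gcongr
    _ = ENNReal.ofReal (min 1 p * a + (1 - min 1 p) * b) := by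
        rw [← ENNReal.ofReal_mul h0, ← ENNReal.ofReal_mul h2, ENNReal.ofReal_add (by positivity)
          (by positivity)]
    _ ≤ _ := ENNReal.ofReal_le_ofReal h

/-- The drift of a potential `u` when one fractional value is raised by `d`. Only an element outside of
the random set matters. The states `t` and `f` are those after a hit and after a miss, and of the
probability `q = min 1 (d / (1 - x))` of a hit only two consequences are kept: `q * (1 - x) ≤ d`,
which bounds the cost, and `(1 - q) * d ≤ q`, by which a hit compensates for a miss. -/
theorem ex_raise_le {ρ : Fin n → ℝ} {b₀ b : Layer n} (hρ : Admissible ρ b₀) {k : ℕ}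
    (hb : Midway ρ b₀ k b) {φ : Layer n → ℝ≥0∞} {u : Layer n → ℝ} (hφ : ∀ b, φ b = ENNReal.ofReal (u b))
    {r : ℝ}
    (h : ∀ h : k < n, (⟨k, h⟩ : Fin n) ∉ b.2 → ∀ d, d = incr n (b.1 ⟨k, h⟩) (ρ ⟨k, h⟩) →
      ∀ t f : Layer n,
        t = (Function.update b.1 ⟨k, h⟩ (b.1 ⟨k, h⟩ + d), insert ⟨k, h⟩ b.2) →
        f = (Function.update b.1 ⟨k, h⟩ (b.1 ⟨k, h⟩ + d), b.2) →
        0 ≤ u t ∧ 0 ≤ u f ∧ ∀ q, 0 ≤ q → q ≤ 1 → q * (1 - b.1 ⟨k, h⟩) ≤ d → (1 - q) * d ≤ q →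
          q * u t + (1 - q) * u f ≤ u b + r) :
    ex (raise ρ k b) φ ≤ φ b + ENNReal.ofReal r := by
  unfold raise
  split_ifs with hk
  · rw [ex_map]
    set i : Fin n := ⟨k, hk⟩ with hi
    by_cases hib : i ∈ b.2
    · have hρ0 : ρ i = 0 := (hρ i).2.2 (hb.fresh i le_rfl hib)
      refine ex_le_const fun hit _ => ?_
      rw [hρ0, incr_zero, add_zero, Function.update_eq_self, Finset.insert_eq_of_mem hib, ite_self]
      exact le_self_add
    · have hx := hb.valid i
      have hx1 := hx.2.2 hib
      have hd := incr_nonneg (n := n) hx.1 (hρ i).1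
      set d := incr n (b.1 i) (ρ i) with hdd
      obtain ⟨h1, h2, h3⟩ := h hk hib d hdd _ _ rfl rfl
      have hp : 0 ≤ d / (1 - b.1 i) := div_nonneg hd (by linarith)
      have hub : φ b + ENNReal.ofReal r ≥ ENNReal.ofReal (u b + r) := by
        rw [hφ]
        exact ENNReal.ofReal_add_le
      refine (ex_coin_le hp (by simp only [if_true, hφ]; exact le_rfl)
        (by simp only [Bool.false_eq_true, if_false, hφ]; exact le_rfl) h1 h2 (h3 _ ?_ ?_ ?_ ?_)).trans hub
      · exact le_min zero_le_one hp
      · exact min_le_left _ _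
      · calc _ ≤ d / (1 - b.1 i) * (1 - b.1 i) :=
              mul_le_mul_of_nonneg_right (min_le_right _ _) (by linarith)
          _ = d := div_mul_cancel₀ _ (by linarith)
      · rcases le_total 1 (d / (1 - b.1 i)) with h' | h'
        · rw [min_eq_left h']
          linarith
        · rw [min_eq_right h']
          have h5 : d ≤ d / (1 - b.1 i) := by
            rw [le_div_iff₀ (by linarith)]
            nlinarith [hx.1]
          nlinarith
  · simp

/-- What is missing for the set `A` together with the random set of the layer, plus the gain that
the fractional vector stands for. It equals the gap for an untouched layer, and is at least twice
the gap if the covering constraint holds. -/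
noncomputable def promise (f : Finset (Fin n) → ℝ) (A : Finset (Fin n)) (b : Layer n) : ℝ :=
  ∑ j, gain f (A ∪ b.2) j * b.1 j + gap f (A ∪ b.2)

/-- Whatever function `f'` and whatever set `A'` the update is made for, raising a fractional value
increases the promised gain by no more than what the coin is expected to realize: a miss adds
`gain * d`, and a hit takes away at least `gain`. -/
theorem ex_round_promise_le (hc : ∀ j, 0 ≤ c j) (hf : IsMonotoneSubmodular f)
    {f' : Finset (Fin n) → ℝ} (hf' : IsMonotoneSubmodular f') (A A' : Finset (Fin n)) {b : Layer n}
    (hb : b.Valid) :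
    ex (round c f' A' b) (fun b => ENNReal.ofReal (promise f A b)) ≤
      ENNReal.ofReal (promise f A b) := by
  unfold round
  split_ifs
  swap
  · simp
  have hρ := admissible_rate hc hf' A' b
  refine (ex_iter_le (r := fun _ => ENNReal.ofReal 0)
    (fun _ _ _ h _ h' => h.raise hρ h') (fun k hk b' hb' => ?_) (Midway.start hb)).trans (by simp)
  refine ex_raise_le (u := promise f A) hρ hb' (fun _ => rfl) ?_
  rintro hk hkb d hdd t f₁ rfl rfl
  set i : Fin n := ⟨k, hk⟩
  have hd : 0 ≤ d := hdd ▸ incr_nonneg (hb'.valid i).1 (hρ i).1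
  have hx : ∀ j, 0 ≤ b'.1 j := fun j => (hb'.valid j).1
  have hx' : ∀ j, 0 ≤ Function.update b'.1 i (b'.1 i + d) j := by
    intro j
    by_cases h : j = i
    · subst h
      simp only [Function.update_self]
      linarith [hx i]
    · simpa only [Function.update_of_ne h] using hx j
  have hpos : ∀ (x : Fin n → ℝ) (R : Finset (Fin n)), (∀ j, 0 ≤ x j) → 0 ≤ promise f A (x, R) :=
    fun x R hx => add_nonneg
      (Finset.sum_nonneg fun j _ => mul_nonneg (hf.gain_nonneg _ j) (hx j)) (hf.gap_nonneg _)
  refine ⟨hpos _ _ hx', hpos _ _ hx', fun q hq0 hq1 _ hq => ?_⟩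
  have hmiss : promise f A (Function.update b'.1 i (b'.1 i + d), b'.2)
      = promise f A b' + gain f (A ∪ b'.2) i * d := by
    have : ∀ j, gain f (A ∪ b'.2) j * Function.update b'.1 i (b'.1 i + d) j
        = gain f (A ∪ b'.2) j * b'.1 j + if j = i then gain f (A ∪ b'.2) i * d else 0 := by
      intro j
      by_cases h : j = i
      · subst h
        simp only [Function.update_self, if_true]
        ring
      · simp [h]
    simp only [promise, this, Finset.sum_add_distrib, Finset.sum_ite_eq', Finset.mem_univ, if_true]
    ring
  have hhit : promise f A (Function.update b'.1 i (b'.1 i + d), insert i b'.2)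
      ≤ promise f A b' - gain f (A ∪ b'.2) i := by
    simp only [promise, Finset.union_insert, gap_insert]
    have : ∑ j, gain f (insert i (A ∪ b'.2)) j * Function.update b'.1 i (b'.1 i + d) j
        ≤ ∑ j, gain f (A ∪ b'.2) j * b'.1 j := by
      refine Finset.sum_le_sum fun j _ => ?_
      by_cases h : j = i
      · subst h
        rw [gain_of_mem (Finset.mem_insert_self _ _), zero_mul]
        exact mul_nonneg (hf.gain_nonneg _ _) (hx _)
      · rw [Function.update_of_ne h]
        exact mul_le_mul_of_nonneg_right (hf.gain_anti (Finset.subset_insert _ _) j) (hx j)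
    linarith
  rw [hmiss]
  have h1 := mul_le_mul_of_nonneg_left hhit hq0
  have h2 := mul_le_mul_of_nonneg_right hq (hf.gain_nonneg (A ∪ b'.2) i)
  nlinarith

/-- The cost of the random set, plus the fractional cost of the other elements. -/
noncomputable def mixedCost (c : Fin n → ℝ) (b : Layer n) : ℝ :=
  ∑ j, c j * if j ∈ b.2 then 1 else b.1 j

theorem mixedCost_nonneg (hc : ∀ j, 0 ≤ c j) {b : Layer n} (hb : ∀ j, 0 ≤ b.1 j) :
    0 ≤ mixedCost c b :=
  Finset.sum_nonneg fun j _ => mul_nonneg (hc j) (by split_ifs; exacts [zero_le_one, hb j])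

theorem cost_le_mixedCost (hc : ∀ j, 0 ≤ c j) {b : Layer n} (hb : b.Valid) :
    cost c b.2 ≤ mixedCost c b := by
  calc cost c b.2 = ∑ j, if j ∈ b.2 then c j else 0 := by simp [cost]
    _ ≤ mixedCost c b := Finset.sum_le_sum fun j _ => by
        split_ifs
        · simp
        · exact mul_nonneg (hc j) (hb j).1

/-- A raise by `d` moves the mixed cost of `j` up by `c j * d` in case of a miss and by
`c j * (1 - x)` in case of a hit. Both contribute at most `c j * d` to the expectation. -/
theorem ex_raises_mixedCost_le (hc : ∀ j, 0 ≤ c j) {ρ : Fin n → ℝ} {b : Layer n}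
    (hρ : Admissible ρ b) (hb : b.Valid) :
    ex (iter (raise ρ) n b) (fun b => ENNReal.ofReal (mixedCost c b)) ≤
      ENNReal.ofReal (mixedCost c b + 2 * ∑ j, c j * incr n (b.1 j) (ρ j)) := by
  have hd : ∀ j, 0 ≤ c j * incr n (b.1 j) (ρ j) := fun j =>
    mul_nonneg (hc j) (incr_nonneg (hb j).1 (hρ j).1)
  let r : ℕ → ℝ := fun k => if h : k < n then 2 * (c ⟨k, h⟩ * incr n (b.1 ⟨k, h⟩) (ρ ⟨k, h⟩)) else 0
  have hr : ∀ k, 0 ≤ r k := by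
    intro k
    simp only [r]
    split_ifs with h
    · exact mul_nonneg zero_le_two (hd _)
    · exact le_rfl
  have hsum : ∑ k ∈ Finset.range n, ENNReal.ofReal (r k)
      = ENNReal.ofReal (2 * ∑ j, c j * incr n (b.1 j) (ρ j)) := by
    rw [← ENNReal.ofReal_sum_of_nonneg fun k _ => hr k, Finset.sum_range, Finset.mul_sum]
    simp [r]
  rw [ENNReal.ofReal_add (mixedCost_nonneg hc fun j => (hb j).1)
    (mul_nonneg zero_le_two (Finset.sum_nonneg fun j _ => hd j)), ← hsum]
  refine ex_iter_le (fun _ _ _ h _ h' => h.raise hρ h') (fun k hk b' hb' => ?_) (Midway.start hb)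
  refine ex_raise_le (u := mixedCost c) hρ hb' (fun _ => rfl) ?_
  rintro hk hkb d hdd t f₁ rfl rfl
  set i : Fin n := ⟨k, hk⟩ with hi
  have hrk : r k = 2 * (c i * d) := by
    simp only [r, dif_pos hk, hdd, hb'.todo i le_rfl, ← hi]
  have hd : 0 ≤ d := hdd ▸ incr_nonneg (hb'.valid i).1 (hρ i).1
  have hx' : ∀ j, 0 ≤ Function.update b'.1 i (b'.1 i + d) j := by
    intro j
    by_cases h : j = i
    · subst h
      simp only [Function.update_self]
      linarith [(hb'.valid i).1]
    · simpa only [Function.update_of_ne h] using (hb'.valid j).1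
  refine ⟨mixedCost_nonneg hc hx', mixedCost_nonneg hc hx', fun q hq0 hq1 hq _ => ?_⟩
  have key : ∀ (x : Fin n → ℝ) (R : Finset (Fin n)) (v : ℝ),
      (∀ j, (if j ∈ R then 1 else x j) = (if j ∈ b'.2 then 1 else b'.1 j) + if j = i then v else 0) →
      mixedCost c (x, R) = mixedCost c b' + c i * v := by
    intro x R v h
    simp only [mixedCost, h, mul_add, Finset.sum_add_distrib, mul_ite, mul_zero, Finset.sum_ite_eq',
      Finset.mem_univ, if_true]
  have hhit := key (Function.update b'.1 i (b'.1 i + d)) (insert i b'.2) (1 - b'.1 i) fun j => by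
    by_cases h : j = i
    · subst h
      simp [hkb]
    · simp [h]
  have hmiss := key (Function.update b'.1 i (b'.1 i + d)) b'.2 d fun j => by
    by_cases h : j = i
    · subst h
      simp [hkb]
    · simp [h]
  rw [hhit, hmiss, hrk]
  have h1 := mul_le_mul_of_nonneg_right hq (hc i)
  have h2 : 0 ≤ q * (c i * d) := mul_nonneg hq0 (mul_nonneg (hc i) hd)
  nlinarith

/-- The distance from the fractional vector to the cover `X`, a sum of logarithms. The numerator `4`
bounds `x j + 1 / n` for valid layers, so that no summand is negative. -/
noncomputable def divergence (c : Fin n → ℝ) (X : Finset (Fin n)) (x : Fin n → ℝ) : ℝ :=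
  ∑ j ∈ X, c j * Real.log (4 / (x j + 1 / n))

/-- The potential that pays for the cost of a layer. The factor of the divergence is chosen such that
its decrease in a violated round outweighs the expected increase of the mixed cost. -/
noncomputable def potential (c : Fin n → ℝ) (X : Finset (Fin n)) (b : Layer n) : ℝ :=
  mixedCost c b + 4 / Real.log 2 * divergence c X b.1

theorem divergence_nonneg (hc : ∀ j, 0 ≤ c j) (X : Finset (Fin n)) {b : Layer n} (hb : b.Valid) :
    0 ≤ divergence c X b.1 := by
  refine Finset.sum_nonneg fun j _ => mul_nonneg (hc j) (Real.log_nonneg ?_)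
  have hn : 0 < (n : ℝ) := by exact_mod_cast j.pos
  have h1 : (1 : ℝ) / n ≤ 1 := by
    rw [div_le_one hn]
    exact_mod_cast j.pos
  have h2 := hb j
  rw [one_le_div (by have := h2.1; positivity)]
  linarith [h2.2.1]

/-- Let `S` be the covered set before a violated round and `M` the largest gain per cost. Then
`c j * rate j = gain j / M`, so that the violated constraint bounds the expected increase of the mixed
cost by `4 * gap f S / M`. The cover `X` has total gain at least `gap f S`, so that the divergence
decreases by at least `log 2 * gap f S / M`. -/
theorem ex_round_potential_le (hc : ∀ j, 0 ≤ c j) (hf : IsMonotoneSubmodular f)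
    {A X : Finset (Fin n)} (hA : ∀ j, ¬ 0 < c j → j ∈ A) (hX : IsCover f X) {b : Layer n}
    (hb : b.Valid) :
    ex (round c f A b) (fun b => ENNReal.ofReal (potential c X b)) ≤
      ENNReal.ofReal (potential c X b) := by
  unfold round
  split_ifs with hv
  swap
  · simp
  set S := A ∪ b.2 with hS
  have hAS : ∀ j, ¬ 0 < c j → j ∈ S := fun j hj => Finset.mem_union_left b.2 (hA j hj)
  have hρ := admissible_rate hc hf A b
  have hgap : 0 < gap f S := lt_of_le_of_lt
    (Finset.sum_nonneg fun j _ => mul_nonneg (hf.gain_nonneg _ j) (hb j).1) hv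
  have hM := maxRatio_pos hf hAS hgap
  set M := maxRatio c f S
  set x' : Fin n → ℝ := fun j => b.1 j + incr n (b.1 j) (rate c f S j) with hx'
  have hlog2 : 0 < Real.log 2 := Real.log_pos one_lt_two
  -- after the update the fractional vector is `x'`, for all outcomes of the coins
  have hstep : ∀ b' ∈ (iter (raise (rate c f S)) n b).support, b'.1 = x' ∧ b'.Valid := by
    intro b' hb'
    have := midway_end hρ hb hb'
    exact ⟨funext fun j => this.done j j.2, this.valid⟩
  obtain ⟨b₁, hb₁⟩ := (iter (raise (rate c f S)) n b).support_nonempty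
  have hdiv' : 0 ≤ divergence c X x' := by
    obtain ⟨e, hv'⟩ := hstep b₁ hb₁
    exact e ▸ divergence_nonneg hc X hv'
  have hcost : ∑ j, c j * incr n (b.1 j) (rate c f S j) ≤ 2 * (gap f S / M) := by
    have h1 : ∀ j, c j * incr n (b.1 j) (rate c f S j)
        = (gain f S j * b.1 j + gain f S j * (1 / n)) / M := by
      intro j
      have := cost_mul_rate (f := f) hAS j
      unfold incr
      rw [mul_comm _ (rate c f S j), ← mul_assoc, this]
      ring
    rw [Finset.sum_congr rfl fun j _ => h1 j, ← Finset.sum_div, Finset.sum_add_distrib,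
      ← mul_div_assoc]
    refine div_le_div_of_nonneg_right ?_ hM.le
    have h2 : ∑ j, gain f S j * (1 / (n : ℝ)) ≤ gap f S := by
      calc _ ≤ ∑ _j : Fin n, gap f S * (1 / (n : ℝ)) :=
            Finset.sum_le_sum fun j _ =>
              mul_le_mul_of_nonneg_right (hf.gain_le_gap S j) (by positivity)
        _ ≤ gap f S := by
            rcases Nat.eq_zero_or_pos n with h0 | h0
            · subst h0
              simpa using hgap.le
            · have : (n : ℝ) ≠ 0 := by exact_mod_cast h0.ne'
              simp only [Finset.sum_const, Finset.card_univ, Fintype.card_fin, nsmul_eq_mul]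
              field_simp
              exact le_rfl
    have h3 : ∑ j, gain f S j * b.1 j < gap f S := hv
    linarith
  have hdrop : divergence c X x' + Real.log 2 * (gap f S / M) ≤ divergence c X b.1 := by
    have h1 : gap f S / M ≤ ∑ j ∈ X, c j * rate c f S j := by
      rw [Finset.sum_congr rfl fun j _ => cost_mul_rate (f := f) hAS j, ← Finset.sum_div]
      exact div_le_div_of_nonneg_right (hf.gap_le_sum_gain hX S) hM.le
    have h2 : divergence c X x' + Real.log 2 * ∑ j ∈ X, c j * rate c f S j
        ≤ divergence c X b.1 := by
      rw [divergence, divergence, Finset.mul_sum, ← Finset.sum_add_distrib]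
      refine Finset.sum_le_sum fun j _ => ?_
      have hn : 0 < (n : ℝ) := by exact_mod_cast j.pos
      have hy : 0 < b.1 j + 1 / n := by
        have := (hb j).1
        positivity
      have hr0 := (hρ j).1
      have hr1 := (hρ j).2.1
      have e : x' j + 1 / n = (b.1 j + 1 / n) * (1 + rate c f S j) := by
        simp only [hx', incr]
        ring
      have h3 : Real.log 2 * rate c f S j ≤ Real.log (1 + rate c f S j) := by
        -- concavity of the logarithm between `1` and `2`
        have := strictConcaveOn_log_Ioi.concaveOn.2 (show (1 : ℝ) ∈ Set.Ioi 0 by simp)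
          (show (2 : ℝ) ∈ Set.Ioi 0 by simp)
          (show 0 ≤ 1 - rate c f S j by linarith) hr0 (by ring)
        simp only [smul_eq_mul, Real.log_one, mul_zero, zero_add] at this
        rw [show (1 - rate c f S j) * 1 + rate c f S j * 2 = 1 + rate c f S j by ring] at this
        linarith
      have h4 : Real.log (4 / (x' j + 1 / n))
          = Real.log (4 / (b.1 j + 1 / n)) - Real.log (1 + rate c f S j) := by
        rw [e, ← div_div, Real.log_div (by positivity) (by linarith)]
      rw [h4]
      have := mul_le_mul_of_nonneg_left h3 (hc j)
      nlinarith
    have := mul_le_mul_of_nonneg_left h1 hlog2.le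
    linarith
  calc ex (iter (raise (rate c f S)) n b) (fun b => ENNReal.ofReal (potential c X b))
      = ex (iter (raise (rate c f S)) n b) (fun b => ENNReal.ofReal (mixedCost c b)
          + ENNReal.ofReal (4 / Real.log 2 * divergence c X x')) := by
        refine ex_congr fun b' hb' => ?_
        obtain ⟨e, hv'⟩ := hstep b' hb'
        rw [potential, e, ENNReal.ofReal_add (mixedCost_nonneg hc fun j => (hv' j).1)
          (by positivity)]
    _ ≤ ENNReal.ofReal (mixedCost c b + 2 * ∑ j, c j * incr n (b.1 j) (rate c f S j))
          + ENNReal.ofReal (4 / Real.log 2 * divergence c X x') := by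
        rw [ex_add, ex_const]
        gcongr
        exact ex_raises_mixedCost_le hc hρ hb
    _ ≤ ENNReal.ofReal (potential c X b) := by
        have hm := mixedCost_nonneg hc fun j => (hb j).1
        have hs : 0 ≤ ∑ j, c j * incr n (b.1 j) (rate c f S j) := Finset.sum_nonneg fun j _ =>
          mul_nonneg (hc j) (incr_nonneg (hb j).1 (hρ j).1)
        rw [← ENNReal.ofReal_add (by positivity) (by positivity)]
        refine ENNReal.ofReal_le_ofReal ?_
        have h5 := mul_le_mul_of_nonneg_left hdrop (show 0 ≤ 4 / Real.log 2 by positivity)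
        have h6 : 4 / Real.log 2 * (Real.log 2 * (gap f S / M)) = 4 * (gap f S / M) := by
          field_simp
        rw [mul_add, h6] at h5
        rw [potential]
        linarith

end Potentials

section Layers
variable {n : ℕ} {c : Fin n → ℝ}

/-! ### Independence of the layers -/

/-- The function depends only on the layers below `i`. -/
def DependsBelow (i : ℕ) (φ : (ℕ → Layer n) → ℝ≥0∞) : Prop :=
  ∀ σ σ', (∀ l < i, σ l = σ' l) → φ σ = φ σ'

theorem ex_layerKernel (f : Finset (Fin n) → ℝ) (i : ℕ) (σ : ℕ → Layer n)
    (φ : (ℕ → Layer n) → ℝ≥0∞) : ex (layerKernel c f i σ) φ =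
      ex (layerStep c f (lower c σ i) (σ i)) fun b => φ (Function.update σ i b) :=
  ex_map _ _ _

theorem eq_of_mem_support_layers {f : Finset (Fin n) → ℝ} {i : ℕ} {σ σ' : ℕ → Layer n}
    (h : σ' ∈ (iter (layerKernel c f) i σ).support) {l : ℕ} (hl : i ≤ l) : σ' l = σ l := by
  refine iter_support (I := fun k σ' => ∀ l, k ≤ l → σ' l = σ l) (fun k _ τ hτ τ' hτ' l hl => ?_)
    (fun _ _ => rfl) σ' h l hl
  obtain ⟨b, _, rfl⟩ := (PMF.mem_support_map_iff _ _ _).1 hτ'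
  rw [Function.update_of_ne (by omega)]
  exact hτ l (by omega)

theorem DependsBelow.ex_layers {j : ℕ} {φ : (ℕ → Layer n) → ℝ≥0∞} (hφ : DependsBelow j φ)
    (f : Finset (Fin n) → ℝ) {i : ℕ} (hi : i ≤ j) :
    DependsBelow j fun σ => ex (iter (layerKernel c f) i σ) φ := by
  induction i generalizing φ with
  | zero => simpa [iter] using hφ
  | succ i ih =>
    simp only [iter, ex_bind]
    refine ih (fun σ σ' h => ?_) (by omega)
    simp only [ex_layerKernel]
    rw [lower_congr c fun l hl => h l (by omega), h i (by omega)]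
    refine congrArg _ (funext fun b => hφ _ _ fun l hl => ?_)
    by_cases hli : l = i
    · subst hli
      simp
    · simpa only [Function.update_of_ne hli] using h l hl

/-- Later layers do not influence earlier ones. -/
theorem DependsBelow.ex_eq {i N : ℕ} {φ : (ℕ → Layer n) → ℝ≥0∞} (hφ : DependsBelow i φ)
    (f : Finset (Fin n) → ℝ) (hN : i ≤ N) (σ : ℕ → Layer n) :
    ex (iter (layerKernel c f) N σ) φ = ex (iter (layerKernel c f) i σ) φ := by
  induction N, hN using Nat.le_induction with
  | base => rfl
  | succ N hN ih =>
    rw [iter, ex_bind, ← ih]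
    refine ex_congr fun σ' _ => ?_
    rw [ex_layerKernel]
    refine (ex_congr fun b _ => ?_).trans (ex_const _ (φ σ'))
    exact hφ _ _ fun l hl => Function.update_of_ne (by omega) _ _

theorem dependsBelow_lower (i : ℕ) (u : Finset (Fin n) → ℝ≥0∞) :
    DependsBelow i fun σ => u (lower c σ i) := fun σ σ' h => by
  simp only [lower_congr c h]

/-- The expectation after one time step of a function that depends on the layers up to `i`: the
lower layers move first, and then the layer `i`. -/
theorem ex_layers_top {f : Finset (Fin n) → ℝ} {i : ℕ} (hi : i < n)
    {H : (ℕ → Layer n) → Layer n → ℝ≥0∞} (hH : ∀ b, DependsBelow i fun σ => H σ b)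
    (σ : ℕ → Layer n) :
    ex (iter (layerKernel c f) n σ) (fun σ' => H σ' (σ' i)) =
      ex (iter (layerKernel c f) i σ) fun σ' => ex (layerStep c f (lower c σ' i) (σ i)) (H σ') := by
  have h1 : DependsBelow (i + 1) fun σ' => H σ' (σ' i) := fun σ σ' h => by
    simp only [h i (by omega)]
    exact hH _ _ _ fun l hl => h l (by omega)
  rw [h1.ex_eq f hi σ, iter, ex_bind]
  refine ex_congr fun σ' hσ' => ?_
  rw [ex_layerKernel, eq_of_mem_support_layers hσ' le_rfl]
  refine ex_congr fun b _ => ?_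
  rw [Function.update_self]
  exact hH _ _ _ fun l hl => Function.update_of_ne (by omega) _ _

theorem layers_valid (hc : ∀ j, 0 ≤ c j) {f : Finset (Fin n) → ℝ} (hf : IsMonotoneSubmodular f)
    {N : ℕ} {σ σ' : ℕ → Layer n} (hσ : ∀ i, (σ i).Valid)
    (h : σ' ∈ (iter (layerKernel c f) N σ).support) (i : ℕ) : (σ' i).Valid := by
  refine iter_support (I := fun _ σ => ∀ i, (σ i).Valid) (fun k _ τ hτ τ' hτ' i => ?_) hσ σ' h i
  obtain ⟨b, hb, rfl⟩ := (PMF.mem_support_map_iff _ _ _).1 hτ'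
  by_cases hik : i = k
  · subst hik
    simpa using layerStep_valid hc hf (hτ i) hb
  · simpa only [Function.update_of_ne hik] using hτ i

theorem layersAfter_valid (hc : ∀ j, 0 ≤ c j) {f : ℕ → Finset (Fin n) → ℝ}
    (hf : ∀ t, 1 ≤ t → IsMonotoneSubmodular (f t)) {T : ℕ} {σ : ℕ → Layer n}
    (h : σ ∈ (layersAfter c f T).support) (i : ℕ) : (σ i).Valid := by
  induction T generalizing σ i with
  | zero =>
    rw [(PMF.mem_support_pure_iff _ _).1 h]
    exact Layer.valid_idle
  | succ T ih =>
    obtain ⟨τ, hτ, h⟩ := (PMF.mem_support_bind_iff _ _ _).1 h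
    exact layers_valid hc (hf _ (by omega)) (ih hτ) h i

/-- All covering constraints hold after a time step. -/
theorem not_violated_layers (hc : ∀ j, 0 ≤ c j) {f : Finset (Fin n) → ℝ}
    (hf : IsMonotoneSubmodular f) {N : ℕ} {σ σ' : ℕ → Layer n} (hσ : ∀ i, (σ i).Valid)
    (h : σ' ∈ (iter (layerKernel c f) N σ).support) :
    ∀ i < N, ¬ Violated f (lower c σ' i) (σ' i) := by
  refine (iter_support (I := fun N σ' => (∀ i, (σ' i).Valid) ∧
    ∀ i < N, ¬ Violated f (lower c σ' i) (σ' i)) (fun k _ τ hτ τ' hτ' => ⟨?_, fun i hi => ?_⟩)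
    ⟨hσ, by simp⟩ σ' h).2
  · intro i
    obtain ⟨b, hb, rfl⟩ := (PMF.mem_support_map_iff _ _ _).1 hτ'
    by_cases hik : i = k
    · subst hik
      simpa using layerStep_valid hc hf (hτ.1 i) hb
    · simpa only [Function.update_of_ne hik] using hτ.1 i
  · obtain ⟨b, hb, rfl⟩ := (PMF.mem_support_map_iff _ _ _).1 hτ'
    rw [lower_congr c (σ' := τ) fun l hl => Function.update_of_ne (by omega) _ _]
    by_cases hik : i = k
    · subst hik
      rw [Function.update_self]
      exact not_violated_of_layerStep hc hf (fun j hj => zero_cost_mem_lower hj) (hτ.1 i) hb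
    · rw [Function.update_of_ne hik]
      exact hτ.2 i (by omega)

/-- The layer `i` may be analysed against the final state of the lower layers: a function of both
whose expectation no step of the layer `i` increases, for any fixed state of the lower layers, has
at the end at most the expectation that it has for an untouched layer `i`. -/
theorem ex_layersAfter_le (hc : ∀ j, 0 ≤ c j) {f : ℕ → Finset (Fin n) → ℝ}
    (hf : ∀ t, 1 ≤ t → IsMonotoneSubmodular (f t)) {i : ℕ} (hi : i < n) (T : ℕ)
    {H : (ℕ → Layer n) → Layer n → ℝ≥0∞} (hH : ∀ b, DependsBelow i fun σ => H σ b)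
    (hstep : ∀ t, 1 ≤ t → ∀ A σ, ∀ b : Layer n, b.Valid →
      ex (layerStep c (f t) A b) (H σ) ≤ H σ b) :
    ex (layersAfter c f T) (fun σ => H σ (σ i)) ≤
      ex (layersAfter c f T) fun σ => H σ (Layer.idle n) := by
  induction T generalizing H with
  | zero => simp [layersAfter]
  | succ T ih =>
    simp only [layersAfter, ex_bind]
    -- average over the moves of the lower layers at the last time step
    let H' : (ℕ → Layer n) → Layer n → ℝ≥0∞ := fun σ b =>
      ex (iter (layerKernel c (f (T + 1))) i σ) fun σ' => H σ' b
    calc ex (layersAfter c f T) (fun σ => ex (iter (layerKernel c (f (T + 1))) n σ)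
          fun σ' => H σ' (σ' i))
        ≤ ex (layersAfter c f T) (fun σ => H' σ (σ i)) := by
          refine ex_mono fun σ hσ => ?_
          rw [ex_layers_top hi hH]
          exact ex_mono fun σ' _ => hstep _ (by omega) _ _ _ (layersAfter_valid hc hf hσ i)
      _ ≤ ex (layersAfter c f T) (fun σ => H' σ (Layer.idle n)) := by
          refine ih (fun b => (hH b).ex_layers _ le_rfl) fun t ht A σ b hb => ?_
          simp only [H']
          rw [ex_comm]
          exact ex_mono fun σ' _ => hstep t ht A σ' b hb
      _ = _ := ex_congr fun σ _ => ((hH _).ex_eq _ hi.le σ).symm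

/-- The growth of a potential of a single layer, in terms of a bound `r` that may depend on the lower
layers. -/
theorem ex_layer_le (hc : ∀ j, 0 ≤ c j) {f : ℕ → Finset (Fin n) → ℝ}
    (hf : ∀ t, 1 ≤ t → IsMonotoneSubmodular (f t)) {i : ℕ} (hi : i < n) {T : ℕ}
    {φ : Layer n → ℝ≥0∞} {r : ℕ → Finset (Fin n) → ℝ≥0∞}
    (h : ∀ t < T, ∀ A, (∀ j, ¬ 0 < c j → j ∈ A) → ∀ b : Layer n, b.Valid →
      ex (layerStep c (f (t + 1)) A b) φ ≤ φ b + r t A) :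
    ex (layersAfter c f T) (fun σ => φ (σ i)) ≤ φ (Layer.idle n) +
      ∑ t ∈ Finset.range T, ex (layersAfter c f (t + 1)) fun σ => r t (lower c σ i) := by
  induction T with
  | zero => simp [layersAfter]
  | succ T ih =>
    rw [Finset.sum_range_succ, ← add_assoc]
    refine le_trans ?_ (add_le_add (ih fun t ht => h t (by omega)) le_rfl)
    simp only [layersAfter, ex_bind]
    rw [← ex_add]
    refine ex_mono fun σ hσ => ?_
    rw [ex_layers_top hi (H := fun _ => φ) (fun _ _ _ _ => rfl),
      (dependsBelow_lower i (r T)).ex_eq _ hi.le]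
    refine (ex_mono fun σ' _ => h T (by omega) _ (fun j hj => zero_cost_mem_lower hj) _
      (layersAfter_valid hc hf hσ i)).trans ?_
    rw [ex_add, ex_const]

/-! ### Every layer halves the expected gap -/

theorem promise_idle (f : Finset (Fin n) → ℝ) (A : Finset (Fin n)) :
    promise f A (Layer.idle n) = gap f A := by
  simp [promise]

/-- The layer `i` starts with the promise `gap`, the expected promise does not increase, and at the
end the covering constraint makes it at least twice the remaining gap. The function and the lower
layers in the promise are those of time `t + 1`, also during the earlier time steps. -/
theorem two_mul_ex_gap_succ_le (hc : ∀ j, 0 ≤ c j) {f : ℕ → Finset (Fin n) → ℝ}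
    (hf : ∀ t, 1 ≤ t → IsMonotoneSubmodular (f t)) {i : ℕ} (hi : i < n) (t : ℕ) :
    2 * ex (layersAfter c f (t + 1)) (fun σ => ENNReal.ofReal (gap (f (t + 1)) (lower c σ (i + 1))))
      ≤ ex (layersAfter c f (t + 1)) fun σ => ENNReal.ofReal (gap (f (t + 1)) (lower c σ i)) := by
  have hft := hf (t + 1) (by omega)
  rw [← ex_mul_left]
  calc _ ≤ ex (layersAfter c f (t + 1))
          fun σ => ENNReal.ofReal (promise (f (t + 1)) (lower c σ i) (σ i)) := by
        refine ex_mono fun σ hσ => ?_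
        obtain ⟨τ, hτ, hσ⟩ := (PMF.mem_support_bind_iff _ _ _).1 hσ
        have := not_violated_layers hc hft (layersAfter_valid hc hf hτ) hσ i hi
        rw [Violated, not_lt] at this
        rw [lower_succ, ← ENNReal.ofReal_ofNat, ← ENNReal.ofReal_mul zero_le_two, promise]
        refine ENNReal.ofReal_le_ofReal ?_
        linarith
    _ ≤ ex (layersAfter c f (t + 1))
          fun σ => ENNReal.ofReal (promise (f (t + 1)) (lower c σ i) (Layer.idle n)) :=
        ex_layersAfter_le hc hf hi (t + 1)
          (H := fun σ b => ENNReal.ofReal (promise (f (t + 1)) (lower c σ i) b))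
          (fun b => dependsBelow_lower i fun A => ENNReal.ofReal (promise (f (t + 1)) A b))
          fun s hs A σ b hb => ex_layerStep_le hc (hf s hs)
            (φ := fun b => ENNReal.ofReal (promise (f (t + 1)) (lower c σ i) b))
            (fun b hb => ex_round_promise_le hc hft (hf s hs) _ A hb) hb
    _ = _ := by simp only [promise_idle]

theorem two_pow_mul_ex_gap_le (hc : ∀ j, 0 ≤ c j) {f : ℕ → Finset (Fin n) → ℝ}
    (hf : ∀ t, 1 ≤ t → IsMonotoneSubmodular (f t)) {i : ℕ} (hi : i ≤ n) (t : ℕ) :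
    2 ^ i * ex (layersAfter c f (t + 1))
        (fun σ => ENNReal.ofReal (gap (f (t + 1)) (lower c σ i)))
      ≤ ENNReal.ofReal (f (t + 1) Finset.univ) := by
  induction i with
  | zero =>
    rw [pow_zero, one_mul]
    exact ex_le_const fun σ _ => ENNReal.ofReal_le_ofReal ((hf _ (by omega)).gap_le _)
  | succ i ih =>
    refine le_trans ?_ (ih (by omega))
    rw [pow_succ, mul_assoc]
    gcongr
    exact two_mul_ex_gap_succ_le hc hf (by omega) t

open scoped Classical in
/-- The probability that the first `i` layers fail to cover at time `t`. -/
noncomputable def failure (c : Fin n → ℝ) (f : ℕ → Finset (Fin n) → ℝ) (t i : ℕ) : ℝ≥0∞ :=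
  ex (layersAfter c f t) fun σ => if IsCover (f t) (lower c σ i) then 0 else 1

/-- A failure leaves a gap of at least `v`, and Markov's inequality applies to the gap. -/
theorem failure_le (hc : ∀ j, 0 ≤ c j) {f : ℕ → Finset (Fin n) → ℝ}
    (hf : ∀ t, 1 ≤ t → IsMonotoneSubmodular (f t)) {i : ℕ} (hi : i ≤ n) (t : ℕ) {v F : ℝ}
    (hv : 0 < v) (hgap : ∀ S, ¬ IsCover (f (t + 1)) S → v ≤ gap (f (t + 1)) S)
    (hF : f (t + 1) Finset.univ ≤ F) :
    failure c f (t + 1) i ≤ ENNReal.ofReal (F / v / 2 ^ i) := by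
  have h1 : ENNReal.ofReal v * failure c f (t + 1) i ≤ ex (layersAfter c f (t + 1))
      fun σ => ENNReal.ofReal (gap (f (t + 1)) (lower c σ i)) := by
    rw [failure, ← ex_mul_left]
    refine ex_mono fun σ _ => ?_
    split_ifs with h
    · simp
    · rw [mul_one]
      exact ENNReal.ofReal_le_ofReal (hgap _ h)
  have h2 := two_pow_mul_ex_gap_le hc hf hi t
  have h3 : failure c f (t + 1) i * ENNReal.ofReal (v * 2 ^ i) ≤ ENNReal.ofReal F := by
    rw [ENNReal.ofReal_mul hv.le, ENNReal.ofReal_pow zero_le_two, ENNReal.ofReal_ofNat]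
    calc _ = 2 ^ i * (ENNReal.ofReal v * failure c f (t + 1) i) := by ring
      _ ≤ _ := (mul_le_mul_right h1 _).trans (h2.trans (ENNReal.ofReal_le_ofReal hF))
  rw [div_div, ENNReal.ofReal_div_of_pos (by positivity)]
  rwa [ENNReal.le_div_iff_mul_le (by left; simp; positivity) (by left; simp)]

/-! ### The cost of a layer -/

open scoped Classical in
/-- The potential of a layer, counted only from its first update on. -/
noncomputable def activePotential (c : Fin n → ℝ) (X : Finset (Fin n)) (b : Layer n) : ℝ≥0∞ :=
  if b = Layer.idle n then 0 else ENNReal.ofReal (potential c X b)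

theorem cost_le_potential (hc : ∀ j, 0 ≤ c j) (X : Finset (Fin n)) {b : Layer n} (hb : b.Valid) :
    cost c b.2 ≤ potential c X b := by
  have h1 := cost_le_mixedCost hc hb
  have h2 := mul_nonneg (show 0 ≤ 4 / Real.log 2 by have := Real.log_pos one_lt_two; positivity)
    (divergence_nonneg hc X hb)
  rw [potential]
  linarith

theorem cost_le_activePotential (hc : ∀ j, 0 ≤ c j) (X : Finset (Fin n)) {b : Layer n}
    (hb : b.Valid) : ENNReal.ofReal (cost c b.2) ≤ activePotential c X b := by
  rw [activePotential]
  split_ifs with h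
  · simp [h, cost]
  · exact ENNReal.ofReal_le_ofReal (cost_le_potential hc X hb)

/-- The potential of an untouched layer bounds the expected cost. A layer remains untouched as long as
the lower layers cover, and these do not depend on it, so that the bound may be multiplied by the
probability that they fail at some time. -/
theorem ex_layer_cost_le (hc : ∀ j, 0 ≤ c j) {f : ℕ → Finset (Fin n) → ℝ}
    (hf : ∀ t, 1 ≤ t → IsMonotoneSubmodular (f t)) {i : ℕ} (hi : i < n) {T : ℕ}
    {X : Finset (Fin n)} (hX : ∀ t < T, IsCover (f (t + 1)) X) :
    ex (layersAfter c f T) (fun σ => ENNReal.ofReal (cost c (σ i).2)) ≤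
      ENNReal.ofReal (potential c X (Layer.idle n)) *
        min 1 (∑ t ∈ Finset.range T, failure c f (t + 1) i) := by
  classical
  have hpot : ∀ t < T, ∀ A, (∀ j, ¬ 0 < c j → j ∈ A) → ∀ b : Layer n, b.Valid →
      ex (layerStep c (f (t + 1)) A b) (fun b => ENNReal.ofReal (potential c X b)) ≤
        ENNReal.ofReal (potential c X b) := fun t ht A hA b hb =>
    ex_layerStep_le hc (hf _ (by omega)) (φ := fun b => ENNReal.ofReal (potential c X b))
      (fun b hb => ex_round_potential_le hc (hf _ (by omega)) hA (hX t ht) hb) hb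
  rw [mul_min, mul_one]
  refine le_min ?_ ?_
  · refine (ex_mono fun σ hσ => ENNReal.ofReal_le_ofReal
      (cost_le_potential hc X (layersAfter_valid hc hf hσ i))).trans ?_
    refine (ex_layer_le hc hf hi (φ := fun b => ENNReal.ofReal (potential c X b))
      (r := fun _ _ => 0) fun t ht A hA b hb => ?_).trans (by simp [ex_const])
    simpa using hpot t ht A hA b hb
  · refine (ex_mono fun σ hσ =>
      cost_le_activePotential hc X (layersAfter_valid hc hf hσ i)).trans ?_
    refine (ex_layer_le hc hf hi (φ := activePotential c X) (r := fun t A =>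
      ENNReal.ofReal (potential c X (Layer.idle n)) * if IsCover (f (t + 1)) A then 0 else 1)
      fun t ht A hA b hb => ?_).trans ?_
    · split_ifs with hcov
      · rw [layerStep_of_isCover (hf _ (by omega)) hcov hb]
        simp
      · rw [mul_one]
        have h1 : ex (layerStep c (f (t + 1)) A b) (activePotential c X)
            ≤ ENNReal.ofReal (potential c X b) := by
          refine (ex_mono fun b' _ => ?_).trans (hpot t ht A hA b hb)
          rw [activePotential]
          split_ifs
          · exact zero_le
          · exact le_rfl
        refine h1.trans ?_
        rw [activePotential]
        split_ifs with hb0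
        · rw [hb0, zero_add]
        · exact le_self_add
    · simp only [ex_mul_left, ← Finset.mul_sum]
      simp [activePotential, failure]

theorem cost_union_le (hc : ∀ j, 0 ≤ c j) (S S' : Finset (Fin n)) :
    cost c (S ∪ S') ≤ cost c S + cost c S' := by
  rw [cost, cost, cost, ← Finset.sum_union_inter]
  exact le_add_of_nonneg_right (Finset.sum_nonneg fun j _ => hc j)

theorem cost_nonneg (hc : ∀ j, 0 ≤ c j) (S : Finset (Fin n)) : 0 ≤ cost c S :=
  Finset.sum_nonneg fun j _ => hc j

theorem cost_lower_le (hc : ∀ j, 0 ≤ c j) (σ : ℕ → Layer n) (i : ℕ) :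
    ENNReal.ofReal (cost c (lower c σ i)) ≤
      ∑ l ∈ Finset.range i, ENNReal.ofReal (cost c (σ l).2) := by
  induction i with
  | zero =>
    simp only [Finset.range_zero, Finset.sum_empty, nonpos_iff_eq_zero, ENNReal.ofReal_eq_zero]
    refine Finset.sum_nonpos fun j hj => ?_
    simpa [lower] using hj
  | succ i ih =>
    rw [Finset.sum_range_succ, lower_succ]
    refine (ENNReal.ofReal_le_ofReal (cost_union_le hc _ _)).trans ?_
    exact ENNReal.ofReal_add_le.trans (add_le_add ih le_rfl)

open scoped Classical in
/-- The states of the layers, together with a flag that tells whether all layers together have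
failed to cover at some time. -/
noncomputable def flagged (c : Fin n → ℝ) (f : ℕ → Finset (Fin n) → ℝ) :
    ℕ → PMF ((ℕ → Layer n) × Bool)
  | 0 => PMF.pure (fun _ => Layer.idle n, false)
  | t + 1 => (flagged c f t).bind fun z => (iter (layerKernel c (f (t + 1))) n z.1).map fun σ =>
      (σ, z.2 || decide (¬ IsCover (f (t + 1)) (lower c σ n)))

theorem flagged_fst (c : Fin n → ℝ) (f : ℕ → Finset (Fin n) → ℝ) (t : ℕ) :
    (flagged c f t).map Prod.fst = layersAfter c f t := by
  induction t with
  | zero => simp [flagged, layersAfter, PMF.pure_map]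
  | succ t ih =>
    rw [flagged, PMF.map_bind, layersAfter, ← ih, PMF.bind_map]
    refine congrArg _ (funext fun z => ?_)
    rw [PMF.map_comp]
    exact PMF.map_id _

theorem ex_flag_le (c : Fin n → ℝ) (f : ℕ → Finset (Fin n) → ℝ) (T : ℕ) :
    ex (flagged c f T) (fun z => if z.2 then 1 else 0) ≤
      ∑ t ∈ Finset.range T, failure c f (t + 1) n := by
  classical
  induction T with
  | zero => simp [flagged]
  | succ T ih =>
    rw [Finset.sum_range_succ]
    refine le_trans ?_ (add_le_add ih le_rfl)
    rw [failure, layersAfter, ← flagged_fst, flagged, ex_bind, ex_bind, ex_map, ← ex_add]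
    refine ex_mono fun z _ => ?_
    rw [ex_map]
    refine le_trans (ex_mono (ψ := fun σ => (if z.2 then 1 else 0) +
      if IsCover (f (T + 1)) (lower c σ n) then 0 else 1) fun σ _ => ?_) ?_
    · cases z.2 <;> by_cases h : IsCover (f (T + 1)) (lower c σ n) <;> simp [h]
    · rw [ex_add, ex_const]

end Layers

section Ratio
variable {n : ℕ} {c : Fin n → ℝ}

/-! ### The competitive ratio -/

/-- The first `m` terms are at most one each, and the other ones form a geometric series. -/
theorem sum_min_one_pow_le (m N : ℕ) :
    ∑ i ∈ Finset.range N, min (1 : ℝ) (2 ^ m / 2 ^ i) ≤ m + 2 := by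
  induction m generalizing N with
  | zero =>
    calc ∑ i ∈ Finset.range N, min (1 : ℝ) (2 ^ 0 / 2 ^ i)
        ≤ ∑ i ∈ Finset.range N, (1 / 2 : ℝ) ^ i := Finset.sum_le_sum fun i _ => by
          refine (min_le_right _ _).trans (le_of_eq ?_)
          rw [pow_zero, div_pow, one_pow]
      _ ≤ (0 : ℕ) + 2 := by
          rw [Nat.cast_zero, zero_add]
          exact sum_geometric_two_le N
  | succ m ih =>
    rcases N with _ | N
    · simp only [Finset.range_zero, Finset.sum_empty]
      positivity
    · rw [Finset.sum_range_succ']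
      have h1 : ∀ i, min (1 : ℝ) (2 ^ (m + 1) / 2 ^ (i + 1)) = min 1 (2 ^ m / 2 ^ i) := by
        intro i
        rw [pow_succ, pow_succ, mul_div_mul_right _ _ two_ne_zero]
      simp only [h1]
      have h2 := min_le_left (1 : ℝ) (2 ^ (m + 1) / 2 ^ 0)
      push_cast
      linarith [ih N]

theorem sum_min_one_le {K : ℝ} (hK : 1 ≤ K) (N : ℕ) :
    ∑ i ∈ Finset.range N, min 1 (K / 2 ^ i) ≤ 3 * (1 + Real.log K) := by
  have hl := Real.log_nonneg hK
  obtain ⟨m, hm1, hm2⟩ : ∃ m : ℕ, K ≤ 2 ^ m ∧ (m : ℝ) ≤ 2 * Real.log K + 1 := by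
    refine ⟨⌈Real.logb 2 K⌉₊, ?_, ?_⟩
    · have h1 := Nat.le_ceil (Real.logb 2 K)
      rw [Real.logb_le_iff_le_rpow one_lt_two (by linarith), Real.rpow_natCast] at h1
      exact h1
    · have h1 := (Nat.ceil_lt_add_one (Real.logb_nonneg one_lt_two hK)).le
      have h2 : Real.logb 2 K ≤ 2 * Real.log K := by
        rw [Real.logb, div_le_iff₀ (Real.log_pos one_lt_two)]
        nlinarith [Real.log_two_gt_d9]
      linarith
  calc ∑ i ∈ Finset.range N, min 1 (K / 2 ^ i)
      ≤ ∑ i ∈ Finset.range N, min (1 : ℝ) (2 ^ m / 2 ^ i) := Finset.sum_le_sum fun i _ => by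
        gcongr
    _ ≤ m + 2 := sum_min_one_pow_le m N
    _ ≤ 3 * (1 + Real.log K) := by linarith

/-- The bound for the failure of all layers decreases with their number, so that a fallback that costs
`N` times the optimum is paid for by the same sum as the layers. -/
theorem mul_min_one_le {K : ℝ} (hK : 0 ≤ K) (N : ℕ) :
    N * min 1 (K / 2 ^ N) ≤ ∑ i ∈ Finset.range N, min 1 (K / 2 ^ i) := by
  calc (N : ℝ) * min 1 (K / 2 ^ N) = ∑ _i ∈ Finset.range N, min 1 (K / 2 ^ N) := by simp
    _ ≤ _ := Finset.sum_le_sum fun i hi => by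
        have : i ≤ N := (Finset.mem_range.1 hi).le
        gcongr
        exact one_le_two

theorem potential_idle (c : Fin n → ℝ) (X : Finset (Fin n)) :
    potential c X (Layer.idle n) = 4 / Real.log 2 * Real.log (4 * n) * cost c X := by
  simp [potential, mixedCost, divergence, cost, Finset.mul_sum]
  refine Finset.sum_congr rfl fun j _ => by ring

theorem nonzeroMarginals_finite (f : ℕ → Finset (Fin n) → ℝ) (T : ℕ) :
    (nonzeroMarginals f T).Finite := by
  refine ((Set.toFinite (Set.Icc 1 T ×ˢ (Set.univ : Set (Fin n × Finset (Fin n))))).image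
    fun z => f z.1 (insert z.2.1 z.2.2) - f z.1 z.2.2).subset ?_
  rintro v ⟨_, t, ht, j, S, rfl⟩
  exact ⟨(t, j, S), ⟨ht, Set.mem_univ _⟩, rfl⟩

theorem exists_marginal {f : ℕ → Finset (Fin n) → ℝ} {t T : ℕ} (ht : t ∈ Set.Icc 1 T)
    (hf : IsMonotoneSubmodular (f t)) {S : Finset (Fin n)} (hS : ¬ IsCover (f t) S) :
    ∃ v ∈ nonzeroMarginals f T, v ≤ gap (f t) S := by
  have h0 : 0 < gap (f t) S :=
    lt_of_le_of_ne (hf.gap_nonneg S) fun h => hS (isCover_iff_gap.2 h.symm)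
  obtain ⟨j, _, hj⟩ : ∃ j ∈ Finset.univ, 0 < gain (f t) S j := by
    by_contra! h
    exact absurd ((hf.gap_le_sum_gain (X := Finset.univ) rfl S).trans (Finset.sum_nonpos h))
      (not_le.2 h0)
  exact ⟨gain (f t) S j, ⟨hj.ne', t, ht, j, S, rfl⟩, hf.gain_le_gap S j⟩

theorem nonzeroMarginals_pos {f : ℕ → Finset (Fin n) → ℝ} {T : ℕ}
    (hf : ∀ t, 1 ≤ t → IsMonotoneSubmodular (f t)) {v : ℝ} (hv : v ∈ nonzeroMarginals f T) :
    0 < v := by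
  obtain ⟨h0, t, ht, j, S, rfl⟩ := hv
  exact lt_of_le_of_ne ((hf t ht.1).gain_nonneg S j) h0.symm

theorem fMin_le_gap {f : ℕ → Finset (Fin n) → ℝ} {t T : ℕ} (ht : t ∈ Set.Icc 1 T)
    (hf : ∀ t, 1 ≤ t → IsMonotoneSubmodular (f t)) {S : Finset (Fin n)} (hS : ¬ IsCover (f t) S) :
    fMin f T ≤ gap (f t) S := by
  obtain ⟨v, hv, hle⟩ := exists_marginal ht (hf t ht.1) hS
  exact (csInf_le (nonzeroMarginals_finite f T).bddBelow hv).trans hle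

theorem fMin_pos {f : ℕ → Finset (Fin n) → ℝ} {T : ℕ}
    (hf : ∀ t, 1 ≤ t → IsMonotoneSubmodular (f t)) (h : (nonzeroMarginals f T).Nonempty) :
    0 < fMin f T :=
  nonzeroMarginals_pos hf (h.csInf_mem (nonzeroMarginals_finite f T))

theorem le_fTotal {f : ℕ → Finset (Fin n) → ℝ} {t T : ℕ} (ht : t ∈ Set.Icc 1 T) :
    f t Finset.univ ≤ fTotal f T :=
  le_csSup ((Set.finite_Icc 1 T).image _).bddAbove ⟨t, ht, rfl⟩

/-- The expected cost of all layers, plus the cost `n * OPT` in case of a failure. -/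
theorem ex_flagged_cost_le (hc : ∀ j, 0 ≤ c j) {f : ℕ → Finset (Fin n) → ℝ}
    (hf : ∀ t, 1 ≤ t → IsMonotoneSubmodular (f t)) {T : ℕ} (hT : 1 ≤ T) {X : Finset (Fin n)}
    (hX : ∀ t < T, IsCover (f (t + 1)) X)
    (hopt : ∀ S, IsCover (f T) S → cost c X ≤ cost c S) :
    ex (flagged c f T) (fun z => ENNReal.ofReal (cost c (lower c z.1 n)) +
        ENNReal.ofReal (n * cost c X) * if z.2 then 1 else 0) ≤
      ENNReal.ofReal (51 * (1 + Real.log n) * (1 + Real.log (T * fTotal f T / fMin f T)) *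
        cost c X) := by
  set K : ℝ := T * fTotal f T / fMin f T with hKdef
  have hX0 := cost_nonneg hc X
  have hlayers : ex (flagged c f T) (fun z => ENNReal.ofReal (cost c (lower c z.1 n))) ≤
      ∑ i ∈ Finset.range n, ENNReal.ofReal (potential c X (Layer.idle n)) *
        min 1 (∑ t ∈ Finset.range T, failure c f (t + 1) i) := by
    rw [← ex_map (flagged c f T) Prod.fst fun σ => ENNReal.ofReal (cost c (lower c σ n)),
      flagged_fst]
    refine (ex_mono fun σ _ => cost_lower_le hc σ n).trans ?_
    rw [ex_sum]
    exact Finset.sum_le_sum fun i hi => ex_layer_cost_le hc hf (Finset.mem_range.1 hi) hX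
  have hflag : ex (flagged c f T) (fun z => if z.2 then 1 else 0) ≤
      min 1 (∑ t ∈ Finset.range T, failure c f (t + 1) n) :=
    le_min (ex_le_const fun z _ => by split_ifs <;> simp) (ex_flag_le c f T)
  rw [ex_add, ex_mul_left]
  refine (add_le_add hlayers (mul_le_mul_right hflag _)).trans ?_
  rcases hX0.eq_or_lt with h0 | h0
  · rw [potential_idle, ← h0]
    simp
  -- the optimum is positive, so that the empty set is no cover
  have hempty : ¬ IsCover (f T) ∅ := fun h => by
    have := hopt ∅ h
    simp only [cost, Finset.sum_empty] at this h0
    linarith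
  have hTT : T ∈ Set.Icc 1 T := ⟨hT, le_rfl⟩
  have hmin : 0 < fMin f T := by
    obtain ⟨v, hv, _⟩ := exists_marginal hTT (hf T hT) hempty
    exact fMin_pos hf ⟨v, hv⟩
  have htot : fMin f T ≤ fTotal f T :=
    (fMin_le_gap hTT hf hempty).trans (((hf T hT).gap_le _).trans (le_fTotal hTT))
  have hK : 1 ≤ K := by
    rw [hKdef, one_le_div hmin]
    have : (1 : ℝ) ≤ T := by exact_mod_cast hT
    nlinarith
  have hfail : ∀ i ≤ n, min 1 (∑ t ∈ Finset.range T, failure c f (t + 1) i) ≤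
      ENNReal.ofReal (min 1 (K / 2 ^ i)) := by
    intro i hi
    rw [ENNReal.ofReal_min, ENNReal.ofReal_one]
    refine min_le_min le_rfl ?_
    calc ∑ t ∈ Finset.range T, failure c f (t + 1) i
        ≤ ∑ _t ∈ Finset.range T, ENNReal.ofReal (fTotal f T / fMin f T / 2 ^ i) :=
          Finset.sum_le_sum fun t ht => by
            have ht' : t + 1 ∈ Set.Icc 1 T := ⟨by omega, Finset.mem_range.1 ht⟩
            exact failure_le hc hf hi t hmin (fun S hS => fMin_le_gap ht' hf hS) (le_fTotal ht')
      _ = ENNReal.ofReal (K / 2 ^ i) := by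
          rw [Finset.sum_const, Finset.card_range, nsmul_eq_mul, ← ENNReal.ofReal_natCast,
            ← ENNReal.ofReal_mul (Nat.cast_nonneg T), hKdef]
          congr 1
          ring
  have hn : 1 ≤ n := by
    by_contra h
    have : n = 0 := by omega
    subst this
    exact hempty (congrArg (f T) (Subsingleton.elim _ _))
  have hn' : (1 : ℝ) ≤ n := by exact_mod_cast hn
  have hlogn : 0 ≤ Real.log n := Real.log_nonneg hn'
  have hlogK : 0 ≤ Real.log K := Real.log_nonneg hK
  have hP : potential c X (Layer.idle n) ≤ 16 * (1 + Real.log n) * cost c X := by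
    rw [potential_idle]
    refine mul_le_mul_of_nonneg_right ?_ hX0
    have h1 := Real.log_two_gt_d9
    have h2 := Real.log_two_lt_d9
    have h3 : Real.log (4 * n) = 2 * Real.log 2 + Real.log n := by
      rw [show (4 : ℝ) * n = 2 ^ 2 * n by norm_num, Real.log_mul (by positivity) (by positivity),
        Real.log_pow]
      norm_num
    rw [h3, div_mul_eq_mul_div, div_le_iff₀ (by linarith)]
    nlinarith
  have hP0 : 0 ≤ potential c X (Layer.idle n) :=
    (cost_nonneg hc _).trans (cost_le_potential hc X Layer.valid_idle)
  set s : ℝ := ∑ i ∈ Finset.range n, min 1 (K / 2 ^ i) with hs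
  have hterm : ∀ i, 0 ≤ min 1 (K / 2 ^ i) := fun i => le_min zero_le_one (by positivity)
  have hs0 : 0 ≤ s := Finset.sum_nonneg fun i _ => hterm i
  calc _ ≤ ∑ i ∈ Finset.range n, ENNReal.ofReal (potential c X (Layer.idle n)) *
          ENNReal.ofReal (min 1 (K / 2 ^ i)) +
        ENNReal.ofReal (n * cost c X) * ENNReal.ofReal (min 1 (K / 2 ^ n)) :=
        add_le_add (Finset.sum_le_sum fun i hi =>
          mul_le_mul_right (hfail i (Finset.mem_range.1 hi).le) _)
          (mul_le_mul_right (hfail n le_rfl) _)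
    _ = ENNReal.ofReal (potential c X (Layer.idle n) * s
          + n * cost c X * min 1 (K / 2 ^ n)) := by
        rw [← Finset.mul_sum, ← ENNReal.ofReal_sum_of_nonneg fun i _ => hterm i,
          ← ENNReal.ofReal_mul hP0, ← ENNReal.ofReal_mul (by positivity),
          ← ENNReal.ofReal_add (by positivity) (mul_nonneg (by positivity) (hterm n))]
    _ ≤ _ := by
        refine ENNReal.ofReal_le_ofReal ?_
        have h1 : s ≤ 3 * (1 + Real.log K) := sum_min_one_le hK n
        have h2 : n * min 1 (K / 2 ^ n) ≤ s := mul_min_one_le (by linarith) n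
        calc potential c X (Layer.idle n) * s + n * cost c X * min 1 (K / 2 ^ n)
            = potential c X (Layer.idle n) * s + n * min 1 (K / 2 ^ n) * cost c X := by ring
          _ ≤ 16 * (1 + Real.log n) * cost c X * s + s * cost c X := by gcongr
          _ = (17 + 16 * Real.log n) * cost c X * s := by ring
          _ ≤ 17 * (1 + Real.log n) * cost c X * (3 * (1 + Real.log K)) := by
              gcongr
              linarith
          _ = _ := by ring

end Ratio

section Program
variable {n : ℕ} {c : Fin n → ℝ} {f : Finset (Fin n) → ℝ}

/-! ### Memory cells -/

@[simp] theorem Mem.setNat_real (m : Mem) (a i v : ℕ) : (m.setNat a i v).real = m.real := rfl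

@[simp] theorem Mem.setReal_nat (m : Mem) (a i : ℕ) (v : ℝ) : (m.setReal a i v).nat = m.nat := rfl

@[simp] theorem Mem.setNat_nat_ne (m : Mem) {a a' : ℕ} (i v : ℕ) (h : a' ≠ a) :
    (m.setNat a i v).nat a' = m.nat a' := by
  simp [Mem.setNat, h]

@[simp] theorem Mem.setReal_real_ne (m : Mem) {a a' : ℕ} (i : ℕ) (v : ℝ) (h : a' ≠ a) :
    (m.setReal a i v).real a' = m.real a' := by
  simp [Mem.setReal, h]

@[simp] theorem Mem.setNat_nat_same (m : Mem) (a i v : ℕ) :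
    (m.setNat a i v).nat a = Function.update (m.nat a) i v := by
  simp [Mem.setNat]

@[simp] theorem Mem.setReal_real_same (m : Mem) (a i : ℕ) (v : ℝ) :
    (m.setReal a i v).real a = Function.update (m.real a) i v := by
  simp [Mem.setReal]

theorem Mem.readSet_congr {m m' : Mem} {a a' : ℕ} (h : m'.nat a' = m.nat a) :
    m'.readSet n a' = m.readSet n a := by
  simp only [Mem.readSet, h]

theorem Mem.mem_readSet {m : Mem} {a : ℕ} {j : Fin n} : j ∈ m.readSet n a ↔ m.nat a j ≠ 0 := by
  simp [Mem.readSet]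

theorem Mem.readSet_insert {m m' : Mem} {a : ℕ} (j : Fin n)
    (h : m'.nat a = Function.update (m.nat a) j 1) :
    m'.readSet n a = insert j (m.readSet n a) := by
  ext k
  rw [Mem.mem_readSet, Finset.mem_insert, Mem.mem_readSet, h, Function.update_apply]
  by_cases hk : k = j
  · simp [hk]
  · have : (k : ℕ) ≠ j := fun e => hk (Fin.ext e)
    simp [this, hk]

/-- The elements of index less than `k`. -/
def below (n k : ℕ) : Finset (Fin n) := Finset.univ.filter fun j => j.val < k

theorem mem_below {k : ℕ} {j : Fin n} : j ∈ below n k ↔ j.val < k := by simp [below]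

theorem below_zero : below n 0 = ∅ := by simp [below]

theorem below_self : below n n = Finset.univ := by simp [below]

theorem below_succ {k : ℕ} (h : k < n) : below n (k + 1) = insert ⟨k, h⟩ (below n k) := by
  ext j
  rw [Finset.mem_insert, mem_below, mem_below, Fin.ext_iff]
  simp only
  omega

theorem notMem_below {k : ℕ} (h : k < n) : (⟨k, h⟩ : Fin n) ∉ below n k := by simp [mem_below]

/-! ### Rules for deterministic parts -/

theorem Sim.seq_det {α : Type*} {p q : Cmd} {m : Mem} {b₁ b₂ : ℕ} {κ : PMF α} {Q : Mem → Prop}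
    {Q' : α → Mem → Prop} (hp : Sim f p m b₁ (PMF.pure ()) fun _ => Q)
    (hq : ∀ m', Q m' → Frame p m m' → Sim f q m' b₂ κ Q') :
    Sim f (.seq p q) m (b₁ + b₂ + 1) κ Q' := by
  have := Sim.seq (κ' := fun _ => κ) hp.frame fun _ m' h => hq m' h.1 h.2
  rwa [PMF.pure_bind] at this

theorem Sim.forLoop_det {v : ℕ} {N : NExp} {p : Cmd} {m : Mem} {b N₀ : ℕ} {I : ℕ → Mem → Prop}
    (hv : v ∉ p.natWrites)
    (hN : ∀ m', Frame (.forLoop v N p) m m' → N.eval m' = N₀)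
    (hI : ∀ k m' w, I k m' → I k (m'.setNat v 0 w)) (h0 : I 0 m)
    (hp : ∀ k < N₀, ∀ m', I k m' → m'.nat v 0 = k → Frame (.forLoop v N p) m m' →
      Sim f p m' b (PMF.pure ()) fun _ => I (k + 1)) :
    Sim f (.forLoop v N p) m (N₀ * (b + 3) + 3) (PMF.pure ()) fun _ => I N₀ := by
  have := Sim.forLoop (κ := fun _ => PMF.pure) (I := fun k (_ : Unit) => I k) (a := ()) hv hN
    (fun k _ => hI k) h0 fun k hk _ => hp k hk
  rwa [iter_pure] at this

theorem Sim.map {α β : Type*} {p : Cmd} {m : Mem} {b : ℕ} {κ : PMF α} {Q : α → Mem → Prop}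
    {Q' : β → Mem → Prop} (h : Sim f p m b κ Q) (g : α → β) (hg : ∀ a m', Q a m' → Q' (g a) m') :
    Sim f p m b (κ.map g) Q' := by
  obtain ⟨J, h1, h2, h3⟩ := h
  refine ⟨J.map (Prod.map g id), ?_, ?_, ?_⟩
  · rw [PMF.map_comp, ← h1, PMF.map_comp]
    rfl
  · rw [PMF.map_comp]
    exact h2
  · intro z hz
    obtain ⟨w, hw, rfl⟩ := (PMF.mem_support_map_iff _ _ _).1 hz
    exact hg _ _ (h3 w hw)

/-! ### The program

Natural arrays: `0` holds `n`, `1` the solution, `2` the set covered so far by the layers of the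
current time step, `3` the random sets of all layers (layer `i` occupies the cells from `i * n` on),
`4` the universe, `5` a set of cheaper elements. The scalars are `6` (element), `7` (layer),
`8` (the offset `i * n` of the layer), `9` and `10` (rounds), `11` (auxiliary), `12` (second element).

Real arrays: `0` holds the costs, `1` the fractional vectors of all layers, `2` the gains. The scalars
are `3` (value of the current set), `4` (value of the universe), `5` (answer of a query), `6` and `7`
(sum and maximum over the elements, for the covering constraint and the rates), `8` (increment). -/

namespace Prog

/-- The cell of the current layer that belongs to the current element. -/
abbrev cell : NExp := .add (.var 8) (.var 6)

/-- The cost of the current element. -/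
abbrev costJ : RExp := .get 0 (.var 6)

/-- The gain per cost of the current element. -/
abbrev ratioJ : RExp := .div (.get 2 (.var 6)) costJ

/-- The fractional value of the current element in the current layer. -/
abbrev valueJ : RExp := .get 1 cell

/-- Array `4` becomes the universe and array `2` the set of elements of cost zero. -/
def prepare : Cmd :=
  .forLoop 6 (.var 0)
    (.seq (.setN 4 (.var 6) (.const 1))
      (.ite (.ltR (.ofNat (.const 0)) costJ) (.setN 2 (.var 6) (.const 0))
        (.setN 2 (.var 6) (.const 1))))

/-- Add the random set of the current layer to array `2`. -/
def mergeLayer : Cmd :=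
  .forLoop 6 (.var 0) (.ite (.ltN (.const 0) (.get 3 cell)) (.setN 2 (.var 6) (.const 1)) .skip)

/-- Compute the gain of the current element over the set in array `2`, and update the sum and the
maximum that are kept in the cells `6` and `7`. -/
def gainBody : Cmd :=
  .seq (.setN 11 (.const 0) (.get 2 (.var 6)))
    (.seq (.setN 2 (.var 6) (.const 1))
      (.seq (.query 5 (.const 0) 2)
        (.seq (.setN 2 (.var 6) (.var 11))
          (.seq (.setR 2 (.var 6) (.sub (.var 5) (.var 3)))
            (.seq (.setR 6 (.const 0) (.add (.var 6) (.mul (.get 2 (.var 6)) valueJ)))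
              (.ite (.ltR (.var 7) ratioJ) (.setR 7 (.const 0) ratioJ) .skip))))))

/-- Raise the fractional value of the current element and toss the coin for it. -/
def raiseBody : Cmd :=
  .seq (.setR 8 (.const 0) (.mul (.add valueJ (.div (.ofNat (.const 1)) (.ofNat (.var 0))))
      (.div ratioJ (.var 7))))
    (.seq (.flip 11 (.const 0) (.div (.var 8) (.sub (.ofNat (.const 1)) valueJ)))
      (.seq (.setR 1 cell (.add valueJ (.var 8)))
        (.ite (.ltN (.const 0) (.var 11))
          (.seq (.setN 2 (.var 6) (.const 1)) (.setN 3 cell (.const 1))) .skip)))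

/-- One multiplicative update, if the covering constraint is violated. -/
def roundCmd : Cmd :=
  .seq (.seq (.query 3 (.const 0) 2) (.seq (.query 4 (.const 0) 4)
      (.seq (.setR 6 (.const 0) (.ofNat (.const 0))) (.setR 7 (.const 0) (.ofNat (.const 0))))))
    (.seq (.forLoop 6 (.var 0) gainBody)
      (.ite (.ltR (.var 6) (.sub (.var 4) (.var 3))) (.forLoop 6 (.var 0) raiseBody) .skip))

/-- All rounds of the current layer. -/
def rounds : Cmd :=
  .forLoop 9 (.add (.var 0) (.const 1)) (.forLoop 10 (.add (.var 0) (.const 1)) roundCmd)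

/-- The layers, one after the other. -/
def layers : Cmd :=
  .forLoop 7 (.var 0) (.seq mergeLayer (.seq rounds (.setN 8 (.const 0) (.add (.var 8) (.var 0)))))

/-- Add array `2` to the solution. -/
def mergeSolution : Cmd :=
  .forLoop 6 (.var 0) (.ite (.ltN (.const 0) (.get 2 (.var 6))) (.setN 1 (.var 6) (.const 1)) .skip)

/-- Array `5` becomes the set of the elements that are cheaper than the current one. -/
def cheaperThan : Cmd :=
  .forLoop 12 (.var 0) (.ite (.ltR (.get 0 (.var 12)) costJ) (.setN 5 (.var 12) (.const 1))
    (.setN 5 (.var 12) (.const 0)))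

/-- If the solution is no cover, buy all elements `j` such that the elements cheaper than `j` form no
cover. -/
def fallback : Cmd :=
  .seq (.seq (.query 3 (.const 0) 1) (.query 4 (.const 0) 4))
    (.ite (.ltR (.var 3) (.var 4))
      (.forLoop 6 (.var 0) (.seq cheaperThan
        (.seq (.query 5 (.const 0) 5)
          (.ite (.ltR (.var 5) (.var 4)) (.setN 1 (.var 6) (.const 1)) .skip)))) .skip)

/-- The program for one time step. -/
def main : Cmd :=
  .seq prepare (.seq (.setN 8 (.const 0) (.const 0)) (.seq layers (.seq mergeSolution fallback)))

end Prog

/-! ### Verification of the program -/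

/-- The universe, the costs and the layers are stored where the program expects them. -/
structure Stored (c : Fin n → ℝ) (σ : ℕ → Layer n) (m : Mem) : Prop where
  size : m.nat 0 0 = n
  costs : ∀ j : Fin n, m.real 0 j = c j
  value : ∀ i (j : Fin n), m.real 1 (i * n + j) = (σ i).1 j
  chosen : ∀ i (j : Fin n), m.nat 3 (i * n + j) ≠ 0 ↔ j ∈ (σ i).2

theorem Stored.congr {σ : ℕ → Layer n} {m m' : Mem} (h : Stored c σ m) (h0 : m'.nat 0 = m.nat 0)
    (h3 : m'.nat 3 = m.nat 3) (hr0 : m'.real 0 = m.real 0) (hr1 : m'.real 1 = m.real 1) :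
    Stored c σ m' :=
  ⟨by rw [h0, h.size], fun j => by rw [hr0, h.costs], fun i j => by rw [hr1, h.value],
    fun i j => by rw [h3, h.chosen]⟩

theorem cell_inj {i i' : ℕ} {j j' : Fin n} (h : i * n + j = i' * n + j') : i = i' ∧ j = j' := by
  have h1 : (i * n + j) / n = i := by
    rw [mul_comm, Nat.mul_add_div j.pos, Nat.div_eq_of_lt j.2, add_zero]
  have h2 : (i' * n + j') / n = i' := by
    rw [mul_comm, Nat.mul_add_div j.pos, Nat.div_eq_of_lt j'.2, add_zero]
  have e : i = i' := by rw [← h1, ← h2, h]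
  subst e
  exact ⟨rfl, Fin.ext (by omega)⟩

theorem prepare_sim {m : Mem} (hn : m.nat 0 0 = n) (hc : ∀ j : Fin n, m.real 0 j = c j)
    (σ : ℕ → Layer n) : Sim f Prog.prepare m (n * 8 + 3) (PMF.pure ()) fun _ m' =>
      m'.readSet n 4 = Finset.univ ∧ m'.readSet n 2 = lower c σ 0 := by
  refine Sim.weaken (Sim.forLoop_det (b := 5) (N₀ := n)
    (I := fun k m' => ∀ j : Fin n, j.val < k → m'.nat 4 j ≠ 0 ∧ (m'.nat 2 j ≠ 0 ↔ ¬ 0 < c j))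
    (by decide) (fun m' h => ?_) (fun k m' w h => by simpa using h) (by simp) ?_) le_rfl ?_
  · simp only [NExp.eval]
    rw [h.1 0 (by decide), hn]
  · intro k hk m' hI hm' hF
    refine Sim.of_straight (by simp [Cmd.Straight]) ?_
    have hck : m'.real 0 k = c ⟨k, hk⟩ := by rw [hF.2 0 (by decide)]; exact hc ⟨k, hk⟩
    intro j hj
    have h6 : (m'.setNat 4 k 1).nat 6 0 = k := by simpa using hm'
    simp only [Cmd.effect, NExp.eval, RExp.eval, Test.Holds, hm', h6, Mem.setNat_real, hck,
      Nat.cast_zero]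
    rcases Nat.lt_succ_iff_lt_or_eq.1 hj with h | h
    · have := hI j h
      split_ifs <;> simpa [h.ne] using this
    · have hjk : j = ⟨k, hk⟩ := Fin.ext h
      subst hjk
      split_ifs with h0 <;> simp [h0]
  · intro _ m' h
    constructor
    · ext j
      simpa [Mem.mem_readSet] using (h j j.2).1
    · ext j
      rw [Mem.mem_readSet, (h j j.2).2]
      simp [lower]

theorem mergeLayer_sim {m : Mem} {σ : ℕ → Layer n} {i : ℕ} {A : Finset (Fin n)}
    (hm : Stored c σ m) (hi : m.nat 8 0 = i * n) (hA : m.readSet n 2 = A) :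
    Sim f Prog.mergeLayer m (n * 6 + 3) (PMF.pure ()) fun _ m' =>
      m'.readSet n 2 = A ∪ (σ i).2 := by
  refine Sim.weaken (Sim.forLoop_det (b := 3) (N₀ := n)
    (I := fun k m' => m'.readSet n 2 = A ∪ (σ i).2 ∩ below n k)
    (by decide) (fun m' h => ?_) (fun k m' w h => ?_) (by simp [below_zero, hA]) ?_) le_rfl ?_
  · simp only [NExp.eval]
    rw [h.1 0 (by decide), hm.size]
  · rwa [Mem.readSet_congr (m := m') (a := 2) (by simp)]
  · intro k hk m' hI hm' hF
    refine Sim.of_straight (by simp [Cmd.Straight]) ?_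
    have h3 : m'.nat 3 (i * n + k) ≠ 0 ↔ (⟨k, hk⟩ : Fin n) ∈ (σ i).2 := by
      rw [hF.1 3 (by decide)]
      exact hm.chosen i ⟨k, hk⟩
    have h8 : m'.nat 8 0 = i * n := by rw [hF.1 8 (by decide), hi]
    simp only [Cmd.effect, NExp.eval, Test.Holds, hm', h8, Nat.pos_iff_ne_zero, h3]
    rw [below_succ hk]
    split_ifs with h
    · rw [Mem.readSet_insert (m := m') ⟨k, hk⟩ (by simp), hI, Finset.inter_insert_of_mem h,
        Finset.union_insert]
    · rw [hI, Finset.inter_insert_of_notMem h]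
  · intro _ m' h
    rw [h, below_self, Finset.inter_univ]

theorem gain_sim {m : Mem} {σ : ℕ → Layer n} {i : ℕ} {S : Finset (Fin n)}
    (hm : Stored c σ m) (hi : m.nat 8 0 = i * n) (hS : m.readSet n 2 = S)
    (h3 : m.real 3 0 = f S) (h6 : m.real 6 0 = 0) (h7 : m.real 7 0 = 0) :
    Sim f (.forLoop 6 (.var 0) Prog.gainBody) m (n * 18 + 3) (PMF.pure ()) fun _ m' =>
      m'.nat 2 = m.nat 2 ∧ (∀ j : Fin n, m'.real 2 j = gain f S j) ∧
        m'.real 6 0 = ∑ j, gain f S j * (σ i).1 j ∧ m'.real 7 0 = maxRatio c f S := by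
  refine Sim.weaken (Sim.forLoop_det (b := 15) (N₀ := n)
    (I := fun k m' => m'.nat 2 = m.nat 2 ∧
      (∀ j : Fin n, j.val < k → m'.real 2 j = gain f S j) ∧
      m'.real 6 0 = ∑ j ∈ below n k, gain f S j * (σ i).1 j ∧
      m'.real 7 0 = (below n k).fold max 0 fun j => gain f S j / c j)
    (by decide) (fun m' h => ?_) (fun k m' w h => ?_) ?_ ?_) le_rfl ?_
  · simp only [NExp.eval]
    rw [h.1 0 (by decide), hm.size]
  · simpa using h
  · simp [below_zero, h6, h7]
  · rintro k hk m' ⟨hI2, hIg, hI6, hI7⟩ hm' hF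
    refine Sim.of_straight (by simp [Cmd.Straight, Prog.gainBody]) ?_
    set j : Fin n := ⟨k, hk⟩ with hj
    have hck : m'.real 0 k = c j := by rw [hF.2 0 (by decide)]; exact hm.costs j
    have hxk : m'.real 1 (i * n + k) = (σ i).1 j := by
      rw [hF.2 1 (by decide)]; exact hm.value i j
    have h8 : m'.nat 8 0 = i * n := by rw [hF.1 8 (by decide), hi]
    have h3' : m'.real 3 0 = f S := by rw [hF.2 3 (by decide), h3]
    have hread : ((m'.setNat 11 0 (m'.nat 2 k)).setNat 2 k 1).readSet n 2 = insert j S := by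
      rw [Mem.readSet_insert (m := m') j (by simp [hj]), Mem.readSet_congr hI2, hS]
    have hg : f (insert j S) - f S = gain f S j := rfl
    have hnat : (Prog.gainBody.effect f m').nat 2 = m.nat 2 := by
      simp only [Prog.gainBody, Cmd.effect, NExp.eval, RExp.eval, Test.Holds]
      simp [hm', apply_ite Mem.nat, hI2]
    have hreal : ∀ a, (Prog.gainBody.effect f m').real a =
        (if m'.real 7 0 < gain f S j / c j then
          (((m'.setReal 5 0 (f (insert j S))).setReal 2 k (gain f S j)).setReal 6 0
            (m'.real 6 0 + gain f S j * (σ i).1 j)).setReal 7 0 (gain f S j / c j)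
        else ((m'.setReal 5 0 (f (insert j S))).setReal 2 k (gain f S j)).setReal 6 0
            (m'.real 6 0 + gain f S j * (σ i).1 j)).real a := by
      intro a
      simp only [Prog.gainBody, Cmd.effect, NExp.eval, RExp.eval, Test.Holds]
      simp [hm', hread, hck, hxk, h8, h3', hg]
      split_ifs <;> rfl
    have hfold : ((below n (k + 1)).fold max 0 fun j => gain f S j / c j) =
        max (gain f S j / c j) (m'.real 7 0) := by
      rw [below_succ hk, Finset.fold_insert (notMem_below hk), hI7]
    have hsum : ∑ j ∈ below n (k + 1), gain f S j * (σ i).1 j =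
        m'.real 6 0 + gain f S j * (σ i).1 j := by
      rw [below_succ hk, Finset.sum_insert (notMem_below hk), hI6, add_comm]
    refine ⟨hnat, fun j' hj' => ?_, ?_, ?_⟩
    · rw [hreal, apply_ite (fun m : Mem => m.real 2)]
      rcases Nat.lt_succ_iff_lt_or_eq.1 hj' with h | h
      · simp [h.ne, hIg j' h]
      · have hjj : j' = j := Fin.ext h
        subst hjj
        simp [h]
    · rw [hreal, apply_ite (fun m : Mem => m.real 6), hsum]
      simp
    · rw [hreal, apply_ite (fun m : Mem => m.real 7), hfold]
      split_ifs with h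
      · simp [max_eq_left h.le]
      · simp [max_eq_right (not_lt.1 h)]
  · intro _ m' h
    rw [below_self] at h
    exact ⟨h.1, fun j => h.2.1 j j.2, h.2.2.1, h.2.2.2⟩

theorem stored_update {σ : ℕ → Layer n} {m m' : Mem} (h : Stored c σ m) (i : ℕ) (j : Fin n)
    (x : ℝ) (hit : Bool) (h0 : m'.nat 0 = m.nat 0) (hr0 : m'.real 0 = m.real 0)
    (hr1 : m'.real 1 = Function.update (m.real 1) (i * n + j) x)
    (h3 : m'.nat 3 = if hit then Function.update (m.nat 3) (i * n + j) 1 else m.nat 3) :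
    Stored c (Function.update σ i (Function.update (σ i).1 j x,
      if hit then insert j (σ i).2 else (σ i).2)) m' := by
  refine ⟨by rw [h0, h.size], fun j => by rw [hr0, h.costs], fun i' j' => ?_, fun i' j' => ?_⟩
  · rw [hr1, Function.update_apply]
    by_cases hi : i' = i
    · subst hi
      by_cases hj : j' = j
      · subst hj
        simp
      · rw [if_neg fun e => hj (cell_inj e).2]
        simp [hj, h.value]
    · rw [if_neg fun e => hi (cell_inj e).1, h.value]
      simp [hi]
  · rw [h3]
    by_cases hi : i' = i
    · subst hi
      by_cases hj : j' = j
      · subst hj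
        cases hit <;> simp [← h.chosen]
      · have hne : i' * n + (j' : ℕ) ≠ i' * n + j := fun e => hj (cell_inj e).2
        cases hit
        · simp [← h.chosen]
        · simp only [if_true, Function.update_of_ne hne, Function.update_self, Finset.mem_insert, hj,
            false_or]
          exact h.chosen i' j'
    · have hne : i' * n + (j' : ℕ) ≠ i * n + j := fun e => hi (cell_inj e).1
      cases hit <;> simp [hne, hi, ← h.chosen]

theorem raise_sim {m : Mem} {σ : ℕ → Layer n} {i : ℕ} {A S : Finset (Fin n)}
    (hm : Stored c σ m) (hi : m.nat 8 0 = i * n) (hA : m.readSet n 2 = A ∪ (σ i).2)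
    (hg : ∀ j : Fin n, m.real 2 j = gain f S j) (h7 : m.real 7 0 = maxRatio c f S) :
    Sim f (.forLoop 6 (.var 0) Prog.raiseBody) m (n * 14 + 3) (iter (raise (rate c f S)) n (σ i))
      fun b m' => Stored c (Function.update σ i b) m' ∧ m'.readSet n 2 = A ∪ b.2 := by
  refine Sim.forLoop (b := 11)
    (I := fun _ b m' => Stored c (Function.update σ i b) m' ∧ m'.readSet n 2 = A ∪ b.2)
    (by decide) (fun m' h => ?_) (fun k b m' w h => ⟨?_, ?_⟩) ?_ ?_
  · simp only [NExp.eval]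
    rw [h.1 0 (by decide), hm.size]
  · exact h.1.congr (by simp) (by simp) (by simp) (by simp)
  · rw [Mem.readSet_congr (m := m') (a := 2) (by simp)]
    exact h.2
  · rw [Function.update_eq_self]
    exact ⟨hm, hA⟩
  · rintro k hk b m' ⟨hI, hI2⟩ hm' hF
    set j : Fin n := ⟨k, hk⟩ with hj
    have h8 : m'.nat 8 0 = i * n := by rw [hF.1 8 (by decide), hi]
    have hck : m'.real 0 k = c j := hI.costs j
    have hxk : m'.real 1 (i * n + k) = b.1 j := by
      have := hI.value i j
      simpa using this
    have hgk : m'.real 2 k = gain f S j := by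
      rw [hF.2 2 (by decide)]
      exact hg j
    have h7' : m'.real 7 0 = maxRatio c f S := by rw [hF.2 7 (by decide), h7]
    have hn' : m'.nat 0 0 = n := hI.size
    set d := incr n (b.1 j) (rate c f S j) with hd
    rw [raise, dif_pos hk, ← PMF.bind_pure_comp]
    refine Sim.weaken (b := 1 + (1 + 7 + 1) + 1) ?_ (by omega) fun _ _ h => h
    refine Sim.seq_det (b₁ := 1) (b₂ := 1 + 7 + 1) (Q := fun m₁ => m₁ = m'.setReal 8 0 d) ?_ ?_
    · refine Sim.of_straight (c := .setR _ _ _) trivial ?_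
      simp only [Cmd.effect, NExp.eval, RExp.eval, hm', h8, hxk, hgk, hck, h7', hn', hd, incr, rate,
        Nat.cast_one]
    · rintro m₁ rfl -
      refine Sim.seq (b₁ := 1) (b₂ := 7) (Q := fun hit m₂ =>
        m₂ = (m'.setReal 8 0 d).setNat 11 0 (if hit then 1 else 0)) ?_ ?_
      · have := Sim.of_runs (f := f) (Q := fun (hit : Bool) m₂ =>
          m₂ = (m'.setReal 8 0 d).setNat 11 0 (if hit then 1 else 0)) _
          (runs_flip 11 (.const 0) (.div (.var 8) (.sub (.ofNat (.const 1)) Prog.valueJ))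
            (m'.setReal 8 0 d)) (fun hit _ => rfl)
        simpa [NExp.eval, RExp.eval, hm', h8, hxk] using this
      · rintro hit m₂ rfl
        refine Sim.weaken (Sim.of_straight (by simp [Cmd.Straight]) (Q := fun b m' =>
          Stored c (Function.update σ i b) m' ∧ m'.readSet n 2 = A ∪ b.2) ⟨?_, ?_⟩) (by decide)
          fun _ _ h => h
        · have := fun m'' => stored_update (m' := m'') hI i j (b.1 j + d) hit
          simp only [Function.update_self, Function.update_idem] at this
          refine this _ ?_ ?_ ?_ ?_
          all_goals cases hit <;> simp [Cmd.effect, NExp.eval, RExp.eval, Test.Holds, hm', h8, hxk, hj]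
        · cases hit
          · rw [Mem.readSet_congr (m := m') (a := 2), hI2]
            · simp
            · simp [Cmd.effect, NExp.eval, RExp.eval, Test.Holds]
          · rw [Mem.readSet_insert (m := m') j, hI2]
            · simp [hj]
            · simp [Cmd.effect, NExp.eval, RExp.eval, Test.Holds, hm', hj]

theorem round_sim {m : Mem} {σ : ℕ → Layer n} {i : ℕ} {A : Finset (Fin n)}
    (hm : Stored c σ m) (hi : m.nat 8 0 = i * n) (hA : m.readSet n 2 = A ∪ (σ i).2)
    (h4 : m.readSet n 4 = Finset.univ) :
    Sim f Prog.roundCmd m (n * 32 + 16) (round c f A (σ i))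
      fun b m' => Stored c (Function.update σ i b) m' ∧ m'.readSet n 2 = A ∪ b.2 := by
  classical
  set S := A ∪ (σ i).2 with hS
  refine Sim.weaken (b := 7 + ((n * 18 + 3) + (n * 14 + 3 + 1) + 1) + 1) ?_ (by omega)
    fun _ _ h => h
  refine Sim.seq_det (b₁ := 7) (Q := fun m' => m'.real 3 0 = f S ∧ m'.real 4 0 = f Finset.univ ∧
    m'.real 6 0 = 0 ∧ m'.real 7 0 = 0) ?_ ?_
  · refine Sim.of_straight (by simp [Cmd.Straight]) ?_
    simp only [Cmd.effect, NExp.eval, RExp.eval]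
    have h4' : (m.setReal 3 0 (f S)).readSet n 4 = Finset.univ := by
      rw [Mem.readSet_congr (m := m) (a := 4) (by simp), h4]
    simp [h4', hA]
  rintro m₁ ⟨h3, h4', h6, h7⟩ hF
  have hm₁ : Stored c σ m₁ := hm.congr (hF.1 0 (by decide)) (hF.1 3 (by decide))
    (hF.2 0 (by decide)) (hF.2 1 (by decide))
  have hA₁ : m₁.readSet n 2 = S := by rw [Mem.readSet_congr (hF.1 2 (by decide)), hA]
  have hi₁ : m₁.nat 8 0 = i * n := by rw [hF.1 8 (by decide), hi]
  refine Sim.seq_det (gain_sim hm₁ hi₁ hA₁ h3 h6 h7) ?_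
  rintro m₂ ⟨g1, g2, g3, g4⟩ hF₂
  have hm₂ : Stored c σ m₂ := hm₁.congr (hF₂.1 0 (by decide)) (hF₂.1 3 (by decide))
    (hF₂.2 0 (by decide)) (hF₂.2 1 (by decide))
  have hA₂ : m₂.readSet n 2 = S := by rw [Mem.readSet_congr g1, hA₁]
  have hi₂ : m₂.nat 8 0 = i * n := by rw [hF₂.1 8 (by decide), hi₁]
  have htest : (Test.ltR (.var 6) (.sub (.var 4) (.var 3))).Holds m₂ ↔ Violated f A (σ i) := by
    simp only [Test.Holds, RExp.eval, NExp.eval, g3, hF₂.2 4 (by decide), hF₂.2 3 (by decide), h3,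
      h4']
    rfl
  refine Sim.ite ?_
  rw [round]
  by_cases hv : Violated f A (σ i)
  · rw [if_pos hv, if_pos (htest.2 hv)]
    exact raise_sim hm₂ hi₂ hA₂ g2 g4
  · rw [if_neg hv, if_neg fun h => hv (htest.1 h)]
    refine Sim.weaken (Sim.of_straight (c := .skip) trivial ⟨?_, hA₂⟩) (by simp [Cmd.size])
      fun _ _ h => h
    rw [Function.update_eq_self]
    exact hm₂

theorem rounds_sim {m : Mem} {σ : ℕ → Layer n} {i : ℕ} {A : Finset (Fin n)}
    (hm : Stored c σ m) (hi : m.nat 8 0 = i * n) (hA : m.readSet n 2 = A ∪ (σ i).2)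
    (h4 : m.readSet n 4 = Finset.univ) :
    Sim f Prog.rounds m ((n + 1) * ((n + 1) * (n * 32 + 19) + 6) + 3) (layerStep c f A (σ i))
      fun b m' => Stored c (Function.update σ i b) m' ∧ m'.readSet n 2 = A ∪ b.2 := by
  have hset : ∀ (v : ℕ), v ≠ 0 → v ≠ 2 → v ≠ 3 → ∀ (b : Layer n) (m' : Mem) (w : ℕ),
      (Stored c (Function.update σ i b) m' ∧ m'.readSet n 2 = A ∪ b.2) →
      (Stored c (Function.update σ i b) (m'.setNat v 0 w) ∧
        (m'.setNat v 0 w).readSet n 2 = A ∪ b.2) := by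
    intro v h0 h2 h3 b m' w h
    refine ⟨h.1.congr (Mem.setNat_nat_ne _ _ _ h0.symm) (Mem.setNat_nat_ne _ _ _ h3.symm) rfl rfl, ?_⟩
    rw [Mem.readSet_congr (m := m') (a := 2) (Mem.setNat_nat_ne _ _ _ h2.symm)]
    exact h.2
  refine Sim.forLoop (b := (n + 1) * (n * 32 + 19) + 3)
    (I := fun _ b m' => Stored c (Function.update σ i b) m' ∧ m'.readSet n 2 = A ∪ b.2)
    (by decide) (fun m' h => ?_)
    (fun _ b m' w h => hset 9 (by decide) (by decide) (by decide) b m' w h) ?_ ?_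
  · simp only [NExp.eval]
    rw [h.1 0 (by decide), hm.size]
  · rw [Function.update_eq_self]
    exact ⟨hm, hA⟩
  rintro k₁ - b₁ m₁ h₁ - hF₁
  refine Sim.forLoop (b := n * 32 + 16)
    (I := fun _ b m' => Stored c (Function.update σ i b) m' ∧ m'.readSet n 2 = A ∪ b.2)
    (by decide) (fun m' h => ?_)
    (fun _ b m' w h => hset 10 (by decide) (by decide) (by decide) b m' w h) h₁ ?_
  · simp only [NExp.eval]
    rw [h.1 0 (by decide), h₁.1.size]
  rintro k₂ - b m' ⟨h, h2⟩ - hF₂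
  have := round_sim (f := f) (A := A) (i := i) h
    (by rw [hF₂.1 8 (by decide), hF₁.1 8 (by decide), hi])
    (by rw [Function.update_self, h2])
    (by rw [Mem.readSet_congr (hF₂.1 4 (by decide)), Mem.readSet_congr (hF₁.1 4 (by decide)), h4])
  simpa only [Function.update_self, Function.update_idem] using this

/-- A bound for the running time of one layer. -/
def layerTime (n : ℕ) : ℕ := n * 6 + 3 + ((n + 1) * ((n + 1) * (n * 32 + 19) + 6) + 3 + 1 + 1) + 1

theorem layers_sim {m : Mem} {σ : ℕ → Layer n} (hm : Stored c σ m) (h8 : m.nat 8 0 = 0)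
    (h2 : m.readSet n 2 = lower c σ 0) (h4 : m.readSet n 4 = Finset.univ) :
    Sim f Prog.layers m (n * (layerTime n + 3) + 3) (iter (layerKernel c f) n σ)
      fun σ' m' => Stored c σ' m' ∧ m'.readSet n 2 = lower c σ' n := by
  refine Sim.weaken (Sim.forLoop (b := layerTime n) (N₀ := n)
    (I := fun i σ' m' => Stored c σ' m' ∧ m'.readSet n 2 = lower c σ' i ∧ m'.nat 8 0 = i * n)
    (by decide) (fun m' h => ?_) (fun i σ' m' w h => ⟨?_, ?_, ?_⟩) ⟨hm, h2, by simpa using h8⟩ ?_)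
    le_rfl fun _ _ h => ⟨h.1, h.2.1⟩
  · simp only [NExp.eval]
    rw [h.1 0 (by decide), hm.size]
  · exact h.1.congr (by simp) (by simp) rfl rfl
  · rw [Mem.readSet_congr (m := m') (a := 2) (by simp)]
    exact h.2.1
  · simpa using h.2.2
  rintro i hi σ' m' ⟨hσ, hl, ho⟩ - hF
  refine Sim.seq_det (mergeLayer_sim hσ ho hl) ?_
  intro m₁ h₁ hF₁
  have hσ₁ : Stored c σ' m₁ := hσ.congr (hF₁.1 0 (by decide)) (hF₁.1 3 (by decide))
    (hF₁.2 0 (by decide)) (hF₁.2 1 (by decide))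
  have ho₁ : m₁.nat 8 0 = i * n := by rw [hF₁.1 8 (by decide), ho]
  have h4₁ : m₁.readSet n 4 = Finset.univ := by
    rw [Mem.readSet_congr (hF₁.1 4 (by decide)), Mem.readSet_congr (hF.1 4 (by decide)), h4]
  rw [layerKernel, ← PMF.bind_pure_comp]
  refine Sim.seq (b₁ := (n + 1) * ((n + 1) * (n * 32 + 19) + 6) + 3) (b₂ := 1)
    (rounds_sim hσ₁ ho₁ h₁ h4₁).frame ?_
  rintro b m₂ ⟨⟨hσ₂, h₂⟩, hF₂⟩
  have ho₂ : m₂.nat 8 0 = i * n := by rw [hF₂.1 8 (by decide), ho₁]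
  refine Sim.of_straight (c := .setN _ _ _) trivial ⟨?_, ?_, ?_⟩
  · exact hσ₂.congr (by simp [Cmd.effect]) (by simp [Cmd.effect]) rfl rfl
  · rw [Mem.readSet_congr (m := m₂) (a := 2) (by simp [Cmd.effect]), h₂,
      lower_succ, Function.update_self,
      lower_congr c fun l hl => Function.update_of_ne (f := σ') (by omega : l ≠ i) b]
  · simp [Cmd.effect, NExp.eval, ho₂, hσ₂.size, Nat.succ_mul]

theorem mergeSolution_sim {m : Mem} (hn : m.nat 0 0 = n) :
    Sim f Prog.mergeSolution m (n * 6 + 3) (PMF.pure ()) fun _ m' =>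
      m'.readSet n 1 = m.readSet n 1 ∪ m.readSet n 2 := by
  refine Sim.weaken (Sim.forLoop_det (b := 3) (N₀ := n)
    (I := fun k m' => m'.readSet n 1 = m.readSet n 1 ∪ m.readSet n 2 ∩ below n k)
    (by decide) (fun m' h => ?_) (fun k m' w h => ?_) (by simp [below_zero]) ?_) le_rfl ?_
  · simp only [NExp.eval]
    rw [h.1 0 (by decide), hn]
  · rwa [Mem.readSet_congr (m := m') (a := 1) (by simp)]
  · intro k hk m' hI hm' hF
    refine Sim.of_straight (by simp [Cmd.Straight]) ?_
    have h2 : m'.nat 2 k ≠ 0 ↔ (⟨k, hk⟩ : Fin n) ∈ m.readSet n 2 := by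
      rw [hF.1 2 (by decide), Mem.mem_readSet]
    simp only [Cmd.effect, NExp.eval, Test.Holds, hm', Nat.pos_iff_ne_zero, h2]
    rw [below_succ hk]
    split_ifs with h
    · rw [Mem.readSet_insert (m := m') ⟨k, hk⟩ (by simp), hI, Finset.inter_insert_of_mem h,
        Finset.union_insert]
    · rw [hI, Finset.inter_insert_of_notMem h]
  · intro _ m' h
    rw [h, below_self, Finset.inter_univ]

/-- The elements that are cheaper than `j`. -/
noncomputable def cheaper (c : Fin n → ℝ) (j : Fin n) : Finset (Fin n) :=
  Finset.univ.filter fun k => c k < c j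

open scoped Classical in
/-- The elements `j` such that the elements cheaper than `j` form no cover. -/
noncomputable def bulk (c : Fin n → ℝ) (f : Finset (Fin n) → ℝ) : Finset (Fin n) :=
  Finset.univ.filter fun j => ¬ IsCover f (cheaper c j)

/-- It contains all elements cheaper than a cheapest element `j` that it lacks, and these form a cover
by the choice of `j`. -/
theorem bulk_isCover (hf : IsMonotoneSubmodular f) : IsCover f (bulk c f) := by
  classical
  by_cases h : ∃ j, j ∉ bulk c f
  · obtain ⟨j, hj, hmin⟩ := (Finset.univ.filter fun j => j ∉ bulk c f).exists_min_image c
      (h.imp fun j hj => Finset.mem_filter.2 ⟨Finset.mem_univ j, hj⟩)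
    have hj' : IsCover f (cheaper c j) := by
      simpa [bulk] using hj
    refine hf.isCover_mono (fun k hk => ?_) hj'
    by_contra hk'
    exact absurd (hmin k (by simpa using hk')) (not_le.2 (Finset.mem_filter.1 hk).2)
  · push Not at h
    rw [Finset.eq_univ_of_forall h]
    exact rfl

/-- An element of the fallback solution is no more expensive than any cover, because every cover
contains an element that costs at least as much. -/
theorem le_cost_of_mem_bulk (hc : ∀ j, 0 ≤ c j) (hf : IsMonotoneSubmodular f) {j : Fin n}
    (hj : j ∈ bulk c f) {X : Finset (Fin n)} (hX : IsCover f X) : c j ≤ cost c X := by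
  classical
  by_contra! h
  refine (Finset.mem_filter.1 hj).2 (hf.isCover_mono (fun k hk => ?_) hX)
  exact Finset.mem_filter.2 ⟨Finset.mem_univ k,
    (Finset.single_le_sum (fun k _ => hc k) hk).trans_lt h⟩

theorem cheaperThan_sim {m : Mem} (hn : m.nat 0 0 = n) (hc : ∀ j : Fin n, m.real 0 j = c j)
    {j : Fin n} (hj : m.nat 6 0 = j) :
    Sim f Prog.cheaperThan m (n * 6 + 3) (PMF.pure ()) fun _ m' =>
      m'.readSet n 5 = cheaper c j := by
  refine Sim.weaken (Sim.forLoop_det (b := 3) (N₀ := n)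
    (I := fun k m' => ∀ l : Fin n, l.val < k → (m'.nat 5 l ≠ 0 ↔ c l < c j))
    (by decide) (fun m' h => ?_) (fun k m' w h => by simpa using h) (by simp) ?_) le_rfl ?_
  · simp only [NExp.eval]
    rw [h.1 0 (by decide), hn]
  · intro k hk m' hI hm' hF
    refine Sim.of_straight (by simp [Cmd.Straight]) ?_
    have hck : m'.real 0 k = c ⟨k, hk⟩ := by rw [hF.2 0 (by decide)]; exact hc ⟨k, hk⟩
    have hcj : m'.real 0 j = c j := by rw [hF.2 0 (by decide)]; exact hc j
    have h6 : m'.nat 6 0 = j := by rw [hF.1 6 (by decide), hj]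
    intro l hl
    simp only [Cmd.effect, NExp.eval, RExp.eval, Test.Holds, hm', h6, hck, hcj]
    rcases Nat.lt_succ_iff_lt_or_eq.1 hl with h | h
    · have := hI l h
      split_ifs <;> simpa [h.ne] using this
    · have hlk : l = ⟨k, hk⟩ := Fin.ext h
      subst hlk
      split_ifs with h0 <;> simp [h0]
  · intro _ m' h
    ext l
    rw [Mem.mem_readSet, h l l.2]
    simp [cheaper]

open scoped Classical in
theorem fallback_sim (hf : IsMonotoneSubmodular f) {m : Mem} (hn : m.nat 0 0 = n)
    (hc : ∀ j : Fin n, m.real 0 j = c j) (h4 : m.readSet n 4 = Finset.univ) :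
    Sim f Prog.fallback m (n * (n * 6 + 13) + 8) (PMF.pure ()) fun _ m' =>
      m'.readSet n 1 = if IsCover f (m.readSet n 1) then m.readSet n 1 else
        m.readSet n 1 ∪ bulk c f := by
  have hlt : ∀ S : Finset (Fin n), f S < f Finset.univ ↔ ¬ IsCover f S := fun S =>
    ⟨fun h => h.ne, fun h => lt_of_le_of_ne (hf.mono _ _ (Finset.subset_univ S)) h⟩
  refine Sim.weaken (b := 3 + (n * ((n * 6 + 3) + 6 + 1 + 3) + 3 + 1) + 1) ?_ (by ring_nf; omega)
    fun _ _ h => h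
  refine Sim.seq_det (Q := fun m' => m'.real 3 0 = f (m.readSet n 1) ∧
    m'.real 4 0 = f Finset.univ) (b₁ := 3) ?_ ?_
  · refine Sim.of_straight (by simp [Cmd.Straight]) ?_
    simp only [Cmd.effect, NExp.eval]
    have h4' : (m.setReal 3 0 (f (m.readSet n 1))).readSet n 4 = Finset.univ := by
      rw [Mem.readSet_congr (m := m) (a := 4) (by simp), h4]
    simp [h4']
  rintro m₁ ⟨h3, h4'⟩ hF₁
  have hsol : m₁.readSet n 1 = m.readSet n 1 := Mem.readSet_congr (hF₁.1 1 (by decide))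
  refine Sim.ite ?_
  have htest : (Test.ltR (.var 3) (.var 4)).Holds m₁ ↔ ¬ IsCover f (m.readSet n 1) := by
    simp only [Test.Holds, RExp.eval, NExp.eval, h3, h4', hlt]
  by_cases hcov : IsCover f (m.readSet n 1)
  · rw [if_neg fun h => htest.1 h hcov, if_pos hcov]
    exact Sim.weaken (Sim.of_straight (c := .skip) trivial hsol)
      (by simp only [Cmd.size]; omega) fun _ _ h => h
  · rw [if_pos (htest.2 hcov), if_neg hcov]
    refine Sim.weaken (Sim.forLoop_det (b := (n * 6 + 3) + 6 + 1) (N₀ := n)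
      (I := fun k m' => m'.readSet n 1 = m.readSet n 1 ∪ bulk c f ∩ below n k)
      (by decide) (fun m' h => ?_) (fun k m' w h => ?_) (by simp [below_zero, hsol]) ?_) le_rfl ?_
    · simp only [NExp.eval]
      rw [h.1 0 (by decide), hF₁.1 0 (by decide), hn]
    · rwa [Mem.readSet_congr (m := m') (a := 1) (by simp)]
    · intro k hk m' hI hm' hF
      have hn' : m'.nat 0 0 = n := by rw [hF.1 0 (by decide), hF₁.1 0 (by decide), hn]
      have hc' : ∀ j : Fin n, m'.real 0 j = c j := fun j => by
        rw [hF.2 0 (by decide), hF₁.2 0 (by decide), hc]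
      refine Sim.seq_det (b₁ := n * 6 + 3) (b₂ := 6) (cheaperThan_sim (j := ⟨k, hk⟩) hn' hc' hm') ?_
      intro m₂ h5 hF₂
      refine Sim.weaken (Sim.of_straight (by simp [Cmd.Straight])
        (Q := fun _ m' => m'.readSet n 1 = m.readSet n 1 ∪ bulk c f ∩ below n (k + 1)) ?_)
        (by decide) fun _ _ h => h
      have hk6 : m₂.nat 6 0 = k := by rw [hF₂.1 6 (by decide), hm']
      have h44 : m₂.real 4 0 = f Finset.univ := by
        rw [hF₂.2 4 (by decide), hF.2 4 (by decide), h4']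
      have hI' : m₂.readSet n 1 = m.readSet n 1 ∪ bulk c f ∩ below n k := by
        rw [Mem.readSet_congr (hF₂.1 1 (by decide)), hI]
      have hmem : f (cheaper c ⟨k, hk⟩) < f Finset.univ ↔ (⟨k, hk⟩ : Fin n) ∈ bulk c f := by
        rw [hlt]
        simp [bulk]
      simp only [Cmd.effect, NExp.eval, RExp.eval, Test.Holds, h5, Mem.setReal_real_same,
        Function.update_self, Mem.setReal_real_ne m₂ (a := 5) (a' := 4) _ _ (by decide), h44, hmem,
        Mem.setReal_nat, hk6]
      rw [below_succ hk]
      split_ifs with h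
      · rw [Mem.readSet_insert (m := m₂) ⟨k, hk⟩ (by simp), hI', Finset.inter_insert_of_mem h,
          Finset.union_insert]
      · rw [Finset.inter_insert_of_notMem h, ← hI']
        exact Mem.readSet_congr rfl
    · intro _ m' h
      rw [h, below_self, Finset.inter_univ]

end Program

section Online
variable {n : ℕ} {c : Fin n → ℝ}

/-! ### Online execution -/

theorem layerStep_mono (hc : ∀ j, 0 ≤ c j) {f : Finset (Fin n) → ℝ} (hf : IsMonotoneSubmodular f)
    {A : Finset (Fin n)} {b b' : Layer n} (hb : b.Valid)
    (hb' : b' ∈ (layerStep c f A b).support) : b.2 ⊆ b'.2 := by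
  let I : ℕ → Layer n → Prop := fun _ a => a.Valid ∧ b.2 ⊆ a.2
  have hround : ∀ k < n + 1, ∀ a, I k a → ∀ a' ∈ (round c f A a).support, I (k + 1) a' := by
    rintro k - a ⟨ha, hsub⟩ a' ha'
    refine ⟨round_valid hc hf ha ha', hsub.trans ?_⟩
    unfold round at ha'
    split_ifs at ha'
    · exact (midway_end (admissible_rate hc hf A a) ha ha').sub
    · rw [(PMF.mem_support_pure_iff _ _).1 ha']
  exact (iter_support (κ := fun _ => iter (fun _ => round c f A) (n + 1)) (N := n + 1) (I := I)
    (fun k _ a ha a' ha' => iter_support (κ := fun _ => round c f A) (N := n + 1) (I := I)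
      hround ha a' ha') ⟨hb, subset_rfl⟩ b' hb').2

theorem lower_subset_lower (hc : ∀ j, 0 ≤ c j) {f : Finset (Fin n) → ℝ}
    (hf : IsMonotoneSubmodular f) {N : ℕ} {σ σ' : ℕ → Layer n} (hσ : ∀ i, (σ i).Valid)
    (h : σ' ∈ (iter (layerKernel c f) N σ).support) (k : ℕ) : lower c σ k ⊆ lower c σ' k := by
  have key := (iter_support (I := fun _ τ => (∀ i, (τ i).Valid) ∧ ∀ i, (σ i).2 ⊆ (τ i).2)
    (fun k _ τ hτ τ' hτ' => ?_) ⟨hσ, fun _ => subset_rfl⟩ σ' h).2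
  · exact Finset.union_subset_union_right (Finset.biUnion_mono fun i _ => key i)
  · obtain ⟨b, hb, rfl⟩ := (PMF.mem_support_map_iff _ _ _).1 hτ'
    refine ⟨fun i => ?_, fun i => ?_⟩
    · by_cases hik : i = k
      · subst hik
        simpa using layerStep_valid hc hf (hτ.1 i) hb
      · simpa only [Function.update_of_ne hik] using hτ.1 i
    · by_cases hik : i = k
      · subst hik
        simpa using (hτ.2 i).trans (layerStep_mono hc hf (hτ.1 i) hb)
      · simpa only [Function.update_of_ne hik] using hτ.2 i

/-- A bound for the running time of the program at one time step. -/
def mainTime (n : ℕ) : ℕ :=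
  n * 8 + 3 + (1 + (n * (layerTime n + 3) + 3 + (n * 6 + 3 + (n * (n * 6 + 13) + 8) + 1) + 1) + 1) + 1

theorem mainTime_le (n : ℕ) : mainTime n ≤ 200 * (n + 1) ^ 4 := by
  unfold mainTime layerTime
  ring_nf
  nlinarith [Nat.zero_le (n ^ 2), Nat.zero_le (n ^ 3), Nat.zero_le (n ^ 4)]

open scoped Classical in
/-- The new solution, computed from the old one, the set covered by the layers, and the fallback
set. -/
noncomputable def newSolution (c : Fin n → ℝ) (f : Finset (Fin n) → ℝ) (S A : Finset (Fin n)) :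
    Finset (Fin n) :=
  if IsCover f (S ∪ A) then S ∪ A else S ∪ A ∪ bulk c f

theorem subset_newSolution (c : Fin n → ℝ) (f : Finset (Fin n) → ℝ) (S A : Finset (Fin n)) :
    S ∪ A ⊆ newSolution c f S A := by
  unfold newSolution
  split_ifs
  · exact subset_rfl
  · exact Finset.subset_union_left

theorem newSolution_isCover {f : Finset (Fin n) → ℝ} (hf : IsMonotoneSubmodular f)
    (S A : Finset (Fin n)) : IsCover f (newSolution c f S A) := by
  unfold newSolution
  split_ifs with h
  · exact h
  · exact hf.isCover_mono Finset.subset_union_right (bulk_isCover hf)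

theorem main_sim {f : Finset (Fin n) → ℝ} (hf : IsMonotoneSubmodular f) {m : Mem}
    {σ : ℕ → Layer n} (hm : Stored c σ m) :
    Sim f Prog.main m (mainTime n) (iter (layerKernel c f) n σ) fun σ' m' => Stored c σ' m' ∧
      solution n m' = newSolution c f (solution n m) (lower c σ' n) := by
  refine Sim.seq_det (prepare_sim hm.size hm.costs σ) ?_
  rintro m₁ ⟨h4, h2⟩ hF₁
  have hm₁ : Stored c σ m₁ := hm.congr (hF₁.1 0 (by decide)) (hF₁.1 3 (by decide))
    (hF₁.2 0 (by decide)) (hF₁.2 1 (by decide))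
  refine Sim.seq_det (b₁ := 1) (Q := fun m' => m'.nat 8 0 = 0)
    (Sim.of_straight (c := .setN _ _ _) trivial (by simp [Cmd.effect, NExp.eval])) ?_
  intro m₂ h8 hF₂
  have hm₂ : Stored c σ m₂ := hm₁.congr (hF₂.1 0 (by decide)) (hF₂.1 3 (by decide))
    (hF₂.2 0 (by decide)) (hF₂.2 1 (by decide))
  rw [← PMF.bind_pure (iter (layerKernel c f) n σ)]
  refine Sim.seq (b₁ := n * (layerTime n + 3) + 3)
    (b₂ := n * 6 + 3 + (n * (n * 6 + 13) + 8) + 1) (layers_sim hm₂ h8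
      (by rw [Mem.readSet_congr (hF₂.1 2 (by decide)), h2])
      (by rw [Mem.readSet_congr (hF₂.1 4 (by decide)), h4])).frame ?_
  rintro σ' m₃ ⟨⟨hm₃, hl⟩, hF₃⟩
  refine Sim.seq_det (mergeSolution_sim hm₃.size) ?_
  intro m₄ h1 hF₄
  have hm₄ : Stored c σ' m₄ := hm₃.congr (hF₄.1 0 (by decide)) (hF₄.1 3 (by decide))
    (hF₄.2 0 (by decide)) (hF₄.2 1 (by decide))
  have h44 : m₄.readSet n 4 = Finset.univ := by
    rw [Mem.readSet_congr (hF₄.1 4 (by decide)), Mem.readSet_congr (hF₃.1 4 (by decide)),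
      Mem.readSet_congr (hF₂.1 4 (by decide)), h4]
  have := (fallback_sim hf hm₄.size hm₄.costs h44).frame.map (fun _ => σ') (Q' := fun σ' m' =>
    Stored c σ' m' ∧ solution n m' = newSolution c f (solution n m) (lower c σ' n))
    (fun _ m₅ h => ⟨hm₄.congr (h.2.1 0 (by decide)) (h.2.1 3 (by decide))
      (h.2.2 0 (by decide)) (h.2.2 1 (by decide)), by
        have hsol : m₃.readSet n 1 = m.readSet n 1 := by
          rw [Mem.readSet_congr (hF₃.1 1 (by decide)), Mem.readSet_congr (hF₂.1 1 (by decide)),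
            Mem.readSet_congr (hF₁.1 1 (by decide))]
        rw [solution, h.1, h1, hl, hsol]
        rfl⟩)
  rwa [PMF.pure_map] at this

/-- What is known between the time steps. The flag tells whether the layers have ever failed. Elements of the solution that are not in the layers have
been bought by the fallback, after a failure; none of them costs more than a cover of the current
function. -/
structure Consistent (c : Fin n → ℝ) (f : ℕ → Finset (Fin n) → ℝ) (t : ℕ)
    (z : (ℕ → Layer n) × Bool) (m : Mem) : Prop where
  stored : Stored c z.1 m
  valid : ∀ i, (z.1 i).Valid
  no_failure : z.2 = false → solution n m ⊆ lower c z.1 n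
  cheap : ∀ j ∈ solution n m, j ∉ lower c z.1 n →
    1 ≤ t ∧ ∀ X, IsCover (f t) X → c j ≤ cost c X

theorem consistent_init (c : Fin n → ℝ) (f : ℕ → Finset (Fin n) → ℝ) :
    Consistent c f 0 (fun _ => Layer.idle n, false) (initMem c) := by
  have hsol : solution n (initMem c) = ∅ := by
    ext j
    simp [solution, Mem.readSet, initMem]
  refine ⟨⟨by simp [initMem], fun j => by simp [initMem], fun i j => by simp [initMem],
    fun i j => by simp [initMem]⟩, fun i => Layer.valid_idle, fun _ => by simp [hsol],
    fun j hj => by simp [hsol] at hj⟩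

open scoped Classical in
theorem Consistent.step (hc : ∀ j, 0 ≤ c j) {f : ℕ → Finset (Fin n) → ℝ}
    (hf : ∀ t, 1 ≤ t → IsMonotoneSubmodular (f t)) (hmono : TimeMonotone f) {t : ℕ}
    {z : (ℕ → Layer n) × Bool} {m : Mem} (h : Consistent c f t z m) :
    Sim (f (t + 1)) Prog.main m (mainTime n)
      ((iter (layerKernel c (f (t + 1))) n z.1).map fun σ =>
        (σ, z.2 || decide (¬ IsCover (f (t + 1)) (lower c σ n))))
      fun z' m' => Consistent c f (t + 1) z' m' ∧ solution n m ⊆ solution n m' ∧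
        IsCover (f (t + 1)) (solution n m') := by
  have hft := hf (t + 1) (by omega)
  refine (main_sim hft h.stored).support.map _ ?_
  rintro σ' m' ⟨⟨hst, hsol⟩, hσ'⟩
  have hlow := lower_subset_lower hc hft h.valid hσ' n
  have hsub := subset_newSolution c (f (t + 1)) (solution n m) (lower c σ' n)
  refine ⟨⟨hst, layers_valid hc hft h.valid hσ', fun hflag => ?_, fun j hj hjl => ?_⟩, ?_, ?_⟩
  · simp only [Bool.or_eq_false_iff, decide_eq_false_iff_not, not_not] at hflag
    have h1 : solution n m ∪ lower c σ' n = lower c σ' n :=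
      Finset.union_eq_right.2 ((h.no_failure hflag.1).trans hlow)
    rw [hsol, newSolution, h1, if_pos hflag.2]
  · refine ⟨by omega, fun X hX => ?_⟩
    by_cases hjm : j ∈ solution n m
    · obtain ⟨ht, hle⟩ := h.cheap j hjm fun h' => hjl (hlow h')
      exact hle X (hmono t ht X hX)
    · rw [hsol, newSolution] at hj
      split_ifs at hj
      · exact absurd (Finset.mem_union.1 hj) (by tauto)
      · refine le_cost_of_mem_bulk hc hft ?_ hX
        simpa [hjm, hjl] using hj
  · rw [hsol]
    exact Finset.subset_union_left.trans hsub
  · rw [hsol]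
    exact newSolution_isCover hft _ _

/-- The memory after time step `t`, coupled with the abstract states: the expected cost may be
computed for the abstract algorithm. -/
theorem exists_coupling (hc : ∀ j, 0 ≤ c j) {f : ℕ → Finset (Fin n) → ℝ}
    (hf : ∀ t, 1 ≤ t → IsMonotoneSubmodular (f t)) (hmono : TimeMonotone f) {k : ℕ → ℕ}
    (hk : ∀ s, mainTime n ≤ k s) (t : ℕ) :
    ∃ J : PMF (((ℕ → Layer n) × Bool) × Mem), J.map Prod.fst = flagged c f t ∧
      J.map Prod.snd = memAfter Prog.main k c f t ∧
      ∀ w ∈ J.support, Consistent c f t w.1 w.2 := by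
  classical
  induction t with
  | zero =>
    refine ⟨PMF.pure ((fun _ => Layer.idle n, false), initMem c), ?_, ?_, ?_⟩
    · rw [PMF.pure_map, flagged]
    · rw [PMF.pure_map, memAfter]
    · intro w hw
      rw [(PMF.mem_support_pure_iff _ _).1 hw]
      exact consistent_init c f
  | succ t ih =>
    obtain ⟨J, h1, h2, h3⟩ := ih
    have hstep := fun (w : ((ℕ → Layer n) × Bool) × Mem) (hw : w ∈ J.support) =>
      (h3 w hw).step hc hf hmono
    have hne : Nonempty (PMF (((ℕ → Layer n) × Bool) × Mem)) := ⟨J⟩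
    choose! J' h1' h2' h3' using hstep
    refine ⟨J.bind J', ?_, ?_, ?_⟩
    · rw [flagged]
      exact coupling_bind h1 h1'
    · rw [memAfter, ← h2, PMF.map_bind, PMF.bind_map]
      refine bind_congr_of_support _ fun w hw => ?_
      rw [Function.comp_apply, (h2' w hw).stage (hk (t + 1)), PMF.map_comp]
      exact (PMF.map_id _).symm
    · intro w' hw'
      obtain ⟨w, hw, hw'⟩ := (PMF.mem_support_bind_iff _ _ _).1 hw'
      exact (h3' w hw w' hw').1

theorem Consistent.cost_le (hc : ∀ j, 0 ≤ c j) {f : ℕ → Finset (Fin n) → ℝ} {t : ℕ}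
    {z : (ℕ → Layer n) × Bool} {m : Mem} (h : Consistent c f t z m) {X : Finset (Fin n)}
    (hX : IsCover (f t) X) :
    ENNReal.ofReal (cost c (solution n m)) ≤ ENNReal.ofReal (cost c (lower c z.1 n)) +
      ENNReal.ofReal (n * cost c X) * if z.2 then 1 else 0 := by
  have hmono : ∀ {S S' : Finset (Fin n)}, S ⊆ S' → cost c S ≤ cost c S' := fun hs =>
    Finset.sum_le_sum_of_subset_of_nonneg hs fun j _ _ => hc j
  cases hz : z.2
  · simpa using ENNReal.ofReal_le_ofReal (hmono (h.no_failure hz))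
  · have h1 : cost c (solution n m \ lower c z.1 n) ≤ n * cost c X := by
      calc cost c (solution n m \ lower c z.1 n)
          ≤ ∑ _j ∈ solution n m \ lower c z.1 n, cost c X := Finset.sum_le_sum fun j hj =>
            ((h.cheap j (Finset.mem_sdiff.1 hj).1 (Finset.mem_sdiff.1 hj).2).2 X hX)
        _ = (solution n m \ lower c z.1 n).card * cost c X := by simp
        _ ≤ n * cost c X := by
            refine mul_le_mul_of_nonneg_right ?_ (cost_nonneg hc X)
            exact_mod_cast (Finset.card_le_univ _).trans (Fintype.card_fin n).le
    have h2 : cost c (solution n m) ≤ cost c (lower c z.1 n) + n * cost c X := by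
      refine (hmono (S' := lower c z.1 n ∪ (solution n m \ lower c z.1 n)) fun j hj => ?_).trans
        ((cost_union_le hc _ _).trans (by linarith))
      by_cases hjl : j ∈ lower c z.1 n
      · exact Finset.mem_union_left _ hjl
      · exact Finset.mem_union_right _ (Finset.mem_sdiff.2 ⟨hj, hjl⟩)
    simpa using (ENNReal.ofReal_le_ofReal h2).trans ENNReal.ofReal_add_le

theorem exists_optimal_cover (c : Fin n → ℝ) (f : Finset (Fin n) → ℝ) :
    ∃ X, IsCover f X ∧ cost c X = optCost c f ∧ ∀ S, IsCover f S → cost c X ≤ cost c S := by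
  have hfin : (cost c '' {S | IsCover f S}).Finite := (Set.toFinite _).image _
  have hne : (cost c '' {S | IsCover f S}).Nonempty := ⟨_, Finset.univ, rfl, rfl⟩
  obtain ⟨X, hX, e⟩ := hne.csInf_mem hfin
  exact ⟨X, hX, e, fun S hS => e ▸ csInf_le hfin.bddBelow ⟨S, hS, rfl⟩⟩

theorem TimeMonotone.isCover {f : ℕ → Finset (Fin n) → ℝ} (h : TimeMonotone f) {T : ℕ}
    {X : Finset (Fin n)} (hX : IsCover (f T) X) {t : ℕ} (ht : 1 ≤ t) (htT : t ≤ T) :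
    IsCover (f t) X := by
  induction T, htT using Nat.le_induction with
  | base => exact hX
  | succ T hT ih => exact ih (h T (ht.trans hT) X hX)

end Online
end OnlineCover

theorem theorem1p1 :
    ∃ (P : OnlineCover.Cmd) (p : Polynomial ℕ) (C : ℝ), 0 < C ∧
      ∀ (n : ℕ) (c : Fin n → ℝ) (f : ℕ → Finset (Fin n) → ℝ),
        (∀ j, 0 ≤ c j) →
        (∀ t, 1 ≤ t → OnlineCover.IsMonotoneSubmodular (f t)) →
        OnlineCover.TimeMonotone f →
        -- at every time step and for all outcomes of the coins, the program halts in polynomial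
        -- time and extends its solution to a cover for the current function
        (∀ t : ℕ, ∀ m ∈ (OnlineCover.memAfter P (fun s => p.eval (n + s)) c f t).support,
          ∀ x ∈ (OnlineCover.stage P (f (t + 1)) (p.eval (n + (t + 1))) m).support,
            x.Halted ∧
            OnlineCover.solution n m ⊆ OnlineCover.solution n x.mem ∧
            OnlineCover.IsCover (f (t + 1)) (OnlineCover.solution n x.mem)) ∧
        -- the competitive ratio
        (∀ T : ℕ, 1 ≤ T →
          OnlineCover.expectedCost c
              (OnlineCover.memAfter P (fun s => p.eval (n + s)) c f T) ≤
            ENNReal.ofReal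
              (C * (1 + Real.log n) *
                (1 + Real.log (T * OnlineCover.fTotal f T / OnlineCover.fMin f T)) *
                OnlineCover.optCost c (f T))) := by
  open OnlineCover in
  refine ⟨Prog.main, 200 * (Polynomial.X + 1) ^ 4, 51, by norm_num, ?_⟩
  intro n c f hc hf hmono
  have hk : ∀ s, mainTime n ≤ (200 * (Polynomial.X + 1) ^ 4 : Polynomial ℕ).eval (n + s) := by
    intro s
    refine (mainTime_le n).trans ?_
    simp only [Polynomial.eval_mul, Polynomial.eval_pow, Polynomial.eval_add, Polynomial.eval_X,
      Polynomial.eval_one, Polynomial.eval_ofNat]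
    gcongr
    omega
  refine ⟨fun t m hm x hx => ?_, fun T hT => ?_⟩
  · obtain ⟨J, -, h2, h3⟩ := exists_coupling hc hf hmono hk t
    rw [← h2] at hm
    obtain ⟨w, hw, rfl⟩ := (PMF.mem_support_map_iff _ _ _).1 hm
    obtain ⟨J', -, h2', h3'⟩ := (h3 w hw).step hc hf hmono
    rw [h2'.stage (hk (t + 1)), PMF.map_comp] at hx
    obtain ⟨w', hw', rfl⟩ := (PMF.mem_support_map_iff _ _ _).1 hx
    exact ⟨rfl, (h3' w' hw').2⟩
  · obtain ⟨J, h1, h2, h3⟩ := exists_coupling hc hf hmono hk T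
    obtain ⟨X, hX, hXc, hopt⟩ := exists_optimal_cover c (f T)
    rw [← hXc, ← h2]
    refine le_trans ?_ (ex_flagged_cost_le hc hf hT
      (fun t ht => hmono.isCover hX (by omega) (by omega)) hopt)
    rw [← h1, ex_map]
    change ex (J.map Prod.snd) (fun m => ENNReal.ofReal (cost c (solution n m))) ≤ _
    rw [ex_map]
    exact ex_mono fun w hw => (h3 w hw).cost_le hc hX
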